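/- Let $P(\boldsymbol\theta)$, $\boldsymbol\theta\in\mathbb R^k$, be a parameterized quantum while-program built from $\mathbf{skip}$, $q:=|0\rangle$, $\bar q:=\sigma$ ($\sigma$ a density operator), $\bar q:=U[\bar q]$ ($U$ unitary), $\bar q:=e^{-i\theta_j\sigma}[\bar q]$ ($\sigma$ a density operator), sequential composition, measurement branching $\mathbf{if}\,(\Box m\cdot M[\bar q]=m\to P_m)\,\mathbf{fi}$ and loops $\mathbf{while}\ M[\bar q]=1\ \mathbf{do}\ Q\ \mathbf{od}$, with finite-dimensional state space $\mathcal H$. Let $\theta$ be one of the parameters, let $\rho$ be a partial density operator and $O$ an observable on $\mathcal H$, and let $M$ be the largest eigenvalue of $|O|$. Let $\mu$ be a probability distribution on $\{1,2,\dots\}$ with $\mu(n)>0$ for all $n$ and $\lim_{n\to\infty}\mu(n)^{1/n}=1$. The differential program is $\frac{\partial}{\partial\theta}(P)=q_1:=|0\rangle;\,q_2:=|0\rangle;\,q_c:=|0\rangle;\,q_c:=C[q_c];\,q_c,q_2:=GP[q_c,q_2];\,T_\theta(P)$, with fresh qubits $q_1,q_2$ and a fresh variable $q_c$ with basis $\{|n\rangle:n\in\mathbb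 Z\}$. Here $C|j\rangle=|j+1\rangle$, and $GP$ acts on $|j\rangle$, $j\ge1$, as $R_y(2\arcsin\sqrt{b_j})$ on $q_2$ with $b_j=\mu(j)/(1-\sum_{i<j}\mu(i))$ (and as the identity for $j\le0$). The transformation $T_\theta$ leaves $P$ unchanged except that in front of every statement $\bar q:=e^{-i\theta\sigma}[\bar q]$ with this parameter $\theta$ it inserts the following: measure $(q_1,q_2)$ with $\{|00\rangle\langle00|,\ |01\rangle\langle01|,\ |10\rangle\langle10|+|11\rangle\langle11|\}$; on the first outcome run $q_c:=C[q_c];\,q_c,q_2:=GP[q_c,q_2]$; on the second run $q_1:=X[q_1];\,q_2:=I/2;\,\bar q':=\sigma;\,q_2,\bar q,\bar q':=AS[q_2,\bar q,\bar q']$, where $\bar q'$ is a fresh copy of $\bar q$, $AS=|0\rangle\langle0|\otimes e^{-i\frac\pi4 S}+|1\rangle\langle1|\otimes e^{i\frac\pi4S}$ and $S$ swaps $\bar q$ and $\bar q'$; on the third do nothing. Let $O_d=\sum_{j\ge1}\frac{2}{\mu(j)}|j\rangle\langle j|\otimes|1\rangle\langle1|\otimes Z$ on $(q_c,q_1,q_2)$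 and $$\langle O_d^2\otimes O^2\rangle=\operatorname{tr}\bigl((O_d^2\otimes O^2)\,[\![\tfrac{\partial}{\partial\theta}(P(\boldsymbol\theta))]\!](\rho)\bigr)\in[0,\infty].$$ Let $M_1$ be the running count of $\theta$ in $P$ (the number of statements with parameter $\theta$, where the branches of a measurement count by their maximum and a loop counts as its body), and let $M_2$ be the number of while-statements in $P$. Put $S(n)=\sum_{j=1}^n 1/\mu(j)$ (so $S(n)=0$ for $n\le0$) and $(x)_+=\max\{0,x\}$. Fix $\boldsymbol\theta$ and suppose that every while-statement $W$ occurring in $P(\boldsymbol\theta)$ terminates almost surely: $\operatorname{tr}([\![W]\!](\tau))=\operatorname{tr}(\tau)$ for all partial density operators $\tau$. Let $\varepsilon\in(0,1)$. Then there is an integer $N\ge1$ such that, for every while-statement $\mathbf{while}\ M[\bar q]=1\ \mathbf{do}\ Q\ \mathbf{od}$ occurring in $P(\boldsymbol\theta)$, with $\mathcal E_i(\tau)=M_i\tau M_i^\dagger$, $$\operatorname{tr}\bigl(\mathcal E_0\circ([\![Q]\!]\circ\mathcal E_1)^n(\tau)\bigr)\le\varepsilon^{\lfloor n/N\rfloor}\operatorname{tr}(\tau)\quad\text{for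 all } n\in\mathbb N\text{ and all partial density operators }\tau ,$$ and for every integer $N_\varepsilon=N\ge1$ with this property $$\langle O_d^2\otimes O^2\rangle\le M^2\Bigl(4S(M_1)+\sum_{k=1}^\infty\bigl(M_2+(k-1)(k^{M_2-1}-1)_+\bigr)\,S\bigl((k+1)^{M_2}M_1-1\bigr)\bigl(2\varepsilon^{\lfloor\frac{k-1}{N_\varepsilon}\rfloor}+2\varepsilon^{\lfloor\frac{k-1}{N_\varepsilon}\rfloor-1}\bigr)\Bigr),$$ where the right-hand side is taken in $[0,\infty]$ with $0\cdot\infty=0$. -/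

import Mathlib

open scoped ComplexOrder ENNReal

noncomputable section

namespace QWhile

/-! ### Operators as (possibly infinite) matrices

A quantum variable `v` has the state space `ℓ²(B v)`, where `B v` is the index set of its
orthonormal basis `{|n⟩}` and `0 : B v` is the index of `|0⟩`.  The state space of a family of
variables is `ℓ²` of the set of basis configurations.  Operators are given by their matrix entries
in this basis; products are `ℓ²`-convergent sums, which are finite sums when the space is
finite-dimensional. -/

/-- Basis configurations of all variables: the computational basis of `⨂ᵥ ℋᵥ`. -/
abbrev Cfg {V : Type} (B : V → Type) : Type := (v : V) → B v

/-- Basis configurations of the register `q̄ = (q i)ᵢ`: the computational basis of `ℋ_q̄`. -/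
abbrev Reg {V : Type} (B : V → Type) {ι : Type} (q : ι → V) : Type := (i : ι) → B (q i)

/-- Product of operators. -/
def opMul {I : Type} (A A' : Matrix I I ℂ) : Matrix I I ℂ :=
  fun f g => ∑' h, A f h * A' h g

/-- The map `ρ ↦ A ρ A†`. -/
def conjBy {I : Type} (A ρ : Matrix I I ℂ) : Matrix I I ℂ :=
  opMul (opMul A ρ) A.conjTranspose

/-- `e^{-i t σ}` on a finite-dimensional space. -/
def expGate {R : Type} [Finite R] (t : ℝ) (σ : Matrix R R ℂ) : Matrix R R ℂ :=
  letI : Fintype R := Fintype.ofFinite R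
  letI : DecidableEq R := Classical.decEq R
  NormedSpace.exp ((-(Complex.I * (t : ℂ))) • σ)

section Local

variable {V : Type} {B : V → Type} {ι : Type}

open Classical in
/-- The operator `A ⊗ I` on all variables, for `A` acting on the register `q`. -/
def lift (q : ι → V) (A : Matrix (Reg B q) (Reg B q) ℂ) : Matrix (Cfg B) (Cfg B) ℂ :=
  fun f g =>
    if ∀ v, (∀ i, q i ≠ v) → f v = g v then A (fun i => f (q i)) (fun i => g (q i)) else 0

open Classical in
/-- Overwrite the register `q` by `r` in the configuration `f`. -/
def splice (q : ι → V) (f : Cfg B) (r : Reg B q) : Cfg B :=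
  fun v => if h : ∃ i, q i = v then h.choose_spec ▸ r h.choose else f v

theorem splice_apply {q : ι → V} (hq : Function.Injective q) (f : Cfg B) (r : Reg B q) (i : ι) :
    splice q f r (q i) = r i := by
  have h : ∃ i', q i' = q i := ⟨i, rfl⟩
  have key : ∀ (i' : ι) (e : q i' = q i), (e ▸ r i' : B (q i)) = r i := by
    intro i' e
    obtain rfl := hq e
    rfl
  unfold splice
  rw [dif_pos h]
  exact key _ _

theorem splice_of_forall_ne {q : ι → V} (f : Cfg B) (r : Reg B q) {v : V} (hv : ∀ i, q i ≠ v) :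
    splice q f r v = f v := by
  unfold splice
  rw [dif_neg]
  rintro ⟨i, hi⟩
  exact hv i hi

/-- The state `tr_q̄(ρ) ⊗ σ`: the register `q` is discarded and prepared afresh in `σ`. -/
def resetTo (q : ι → V) (σ : Matrix (Reg B q) (Reg B q) ℂ) (ρ : Matrix (Cfg B) (Cfg B) ℂ) :
    Matrix (Cfg B) (Cfg B) ℂ :=
  fun f g =>
    σ (fun i => f (q i)) (fun i => g (q i)) * ∑' r : Reg B q, ρ (splice q f r) (splice q g r)

open Classical in
/-- The operator `|0⟩⟨n|` on the variable `v`. -/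
def ketZeroBra (v : V) [Zero (B v)] (n : B v) :
    Matrix (Reg B (fun _ : Unit => v)) (Reg B (fun _ : Unit => v)) ℂ :=
  fun a b => if a () = 0 ∧ b () = n then 1 else 0

end Local

/-! ### Parameterized quantum while-programs -/

/-- Syntax of `k`-parameterized quantum while-programs over the variables `V`.  A register is a
finite family of variables.  The parameter of a parameterized gate is named by its index in
`Fin k`. -/
inductive Prog {V : Type} (B : V → Type) (k : ℕ) : Type 1
  /-- `skip` -/
  | skip : Prog B k
  /-- `v := |0⟩` -/
  | init (v : V) : Prog B k
  /-- `q̄ := σ` -/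
  | initTo {ι : Type} [Fintype ι] [DecidableEq ι] (q : ι → V)
      (σ : Matrix (Reg B q) (Reg B q) ℂ) : Prog B k
  /-- `q̄ := U[q̄]` -/
  | gate {ι : Type} [Fintype ι] [DecidableEq ι] (q : ι → V)
      (U : Matrix (Reg B q) (Reg B q) ℂ) : Prog B k
  /-- `q̄ := e^{-iθⱼσ}[q̄]`, on a finite-dimensional register -/
  | pgate {ι : Type} [Fintype ι] [DecidableEq ι] (q : ι → V) [Finite (Reg B q)] (j : Fin k)
      (σ : Matrix (Reg B q) (Reg B q) ℂ) : Prog B k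
  /-- `P₁; P₂` -/
  | seq (P₁ P₂ : Prog B k) : Prog B k
  /-- `if (□ m · M[q̄] = m → Pₘ) fi` -/
  | meas {ι : Type} [Fintype ι] [DecidableEq ι] (q : ι → V) {n : ℕ}
      (M : Fin n → Matrix (Reg B q) (Reg B q) ℂ) (P : Fin n → Prog B k) : Prog B k
  /-- `while M[q̄] = 1 do P od` -/
  | loop {ι : Type} [Fintype ι] [DecidableEq ι] (q : ι → V)
      (M : Fin 2 → Matrix (Reg B q) (Reg B q) ℂ) (P : Prog B k) : Prog B k

namespace Prog

variable {V : Type} {B : V → Type} {k : ℕ}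

/-- Denotational semantics at the parameter values `θ`.  For a loop, the partial sums are
increasing in the Löwner order and of bounded trace, so that their least upper bound is the
entrywise limit. -/
def sem [∀ v, Zero (B v)] (θ : Fin k → ℝ) :
    Prog B k → Matrix (Cfg B) (Cfg B) ℂ → Matrix (Cfg B) (Cfg B) ℂ
  | skip, ρ => ρ
  | init v, ρ => fun f g => ∑' n : B v, conjBy (lift (fun _ : Unit => v) (ketZeroBra v n)) ρ f g
  | initTo q σ, ρ => resetTo q σ ρ
  | gate q U, ρ => conjBy (lift q U) ρ
  | pgate q j σ, ρ => conjBy (lift q (expGate (θ j) σ)) ρ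
  | seq P₁ P₂, ρ => P₂.sem θ (P₁.sem θ ρ)
  | meas q M P, ρ => ∑ m, (P m).sem θ (conjBy (lift q (M m)) ρ)
  | loop q M P, ρ => fun f g =>
      ∑' n : ℕ,
        conjBy (lift q (M 0)) ((fun τ => P.sem θ (conjBy (lift q (M 1)) τ))^[n] ρ) f g

/-- Well-formed programs with finite-dimensional state spaces: the variables of a register are
distinct, `σ` is a density operator, `U` is unitary, and measurements are complete. -/
def WellFormed [∀ v, Fintype (B v)] [∀ v, DecidableEq (B v)] : Prog B k → Prop
  | skip => True
  | init _ => True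
  | initTo q σ => Function.Injective q ∧ σ.PosSemidef ∧ σ.trace = 1
  | gate q U => Function.Injective q ∧ U ∈ Matrix.unitaryGroup (Reg B q) ℂ
  | pgate q _ σ => Function.Injective q ∧ σ.PosSemidef ∧ σ.trace = 1
  | seq P₁ P₂ => P₁.WellFormed ∧ P₂.WellFormed
  | meas q M P =>
      Function.Injective q ∧ ∑ m, (M m).conjTranspose * M m = 1 ∧ ∀ m, (P m).WellFormed
  | loop q M P =>
      Function.Injective q ∧ ∑ m, (M m).conjTranspose * M m = 1 ∧ P.WellFormed

/-- The running count for the parameter `j`. -/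
def runCount (j : Fin k) : Prog B k → ℕ
  | skip => 0
  | init _ => 0
  | initTo _ _ => 0
  | gate _ _ => 0
  | pgate _ j' _ => if j' = j then 1 else 0
  | seq P₁ P₂ => P₁.runCount j + P₂.runCount j
  | meas _ _ P => Finset.univ.sup fun m => (P m).runCount j
  | loop _ _ P => P.runCount j

/-- The loop count. -/
def loopCount : Prog B k → ℕ
  | skip => 0
  | init _ => 0
  | initTo _ _ => 0
  | gate _ _ => 0
  | pgate _ _ _ => 0
  | seq P₁ P₂ => P₁.loopCount + P₂.loopCount
  | meas _ _ P => ∑ m, (P m).loopCount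
  | loop _ _ P => P.loopCount + 1

/-- The while-statements occurring in a program as subprograms. -/
def loops : Prog B k → Set (Prog B k)
  | skip => ∅
  | init _ => ∅
  | initTo _ _ => ∅
  | gate _ _ => ∅
  | pgate _ _ _ => ∅
  | seq P₁ P₂ => P₁.loops ∪ P₂.loops
  | meas _ _ P => ⋃ m, (P m).loops
  | loop q M P => insert (loop q M P) P.loops

end Prog

/-- Partial density operators. -/
def IsPartialDensity {I : Type} [Fintype I] (ρ : Matrix I I ℂ) : Prop :=
  ρ.PosSemidef ∧ ρ.trace.re ≤ 1

section Finite

variable {Q : Type} [Fintype Q] [DecidableEq Q] {B : Q → Type} [∀ q, Fintype (B q)]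
  [∀ q, Zero (B q)] {k : ℕ}

/-- `P(θ)` terminates almost surely. -/
def TerminatesAS (θ : Fin k → ℝ) (P : Prog B k) : Prop :=
  ∀ ρ : Matrix (Cfg B) (Cfg B) ℂ, IsPartialDensity ρ → (P.sem θ ρ).trace = ρ.trace

/-- For `W = while M[q̄] = 1 do P od`: for all `n` and all partial density operators `ρ`,
`tr(ℰ₀ ∘ (⟦P(θ)⟧ ∘ ℰ₁)ⁿ(ρ)) ≤ ε^⌊n/N⌋ tr(ρ)`. -/
def LoopDecay (θ : Fin k → ℝ) (ε : ℝ) (N : ℕ) : Prog B k → Prop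
  | Prog.loop q M P =>
      ∀ (n : ℕ) (ρ : Matrix (Cfg B) (Cfg B) ℂ), IsPartialDensity ρ →
        (conjBy (lift q (M 0))
            ((fun τ => P.sem θ (conjBy (lift q (M 1)) τ))^[n] ρ)).trace.re
          ≤ ε ^ (n / N) * ρ.trace.re
  | _ => True

end Finite

/-- `μ` is a probability distribution on `{1, 2, …}` with positive weights that satisfies the
converging-rate condition `μ(n)^{1/n} → 1`.  The value `μ 0` plays no role. -/
structure IsRateDistribution (μ : ℕ → ℝ) : Prop where
  pos : ∀ n, 1 ≤ n → 0 < μ n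
  hasSum : HasSum (fun n => μ (n + 1)) 1
  rate : Filter.Tendsto (fun n : ℕ => μ n ^ (1 / (n : ℝ))) Filter.atTop (nhds 1)

/-! ### The differential program -/

/-- The variables of the differential program: those of the original program, a fresh copy `q'` of
each of them, the qubits `q₁`, `q₂` and the counter `q_c`. -/
inductive DVar (Q : Type) : Type
  | orig (q : Q) : DVar Q
  | copy (q : Q) : DVar Q
  | q1 : DVar Q
  | q2 : DVar Q
  | qc : DVar Q

/-- The bases: `q_c` has the basis `{|n⟩ : n ∈ ℤ}`. -/
abbrev DBasis {Q : Type} (B : Q → Type) : DVar Q → Type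
  | .orig q => B q
  | .copy q => B q
  | .q1 => Fin 2
  | .q2 => Fin 2
  | .qc => ℤ

instance instZeroDBasis {Q : Type} (B : Q → Type) [∀ q, Zero (B q)] :
    ∀ v : DVar Q, Zero (DBasis B v)
  | .orig q => inferInstanceAs (Zero (B q))
  | .copy q => inferInstanceAs (Zero (B q))
  | .q1 => inferInstanceAs (Zero (Fin 2))
  | .q2 => inferInstanceAs (Zero (Fin 2))
  | .qc => inferInstanceAs (Zero ℤ)

section Transform

variable {Q : Type} (B : Q → Type) {k : ℕ}

/-- The register `(q_c, q₂)`. -/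
abbrev regCounter : Bool → DVar Q
  | false => .qc
  | true => .q2

/-- The register `(q₁, q₂)`. -/
abbrev regFlags : Bool → DVar Q
  | false => .q1
  | true => .q2

/-- The register `(q₂, q̄, q̄')`. -/
abbrev regSwap {ι : Type} (q : ι → Q) : Option (ι ⊕ ι) → DVar Q
  | none => .q2
  | some (.inl i) => .orig (q i)
  | some (.inr i) => .copy (q i)

/-- The right translation `C = ∑ⱼ |j+1⟩⟨j|` on `q_c`. -/
def opC : Matrix (Unit → ℤ) (Unit → ℤ) ℂ :=
  fun a b => if a () = b () + 1 then 1 else 0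

/-- The Pauli matrix `X` on a qubit. -/
def opX : Matrix (Unit → Fin 2) (Unit → Fin 2) ℂ :=
  fun a b => if a () ≠ b () then 1 else 0

/-- The maximally mixed state `I/2` of a qubit. -/
def halfId : Matrix (Unit → Fin 2) (Unit → Fin 2) ℂ :=
  fun a b => if a () = b () then 1 / 2 else 0

/-- `b_j = μ(j) / (1 - ∑_{1 ≤ i < j} μ(i))`. -/
def hazard (μ : ℕ → ℝ) (j : ℕ) : ℝ :=
  μ j / (1 - ∑ i ∈ Finset.Ico 1 j, μ i)

/-- The rotation `R_y(φ)`. -/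
def rotY (φ : ℝ) : Matrix (Fin 2) (Fin 2) ℂ :=
  !![(Real.cos (φ / 2) : ℂ), -(Real.sin (φ / 2) : ℂ);
     (Real.sin (φ / 2) : ℂ), (Real.cos (φ / 2) : ℂ)]

/-- `GP = ∑_{j ≥ 1} |j⟩⟨j| ⊗ R_y(2 arcsin √b_j)` on `(q_c, q₂)`, completed to a unitary by the
identity on the states `|j⟩` with `j ≤ 0`. -/
def opGP (μ : ℕ → ℝ) :
    Matrix (Reg (DBasis B) (regCounter (Q := Q))) (Reg (DBasis B) (regCounter (Q := Q))) ℂ :=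
  fun a b =>
    let z : ℤ := a false
    let z' : ℤ := b false
    let s : Fin 2 := a true
    let s' : Fin 2 := b true
    if z = z' then
      if 1 ≤ z then rotY (2 * Real.arcsin (Real.sqrt (hazard μ z.toNat))) s s'
      else (1 : Matrix (Fin 2) (Fin 2) ℂ) s s'
    else 0

/-- The measurement `{|00⟩⟨00|, |01⟩⟨01|, |10⟩⟨10| + |11⟩⟨11|}` on `(q₁, q₂)`. -/
def measFlags (m : Fin 3) :
    Matrix (Reg (DBasis B) (regFlags (Q := Q))) (Reg (DBasis B) (regFlags (Q := Q))) ℂ :=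
  fun a b =>
    let s₁ : Fin 2 := a false
    let s₁' : Fin 2 := b false
    let s₂ : Fin 2 := a true
    let s₂' : Fin 2 := b true
    let outcome : Fin 3 := if s₁ = 0 then (if s₂ = 0 then 0 else 1) else 2
    if s₁ = s₁' ∧ s₂ = s₂' ∧ outcome = m then 1 else 0

open Classical in
/-- The SWAP operator on `R ⊗ R`. -/
def swapOp (R : Type) : Matrix (R × R) (R × R) ℂ :=
  fun a b => if a.1 = b.2 ∧ a.2 = b.1 then 1 else 0

/-- `AS = |0⟩⟨0| ⊗ e^{-iπ/4 S} + |1⟩⟨1| ⊗ e^{iπ/4 S}` on `(q₂, q̄, q̄')`. -/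
def opAS {ι : Type} (q : ι → Q) [Finite (Reg B q)] :
    Matrix (Reg (DBasis B) (regSwap q)) (Reg (DBasis B) (regSwap q)) ℂ :=
  fun a b =>
    let s : Fin 2 := a none
    let s' : Fin 2 := b none
    let x : Reg B q × Reg B q := (fun i => a (some (.inl i)), fun i => a (some (.inr i)))
    let y : Reg B q × Reg B q := (fun i => b (some (.inl i)), fun i => b (some (.inr i)))
    if s = s' then
      expGate (if s = 0 then Real.pi / 4 else -(Real.pi / 4)) (swapOp (Reg B q)) x y
    else 0

/-- `q_c := C[q_c]; q_c, q₂ := GP[q_c, q₂]`. -/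
def stepCounter (μ : ℕ → ℝ) : Prog (DBasis B) k :=
  .seq (.gate (fun _ : Unit => DVar.qc) opC) (.gate regCounter (opGP B μ))

/-- The code inserted in front of an occurrence of `q̄ := e^{-iθσ}[q̄]`. -/
def eulCode (μ : ℕ → ℝ) {ι : Type} [Fintype ι] [DecidableEq ι] (q : ι → Q) [Finite (Reg B q)]
    (σ : Matrix (Reg B q) (Reg B q) ℂ) : Prog (DBasis B) k :=
  .meas regFlags (measFlags B)
    ![stepCounter B μ,
      .seq (.gate (fun _ : Unit => DVar.q1) opX)
        (.seq (.initTo (fun _ : Unit => DVar.q2) halfId)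
          (.seq (.initTo (fun i => DVar.copy (q i)) σ)
            (.gate (regSwap q) (opAS B q)))),
      .skip]

variable {B}

/-- The code transformation `T_θ` for the parameter of index `j`. -/
def transform (μ : ℕ → ℝ) (j : Fin k) : Prog B k → Prog (DBasis B) k
  | Prog.skip => .skip
  | Prog.init v => .init (DVar.orig v)
  | Prog.initTo q σ => .initTo (fun i => DVar.orig (q i)) σ
  | Prog.gate q U => .gate (fun i => DVar.orig (q i)) U
  | @Prog.pgate _ _ _ _ i₁ i₂ q hfin j' σ =>
      let keep : Prog (DBasis B) k :=
        @Prog.pgate _ (DBasis B) k _ i₁ i₂ (fun i => DVar.orig (q i)) hfin j' σ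
      if j' = j then .seq (eulCode B μ q σ) keep else keep
  | Prog.seq P₁ P₂ => .seq (transform μ j P₁) (transform μ j P₂)
  | Prog.meas q M P => .meas (fun i => DVar.orig (q i)) M (fun m => transform μ j (P m))
  | Prog.loop q M P => .loop (fun i => DVar.orig (q i)) M (transform μ j P)

/-- The differential program `∂/∂θⱼ (P(θ)) = Dinit; T_θ(P(θ))`. -/
def diffProg (μ : ℕ → ℝ) (j : Fin k) (P : Prog B k) : Prog (DBasis B) k :=
  .seq (.init .q1) (.seq (.init .q2) (.seq (.init .qc) (.seq (stepCounter B μ)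
    (transform μ j P))))

open Classical in
/-- The input `ρ` of the original variables, with all other variables in the state `|0⟩`. -/
def extendState [∀ q, Zero (B q)] (ρ : Matrix (Cfg B) (Cfg B) ℂ) :
    Matrix (Cfg (DBasis B)) (Cfg (DBasis B)) ℂ :=
  fun f g =>
    if ∀ v : DVar Q, (∀ q, DVar.orig q ≠ v) → f v = 0 ∧ g v = 0 then
      ρ (fun q => f (.orig q)) (fun q => g (.orig q))
    else 0

/-- The diagonal entries of `O_d = ∑_{j ≥ 1} (2/μ(j)) |j⟩⟨j| ⊗ |1⟩⟨1| ⊗ Z` on `(q_c, q₁, q₂)`;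
the other entries are zero. -/
def obsD (μ : ℕ → ℝ) (z : ℤ) (s₁ s₂ : Fin 2) : ℝ :=
  if 1 ≤ z ∧ s₁ = 1 then 2 / μ z.toNat * (if s₂ = 0 then 1 else -1) else 0

open Classical in
/-- The observable `O_d² ⊗ O²` (and the identity on the copies). -/
def obsSq [Fintype (Cfg B)] (μ : ℕ → ℝ) (O : Matrix (Cfg B) (Cfg B) ℂ) :
    Matrix (Cfg (DBasis B)) (Cfg (DBasis B)) ℂ :=
  fun f g =>
    if f .qc = g .qc ∧ f .q1 = g .q1 ∧ f .q2 = g .q2 ∧ ∀ q, f (.copy q) = g (.copy q) then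
      ((obsD μ (f .qc) (f .q1) (f .q2) ^ 2 : ℝ) : ℂ) *
        (O * O) (fun q => f (.orig q)) (fun q => g (.orig q))
    else 0

/-- `tr(A ρ)` for a nonnegative observable `A` that is diagonal in `q_c`, as a value in `[0, ∞]`:
`A` may be unbounded, so the trace is summed over the blocks `q_c = z`, on each of which `A` is
bounded and contributes a nonnegative number. -/
def expectation (A ρ : Matrix (Cfg (DBasis B)) (Cfg (DBasis B)) ℂ) : ℝ≥0∞ :=
  ∑' z : ℤ, ENNReal.ofReal
    (∑' f : {f : Cfg (DBasis B) // f DVar.qc = z}, opMul A ρ f.1 f.1).re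

end Transform

/-! ### The bound -/

/-- The largest eigenvalue of `|O|`, i.e. the largest absolute value of an eigenvalue of `O`. -/
def maxAbsEigenvalue {I : Type} [Fintype I] [DecidableEq I] {O : Matrix I I ℂ}
    (hO : O.IsHermitian) : ℝ :=
  ⨆ i, |hO.eigenvalues i|

/-- `S(n) = ∑_{j=1}^n 1/μ(j)`. -/
def recipSum (μ : ℕ → ℝ) (n : ℕ) : ℝ :=
  ∑ j ∈ Finset.Icc 1 n, 1 / μ j

/-- The `k`-th summand of the bound, for `k ≥ 1`. -/
def boundTerm (μ : ℕ → ℝ) (M₁ M₂ : ℕ) (ε : ℝ) (N k : ℕ) : ℝ :=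
  ((M₂ : ℝ) + ((k : ℝ) - 1) * max 0 ((k : ℝ) ^ ((M₂ : ℤ) - 1) - 1)) *
    recipSum μ ((k + 1) ^ M₂ * M₁ - 1) *
    (2 * ε ^ ((k - 1) / N) + 2 * ε ^ ((((k - 1) / N : ℕ) : ℤ) - 1))

/-- `M² (4 S(M₁) + ∑_{k ≥ 1} …)`, a value in `[0, ∞]`. -/
def varianceBound (μ : ℕ → ℝ) (M : ℝ) (M₁ M₂ : ℕ) (ε : ℝ) (N : ℕ) : ℝ≥0∞ :=
  ENNReal.ofReal (M ^ 2) *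
    (ENNReal.ofReal (4 * recipSum μ M₁) +
      ∑' i : ℕ, ENNReal.ofReal (boundTerm μ M₁ M₂ ε N (i + 1)))

end QWhile

end

/-! Until the jump, the differential program runs `P` itself. Sort the unnormalized states of `P` by
the counter value `m`, which is one more than the number of gates with parameter θ passed so far,
and call them `r m`. They occur with weight `survival μ m` and with `q₂` rotated so that measuring
it yields 1 with conditional probability `hazard μ m`. One pass through the inserted code therefore
splits the part at `m` in two. Either it moves to `m + 1` with weight `survival μ (m + 1)`, or it is
flagged (`q₁ = 1`) with weight exactly `μ m`. A flagged state keeps its counter forever. Of the code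
run at the jump only this matters: it flags, it leaves the counter alone and it preserves traces.
The action of the swap gate plays no role for the second moment.

The invariant is `DiffState.potential`: for each `z ≥ 1`, the flagged weight at `z` plus `μ z * ∑ i
≤ z, tr (r i)` never increases, because a jump at `z` moves exactly `μ z * tr (r z)` from the second
summand to the first. Initially it equals `μ z * tr ρ`. Hence the final flagged weight at `m` is at
most `μ m * (tr ρ - ∑ i ≤ m, tr (r i))`. If every loop makes at most `n` iterations, at most
`boundedCount j n ≤ n ^ M₂ * M₁` relevant gates are passed, so the remaining sum dominates the
truncated semantics `boundedSem θ n` applied to `ρ`. `Simulates` packages both facts and is proved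
by structural induction on `P`.

On flagged states at counter `m` the observable is at most `4 M² / μ(m)²`, elsewhere it vanishes.
With `p n = tr (boundedSem θ n ρ)` and `t m` the flagged weight at `m + 1` divided by `μ (m + 1)`,
the expectation is at most `M² ∑ (4 / μ (m + 1)) t m`, where `t m ≤ 1`, and `t m ≤ tr ρ - p n` once
`n ^ M₂ * M₁ ≤ m`. Almost sure termination gives `p n → tr ρ`. So the tail telescopes into
increments of `p`, and exchanging the sums gives `4 S(M₁) + ∑ (p (n+1) - p n) * 4 S((n+1) ^ M₂ *
M₁)` over `n ≥ 1` (`tsum_tail_le`). An increment is the mass of runs whose longest loop makes `n +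
1` iterations. It is at most the number of possible loop entries times `ε ^ ((n+1)/N)`
(`rtr_boundedSem_succ_sub_le`), and the number of entries is at most a geometric sum. With `k = n +
1` this lies below the `k`-th term of the bound.

That `N` exists is a finite-dimensional fact: the maximally mixed state dominates every state up to
a constant, so termination from it is uniform over all inputs, and a uniform contraction iterates to
geometric decay. -/

section

open scoped MatrixOrder

set_option linter.unusedSectionVars false

noncomputable section

namespace QWhile

/-! ### Positive semidefinite matrices and their traces -/

section Trace

variable {I : Type} [Fintype I]

/-- The real part of the trace. -/
def rtr (A : Matrix I I ℂ) : ℝ := A.trace.re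

@[simp] theorem rtr_zero : rtr (0 : Matrix I I ℂ) = 0 := by simp [rtr]

theorem rtr_add (A A' : Matrix I I ℂ) : rtr (A + A') = rtr A + rtr A' := by simp [rtr]

theorem rtr_sub (A A' : Matrix I I ℂ) : rtr (A - A') = rtr A - rtr A' := by simp [rtr]

theorem rtr_smul (c : ℝ) (A : Matrix I I ℂ) : rtr (c • A) = c * rtr A := by
  simp [rtr, Matrix.trace_smul]

theorem rtr_sum {κ : Type*} (s : Finset κ) (A : κ → Matrix I I ℂ) :
    rtr (∑ a ∈ s, A a) = ∑ a ∈ s, rtr (A a) := by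
  simp [rtr, Matrix.trace_sum]

theorem rtr_nonneg {A : Matrix I I ℂ} (hA : 0 ≤ A) : 0 ≤ rtr A := by
  have := (Matrix.nonneg_iff_posSemidef.1 hA).trace_nonneg
  exact (Complex.le_def.1 this).1

theorem rtr_mono {A A' : Matrix I I ℂ} (h : A ≤ A') : rtr A ≤ rtr A' := by
  have := rtr_nonneg (sub_nonneg.2 h)
  rw [rtr_sub] at this
  linarith

theorem smul_nonneg_matrix {J : Type} {c : ℝ} (hc : 0 ≤ c) {A : Matrix J J ℂ} (hA : 0 ≤ A) :
    0 ≤ c • A := by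
  rw [Matrix.nonneg_iff_posSemidef] at *
  have := hA.smul (Complex.zero_le_real.2 hc)
  exact (Complex.coe_smul c A) ▸ this

theorem exists_eq_mul_conjTranspose {A : Matrix I I ℂ} (hA : 0 ≤ A) :
    ∃ S : Matrix I I ℂ, A = S * S.conjTranspose := by
  classical
  obtain ⟨X, hX, -, h⟩ := CFC.exists_sqrt_of_isSelfAdjoint_of_quasispectrumRestricts
    (Matrix.nonneg_iff_posSemidef.1 hA).isHermitian
          (QuasispectrumRestricts.nnreal_of_nonneg hA)
  exact ⟨X, by rw [← h]; congr 1; exact hX.star_eq.symm⟩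

/-- With `A = S S†` the entry is an inner product of two rows of `S`, hence at most the mean of
their squared norms, which are diagonal entries of `A`. This turns summable traces into entrywise
convergence. -/
theorem norm_entry_le_rtr {A : Matrix I I ℂ} (hA : 0 ≤ A) (f g : I) : ‖A f g‖ ≤ rtr A := by
  obtain ⟨S, rfl⟩ := exists_eq_mul_conjTranspose hA
  have hd : ∀ f, ((S * S.conjTranspose) f f).re = ∑ h, ‖S f h‖ ^ 2 := by
    intro f
    simp only [Matrix.mul_apply, Matrix.conjTranspose_apply, Complex.re_sum, Complex.star_def,
      Complex.mul_conj, Complex.ofReal_re, Complex.normSq_eq_norm_sq]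
  have hle : ∀ f, ∑ h, ‖S f h‖ ^ 2 ≤ rtr (S * S.conjTranspose) := by
    intro f
    rw [rtr, Matrix.trace, Complex.re_sum]
    rw [← hd f]
    exact Finset.single_le_sum (f := fun f => ((S * S.conjTranspose) f f).re)
      (fun i _ => by rw [hd]; positivity) (Finset.mem_univ f)
  calc ‖(S * S.conjTranspose) f g‖ ≤ ∑ h, ‖S f h * star (S g h)‖ := by
        rw [Matrix.mul_apply]; exact norm_sum_le _ _
    _ ≤ ∑ h, (‖S f h‖ ^ 2 + ‖S g h‖ ^ 2) / 2 := by
        refine Finset.sum_le_sum fun h _ => ?_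
        rw [norm_mul, norm_star]
        nlinarith [sq_nonneg (‖S f h‖ - ‖S g h‖)]
    _ = ((∑ h, ‖S f h‖ ^ 2) + ∑ h, ‖S g h‖ ^ 2) / 2 := by
        rw [← Finset.sum_div, Finset.sum_add_distrib]
    _ ≤ _ := by linarith [hle f, hle g]

theorem eq_zero_of_rtr_eq_zero {A : Matrix I I ℂ} (hA : 0 ≤ A) (h : rtr A ≤ 0) : A = 0 := by
  ext f g
  simpa using (norm_entry_le_rtr hA f g).trans h

/-- Each eigenvalue of a positive matrix is at most their sum. This is how the maximally mixed state
comes to dominate every state. -/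
theorem le_rtr_smul_one [DecidableEq I] {A : Matrix I I ℂ} (hA : 0 ≤ A) :
    A ≤ rtr A • (1 : Matrix I I ℂ) := by
  have hA' := Matrix.nonneg_iff_posSemidef.1 hA
  have h := hA'.isHermitian
  have hU := h.spectral_theorem
  rw [Matrix.le_iff]
  have key : rtr A • (1 : Matrix I I ℂ) - A = (h.eigenvectorUnitary : Matrix I I ℂ) *
      Matrix.diagonal (fun i => ((rtr A - h.eigenvalues i : ℝ) : ℂ)) *
      (h.eigenvectorUnitary : Matrix I I ℂ).conjTranspose := by
    have h1 : (h.eigenvectorUnitary : Matrix I I ℂ) *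
      (h.eigenvectorUnitary : Matrix I I ℂ).conjTranspose = 1 :=
      Unitary.mul_star_self_of_mem h.eigenvectorUnitary.2
    have h2 : Matrix.diagonal (fun i => ((rtr A - h.eigenvalues i : ℝ) : ℂ)) =
      ((rtr A : ℝ) : ℂ) • (1 : Matrix I I ℂ) -
        Matrix.diagonal (fun i => ((h.eigenvalues i : ℝ) : ℂ)) := by
      ext i k
      by_cases hik : i = k <;> simp [hik]
    rw [h2, mul_sub, sub_mul]
    congr 1
    · simp [h1]
  rw [key]
  refine Matrix.PosSemidef.mul_mul_conjTranspose_same (Matrix.PosSemidef.diagonal ?_) _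
  intro i
  have : h.eigenvalues i ≤ rtr A := by
    have h3 : rtr A = ∑ i, h.eigenvalues i := by
      rw [rtr, h.trace_eq_sum_eigenvalues]; simp
    rw [h3]
    exact Finset.single_le_sum (fun i _ => hA'.eigenvalues_nonneg i) (Finset.mem_univ i)
  simpa using this

/-- Write `S = T T†`, compress `c • 1 - A ≥ 0` by `T` and take the trace. -/
theorem rtr_mul_le_of_le_smul_one [DecidableEq I] {A S : Matrix I I ℂ} {c : ℝ}
    (hA : A ≤ c • (1 : Matrix I I ℂ)) (hS : 0 ≤ S) : rtr (A * S) ≤ c * rtr S := by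
  obtain ⟨T, rfl⟩ := exists_eq_mul_conjTranspose hS
  have h := Matrix.PosSemidef.conjTranspose_mul_mul_same (Matrix.le_iff.1 hA) T
  have h2 := rtr_nonneg (Matrix.nonneg_iff_posSemidef.2 h)
  have h3 : rtr (T.conjTranspose * (c • (1 : Matrix I I ℂ) - A) * T) =
      c * rtr (T * T.conjTranspose) - rtr (A * (T * T.conjTranspose)) := by
    rw [mul_sub, sub_mul, rtr_sub]
    congr 1
    · simp [rtr_smul]; left; rw [rtr, rtr, Matrix.trace_mul_comm]
    · rw [rtr, rtr, Matrix.mul_assoc, Matrix.trace_mul_comm, Matrix.mul_assoc]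
  linarith

/-- A series of positive matrices with summable traces converges entrywise. -/
theorem summable_entry {A : ℕ → Matrix I I ℂ} (hA : ∀ n, 0 ≤ A n)
    (hs : Summable fun n => rtr (A n)) (f g : I) : Summable fun n => A n f g :=
  Summable.of_norm_bounded hs fun n => norm_entry_le_rtr (hA n) f g

/-- Guarantees that the entrywise `∑'` in the semantics of a loop is a genuine sum of matrices and
not a default value. -/
theorem hasSum_matrix {A : ℕ → Matrix I I ℂ} (hA : ∀ n, 0 ≤ A n)
    (hs : Summable fun n => rtr (A n)) :
    HasSum A (fun f g => ∑' n, A n f g : Matrix I I ℂ) := by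
  refine Pi.hasSum.2 fun f => Pi.hasSum.2 fun g => ?_
  exact (summable_entry hA hs f g).hasSum

theorem nonneg_of_hasSum {A : ℕ → Matrix I I ℂ} {S : Matrix I I ℂ} (hA : ∀ n, 0 ≤ A n)
    (hS : HasSum A S) : 0 ≤ S := by
  rw [Matrix.nonneg_iff_posSemidef]
  have hA' := fun n => Matrix.nonneg_iff_posSemidef.1 (hA n)
  have he : ∀ f g, HasSum (fun n => A n f g) (S f g) := fun f g =>
    Pi.hasSum.1 (Pi.hasSum.1 hS f) g
  refine Matrix.PosSemidef.of_dotProduct_mulVec_nonneg ?_ fun x => ?_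
  · ext f g
    have h1 := (he g f).star
    have h2 : (fun n => star (A n g f)) = fun n => A n f g := by
      ext n; exact (hA' n).1.apply f g
    rw [h2] at h1
    exact h1.unique (he f g)
  · have h1 : HasSum (fun n => star x ⬝ᵥ (A n).mulVec x) (star x ⬝ᵥ S.mulVec x) := by
      simp only [dotProduct, Matrix.mulVec]
      refine hasSum_sum fun f _ => HasSum.mul_left _ (hasSum_sum fun g _ => (he f g).mul_right _)
    exact h1.nonneg fun n => (hA' n).dotProduct_mulVec_nonneg x

theorem hasSum_rtr {A : ℕ → Matrix I I ℂ} {S : Matrix I I ℂ}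
    (hS : HasSum A S) : HasSum (fun n => rtr (A n)) (rtr S) := by
  have he : ∀ f g, HasSum (fun n => A n f g) (S f g) := fun f g =>
    Pi.hasSum.1 (Pi.hasSum.1 hS f) g
  have : HasSum (fun n => (A n).trace) S.trace := hasSum_sum fun f _ => he f f
  exact Complex.hasSum_re this

theorem sum_le_of_hasSum {A : ℕ → Matrix I I ℂ} {S : Matrix I I ℂ} (hA : ∀ n, 0 ≤ A n)
    (hS : HasSum A S) (n : ℕ) : ∑ i ∈ Finset.range n, A i ≤ S := by
  have h := (hasSum_nat_add_iff' n).2 hS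
  exact sub_nonneg.1 (nonneg_of_hasSum (fun i => hA (i + n)) h)

end Trace

/-! ### Operators on a register -/

section Register

variable {V : Type} {B : V → Type} {ι : Type}

theorem splice_injective {q : ι → V} (hq : Function.Injective q) (f : Cfg B) :
    Function.Injective (splice q f) := by
  intro r r' h
  funext i
  rw [← splice_apply hq f r i, h, splice_apply hq]

theorem splice_eq_of_agree {q : ι → V} (hq : Function.Injective q) {f g : Cfg B}
    (h : ∀ v, (∀ i, q i ≠ v) → f v = g v) : splice q f (fun i => g (q i)) = g := by
  funext v
  by_cases hv : ∃ i, q i = v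
  · obtain ⟨i, rfl⟩ := hv
    rw [splice_apply hq]
  · push Not at hv
    rw [splice_of_forall_ne f _ hv, h v hv]

theorem lift_splice {q : ι → V} (hq : Function.Injective q) (A : Matrix (Reg B q) (Reg B q) ℂ)
    (f : Cfg B) (r : Reg B q) :
    lift q A f (splice q f r) = A (fun i => f (q i)) r := by
  unfold lift
  rw [if_pos fun v hv => (splice_of_forall_ne f r hv).symm]
  congr 1
  funext i
  exact splice_apply hq f r i

theorem exists_splice_of_lift_ne_zero {q : ι → V} (hq : Function.Injective q)
    {A : Matrix (Reg B q) (Reg B q) ℂ} {f h : Cfg B} (hne : lift q A f h ≠ 0) :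
    splice q f (fun i => h (q i)) = h := by
  refine splice_eq_of_agree hq ?_
  by_contra hcon
  exact hne (by unfold lift; rw [if_neg hcon])

theorem lift_conjTranspose (q : ι → V) (A : Matrix (Reg B q) (Reg B q) ℂ) :
    (lift q A).conjTranspose = lift q A.conjTranspose := by
  ext f g
  rw [Matrix.conjTranspose_apply]
  unfold lift
  by_cases h : ∀ v, (∀ i, q i ≠ v) → f v = g v
  · rw [if_pos h, if_pos fun v hv => (h v hv).symm]
    rfl
  · rw [if_neg h, if_neg fun h' => h fun v hv => (h' v hv).symm, star_zero]

/-- Row `f` of the lifted operator is supported on the configurations agreeing with `f` off the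
register, and `splice` parametrizes these injectively by register values. A sum over all
configurations, infinite because of the counter, becomes a sum over the register. -/
theorem opMul_lift {q : ι → V} (hq : Function.Injective q) (A : Matrix (Reg B q) (Reg B q) ℂ)
    (X : Matrix (Cfg B) (Cfg B) ℂ) (f g : Cfg B) :
    opMul (lift q A) X f g = ∑' r : Reg B q, A (fun i => f (q i)) r * X (splice q f r) g := by
  unfold opMul
  rw [← (splice_injective hq f).tsum_eq]
  · simp only [lift_splice hq]
  · intro h hh
    exact ⟨_, exists_splice_of_lift_ne_zero hq (left_ne_zero_of_mul hh)⟩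

theorem opMul_lift_conjTranspose {q : ι → V} (hq : Function.Injective q)
    (A : Matrix (Reg B q) (Reg B q) ℂ) (X : Matrix (Cfg B) (Cfg B) ℂ) (f g : Cfg B) :
    opMul X (lift q A).conjTranspose f g =
      ∑' r : Reg B q, X f (splice q g r) * star (A (fun i => g (q i)) r) := by
  unfold opMul
  rw [← (splice_injective hq g).tsum_eq]
  · simp only [Matrix.conjTranspose_apply, lift_splice hq]
  · intro h hh
    refine ⟨_, exists_splice_of_lift_ne_zero hq (A := A) (f := g) (h := h) ?_⟩
    intro h0
    apply right_ne_zero_of_mul hh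
    simp [h0]

theorem conjBy_lift {q : ι → V} (hq : Function.Injective q) [Fintype (Reg B q)]
    (A : Matrix (Reg B q) (Reg B q) ℂ) (X : Matrix (Cfg B) (Cfg B) ℂ) (f g : Cfg B) :
    conjBy (lift q A) X f g = ∑ r' : Reg B q, ∑ r : Reg B q,
      A (fun i => f (q i)) r * X (splice q f r) (splice q g r') *
        star (A (fun i => g (q i)) r') := by
  unfold conjBy
  rw [opMul_lift_conjTranspose hq]
  simp only [opMul_lift hq, tsum_fintype, Finset.sum_mul]

theorem conjBy_lift_add {q : ι → V} (hq : Function.Injective q) [Finite (Reg B q)]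
    (A : Matrix (Reg B q) (Reg B q) ℂ) (X Y : Matrix (Cfg B) (Cfg B) ℂ) :
    conjBy (lift q A) (X + Y) = conjBy (lift q A) X + conjBy (lift q A) Y := by
  have := Fintype.ofFinite (Reg B q)
  ext f g
  simp only [Matrix.add_apply, conjBy_lift hq, mul_add, add_mul, Finset.sum_add_distrib]

theorem lift_splice_left {q : ι → V} (hq : Function.Injective q)
    (A : Matrix (Reg B q) (Reg B q) ℂ) (f g : Cfg B) (r : Reg B q) [Decidable
      (∀ v, (∀ i, q i ≠ v) → f v = g v)] :
    lift q A (splice q f r) g =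
      if ∀ v, (∀ i, q i ≠ v) → f v = g v then A r (fun i => g (q i)) else 0 := by
  unfold lift
  have h1 : (∀ v, (∀ i, q i ≠ v) → splice q f r v = g v) ↔
      (∀ v, (∀ i, q i ≠ v) → f v = g v) := by
    refine forall_congr' fun v => imp_congr_right fun hv => ?_
    rw [splice_of_forall_ne f r hv]
  have h2 : (fun i => splice q f r (q i)) = r := funext fun i => splice_apply hq f r i
  simp only [h1, h2]

theorem opMul_lift_lift {q : ι → V} (hq : Function.Injective q) [Fintype (Reg B q)]
    (A A' : Matrix (Reg B q) (Reg B q) ℂ) :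
    opMul (lift q A) (lift q A') = lift q (A * A') := by
  classical
  ext f g
  rw [opMul_lift hq, tsum_fintype]
  rw [Finset.sum_congr rfl fun r _ => by rw [lift_splice_left hq A' f g r]]
  unfold lift
  split_ifs
  · rw [Matrix.mul_apply]
  · simp

theorem lift_one {q : ι → V} (hq : Function.Injective q) [DecidableEq (Reg B q)]
    [DecidableEq (Cfg B)] : lift q (1 : Matrix (Reg B q) (Reg B q) ℂ) = 1 := by
  ext f g
  unfold lift
  by_cases h : f = g
  · subst h; simp
  · rw [Matrix.one_apply_ne h]
    split_ifs with h1
    · refine Matrix.one_apply_ne fun h2 => h ?_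
      rw [← splice_eq_of_agree hq h1, ← h2]
      exact (splice_eq_of_agree hq (fun _ _ => rfl)).symm
    · rfl

theorem lift_sum {κ : Type*} (q : ι → V) (s : Finset κ)
    (A : κ → Matrix (Reg B q) (Reg B q) ℂ) : lift q (∑ a ∈ s, A a) = ∑ a ∈ s, lift q (A a) := by
  ext f g
  simp only [lift, Matrix.sum_apply]
  split_ifs <;> simp

/-- A register operation cannot change the value of a variable outside the register. -/
theorem conjBy_lift_support {q : ι → V} (hq : Function.Injective q) [Finite (Reg B q)]
    (A : Matrix (Reg B q) (Reg B q) ℂ) {v : V} (hv : ∀ i, q i ≠ v) (p : B v → B v → Prop)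
    {X : Matrix (Cfg B) (Cfg B) ℂ} (hX : ∀ f g, X f g ≠ 0 → p (f v) (g v)) (f g : Cfg B)
    (hne : conjBy (lift q A) X f g ≠ 0) : p (f v) (g v) := by
  have := Fintype.ofFinite (Reg B q)
  rw [conjBy_lift hq] at hne
  obtain ⟨r', -, h1⟩ := Finset.exists_ne_zero_of_sum_ne_zero hne
  obtain ⟨r, -, h2⟩ := Finset.exists_ne_zero_of_sum_ne_zero h1
  have := hX _ _ (right_ne_zero_of_mul (left_ne_zero_of_mul h2))
  rwa [splice_of_forall_ne _ _ hv, splice_of_forall_ne _ _ hv] at this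

open Classical in
/-- The Kraus operators of the preparation of a state `S S†`. -/
def resetKraus {R : Type} (S : Matrix R R ℂ) (a : R × R) : Matrix R R ℂ :=
  fun x y => if y = a.2 then S x a.1 else 0

/-- Discarding a register and preparing it in a state `σ = S S†` in Kraus form. -/
theorem resetTo_eq_sum {q : ι → V} (hq : Function.Injective q) [Fintype (Reg B q)]
    (S : Matrix (Reg B q) (Reg B q) ℂ) (X : Matrix (Cfg B) (Cfg B) ℂ) :
    resetTo q (S * S.conjTranspose) X =
      ∑ a : Reg B q × Reg B q,
        conjBy (lift q (resetKraus S a)) X := by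
  ext f g
  rw [Matrix.sum_apply, Fintype.sum_prod_type]
  simp only [resetTo, tsum_fintype, Matrix.mul_apply, Matrix.conjTranspose_apply, Finset.sum_mul]
  refine Finset.sum_congr rfl fun l _ => ?_
  rw [Finset.mul_sum]
  refine Finset.sum_congr rfl fun r _ => ?_
  rw [conjBy_lift hq, Finset.sum_eq_single r, Finset.sum_eq_single r]
  · simp only [resetKraus, if_true]; ring
  · intro b _ hb; simp [resetKraus, hb]
  · simp
  · intro b _ hb; simp [resetKraus, hb]
  · simp

/-- The operators are `S|l⟩⟨r|`, so the sum is `∑ l, ‖S|l⟩‖²` times the resolution of the identity,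
and the first factor is `tr (S S†) = 1`. -/
theorem resetKraus_complete {R : Type} [Fintype R] [DecidableEq R] (S : Matrix R R ℂ)
    (hS : (S * S.conjTranspose).trace = 1) :
    ∑ a : R × R, (resetKraus S a).conjTranspose * resetKraus S a = 1 := by
  ext x y
  simp only [Matrix.sum_apply, Matrix.mul_apply, Matrix.conjTranspose_apply,
    Fintype.sum_prod_type, resetKraus]
  simp only [Matrix.trace, Matrix.diag, Matrix.mul_apply, Matrix.conjTranspose_apply] at hS
  by_cases h : x = y
  · subst h
    rw [Matrix.one_apply_eq, ← hS, Finset.sum_comm, Finset.sum_eq_single x]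
    · simp only [if_true]
      rw [Finset.sum_comm]
      refine Finset.sum_congr rfl fun _ _ => Finset.sum_congr rfl fun _ _ => mul_comm _ _
    · intro b _ hb; simp [hb.symm]
    · simp
  · rw [Matrix.one_apply_ne h]
    refine Finset.sum_eq_zero fun l _ => Finset.sum_eq_zero fun r _ =>
      Finset.sum_eq_zero fun k _ => ?_
    by_cases h1 : x = r
    · subst h1; simp [Ne.symm h]
    · simp [h1]

theorem ketZeroBra_complete {v : V} [Zero (B v)] [Fintype (B v)] [DecidableEq (B v)] :
    ∑ n : B v, (ketZeroBra v n).conjTranspose * ketZeroBra v n = 1 := by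
  ext x y
  simp only [Matrix.sum_apply, Matrix.mul_apply, Matrix.conjTranspose_apply, ketZeroBra]
  by_cases h : x = y
  · subst h
    rw [Matrix.one_apply_eq, Finset.sum_eq_single (x ()), Finset.sum_eq_single (fun _ => 0)]
    · simp
    · intro b _ hb
      have : b () ≠ 0 := fun h => hb (funext fun _ => h)
      simp [this]
    · simp
    · intro b _ hb; simp [hb.symm]
    · simp
  · rw [Matrix.one_apply_ne h]
    refine Finset.sum_eq_zero fun l _ => Finset.sum_eq_zero fun r _ => ?_
    by_cases h1 : x () = l
    · subst h1
      have : ¬ y () = x () := fun h2 => h (funext fun _ => h2.symm)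
      simp [this]
    · simp [h1]

end Register

/-! ### Quantum operations on the positive cone -/

section Operation

variable {I : Type} [Fintype I]

/-- A positive, trace-nonincreasing operation, additive and homogeneous on the positive cone. -/
structure IsOp (Φ : Matrix I I ℂ → Matrix I I ℂ) : Prop where
  add : ∀ {ρ τ : Matrix I I ℂ}, 0 ≤ ρ → 0 ≤ τ → Φ (ρ + τ) = Φ ρ + Φ τ
  smul : ∀ {c : ℝ} {ρ : Matrix I I ℂ}, 0 ≤ c → 0 ≤ ρ → Φ (c • ρ) = c • Φ ρ
  nonneg : ∀ {ρ : Matrix I I ℂ}, 0 ≤ ρ → 0 ≤ Φ ρ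
  rtr_le : ∀ {ρ : Matrix I I ℂ}, 0 ≤ ρ → rtr (Φ ρ) ≤ rtr ρ

namespace IsOp

variable {Φ Ψ : Matrix I I ℂ → Matrix I I ℂ}

/-- Additivity is available on the positive cone only, so differences can be taken only along the
Löwner order. -/
theorem sub_eq (h : IsOp Φ) {ρ τ : Matrix I I ℂ} (hρ : 0 ≤ ρ) (hle : ρ ≤ τ) :
    Φ (τ - ρ) = Φ τ - Φ ρ := by
  rw [eq_sub_iff_add_eq, ← h.add (sub_nonneg.2 hle) hρ, sub_add_cancel]

theorem mono (h : IsOp Φ) {ρ τ : Matrix I I ℂ} (hρ : 0 ≤ ρ) (hle : ρ ≤ τ) : Φ ρ ≤ Φ τ := by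
  rw [← sub_nonneg, ← h.sub_eq hρ hle]
  exact h.nonneg (sub_nonneg.2 hle)

theorem map_zero (h : IsOp Φ) : Φ 0 = 0 := by
  simpa using h.smul (c := 0) (ρ := 0) le_rfl le_rfl

theorem sum {κ : Type*} (h : IsOp Φ) (s : Finset κ) {A : κ → Matrix I I ℂ}
    (hA : ∀ a, 0 ≤ A a) : Φ (∑ a ∈ s, A a) = ∑ a ∈ s, Φ (A a) := by
  classical
  induction s using Finset.induction_on with
  | empty => simp [h.map_zero]
  | insert a s ha ih =>
    rw [Finset.sum_insert ha, Finset.sum_insert ha, h.add (hA a)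
      (Finset.sum_nonneg fun b _ => hA b), ih]

protected theorem id : IsOp (fun ρ : Matrix I I ℂ => ρ) :=
  ⟨fun _ _ => rfl, fun _ _ => rfl, fun h => h, fun _ => le_rfl⟩

theorem comp (h : IsOp Φ) (h' : IsOp Ψ) : IsOp (fun ρ => Φ (Ψ ρ)) where
  add hρ hτ := by rw [h'.add hρ hτ, h.add (h'.nonneg hρ) (h'.nonneg hτ)]
  smul hc hρ := by rw [h'.smul hc hρ, h.smul hc (h'.nonneg hρ)]
  nonneg hρ := h.nonneg (h'.nonneg hρ)
  rtr_le hρ := (h.rtr_le (h'.nonneg hρ)).trans (h'.rtr_le hρ)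

theorem iterate (h : IsOp Φ) (n : ℕ) : IsOp (Φ^[n]) := by
  induction n with
  | zero => exact IsOp.id
  | succ n ih =>
    rw [Function.iterate_succ]
    exact ih.comp h

end IsOp

theorem opMul_eq_mul (A A' : Matrix I I ℂ) : opMul A A' = A * A' := by
  ext f g
  simp [opMul, Matrix.mul_apply, tsum_fintype]

theorem conjBy_eq (A ρ : Matrix I I ℂ) : conjBy A ρ = A * ρ * A.conjTranspose := by
  simp [conjBy, opMul_eq_mul]

theorem rtr_conj (A ρ : Matrix I I ℂ) :
    rtr (A * ρ * A.conjTranspose) = rtr (A.conjTranspose * A * ρ) := by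
  rw [rtr, rtr, Matrix.trace_mul_comm, Matrix.mul_assoc]

theorem sum_rtr_conj [DecidableEq I] {κ : Type*} [Fintype κ] {A : κ → Matrix I I ℂ}
    (hA : ∑ a, (A a).conjTranspose * A a = 1) (ρ : Matrix I I ℂ) :
    ∑ a, rtr (A a * ρ * (A a).conjTranspose) = rtr ρ := by
  simp only [rtr_conj]
  rw [← rtr_sum, ← Finset.sum_mul, hA, one_mul]

theorem conj_nonneg {J : Type} [Fintype J] (A : Matrix J I ℂ) {ρ : Matrix I I ℂ} (hρ : 0 ≤ ρ) :
    0 ≤ A * ρ * A.conjTranspose :=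
  Matrix.nonneg_iff_posSemidef.2
    ((Matrix.nonneg_iff_posSemidef.1 hρ).mul_mul_conjTranspose_same A)

theorem isOp_conjBy [DecidableEq I] {κ : Type*} [Fintype κ] {A : κ → Matrix I I ℂ}
    (hA : ∑ a, (A a).conjTranspose * A a = 1) (a : κ) : IsOp (conjBy (A a)) where
  add _ _ := by simp [conjBy_eq, mul_add, add_mul]
  smul _ _ := by simp [conjBy_eq]
  nonneg hρ := by rw [conjBy_eq]; exact conj_nonneg _ hρ
  rtr_le {ρ} hρ := by
    rw [conjBy_eq, ← sum_rtr_conj hA ρ]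
    exact Finset.single_le_sum (f := fun a => rtr (A a * ρ * (A a).conjTranspose))
      (fun i _ => rtr_nonneg (conj_nonneg _ hρ)) (Finset.mem_univ a)

theorem sum_rtr_conjBy [DecidableEq I] {κ : Type*} [Fintype κ] {A : κ → Matrix I I ℂ}
    (hA : ∑ a, (A a).conjTranspose * A a = 1) (ρ : Matrix I I ℂ) :
    ∑ a, rtr (conjBy (A a) ρ) = rtr ρ := by
  simp only [conjBy_eq, sum_rtr_conj hA]

theorem isOp_branch [DecidableEq I] {κ : Type*} [Fintype κ] {A : κ → Matrix I I ℂ}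
    (hA : ∑ a, (A a).conjTranspose * A a = 1) {Φ : κ → Matrix I I ℂ → Matrix I I ℂ}
    (hΦ : ∀ a, IsOp (Φ a)) : IsOp (fun ρ => ∑ a, Φ a (conjBy (A a) ρ)) where
  add hρ hτ := by
    rw [← Finset.sum_add_distrib]
    exact Finset.sum_congr rfl fun a _ => ((hΦ a).comp (isOp_conjBy hA a)).add hρ hτ
  smul hc hρ := by
    rw [Finset.smul_sum]
    exact Finset.sum_congr rfl fun a _ => ((hΦ a).comp (isOp_conjBy hA a)).smul hc hρ
  nonneg hρ := Finset.sum_nonneg fun a _ => ((hΦ a).comp (isOp_conjBy hA a)).nonneg hρ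
  rtr_le {ρ} hρ := by
    rw [rtr_sum, ← sum_rtr_conjBy hA ρ]
    exact Finset.sum_le_sum fun a _ => (hΦ a).rtr_le ((isOp_conjBy hA a).nonneg hρ)

theorem isOp_kraus [DecidableEq I] {κ : Type*} [Fintype κ] {A : κ → Matrix I I ℂ}
    (hA : ∑ a, (A a).conjTranspose * A a = 1) : IsOp (fun ρ => ∑ a, conjBy (A a) ρ) :=
  isOp_branch hA (fun _ => IsOp.id)

/-! ### Iterated measurement -/

section Loop

variable {E₀ E₁ Φ Ψ : Matrix I I ℂ → Matrix I I ℂ}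

theorem rtr_exit_add_le (hΦ : IsOp Φ) (hE₁ : IsOp E₁)
    (hE : ∀ ρ, rtr (E₀ ρ) + rtr (E₁ ρ) = rtr ρ) {ρ : Matrix I I ℂ} (hρ : 0 ≤ ρ) :
    rtr (E₀ ρ) + rtr (Φ (E₁ ρ)) ≤ rtr ρ := by
  linarith [hE ρ, hΦ.rtr_le (hE₁.nonneg hρ)]

/-- Each measurement conserves mass and the body does not create any, so what has left in the first
`n` rounds and what is still inside together never exceed the input. -/
theorem sum_exit_le (hΦ : IsOp Φ) (hE₁ : IsOp E₁)
    (hE : ∀ ρ, rtr (E₀ ρ) + rtr (E₁ ρ) = rtr ρ) {ρ : Matrix I I ℂ} (hρ : 0 ≤ ρ) (n : ℕ) :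
    ∑ i ∈ Finset.range n, rtr (E₀ ((fun τ => Φ (E₁ τ))^[i] ρ)) +
      rtr ((fun τ => Φ (E₁ τ))^[n] ρ) ≤ rtr ρ := by
  induction n with
  | zero => simp
  | succ n ih =>
    rw [Finset.sum_range_succ, Function.iterate_succ_apply']
    have := rtr_exit_add_le hΦ hE₁ hE (((hΦ.comp hE₁).iterate n).nonneg hρ)
    linarith

theorem exit_summable (hΦ : IsOp Φ) (hE₀ : IsOp E₀) (hE₁ : IsOp E₁)
    (hE : ∀ ρ, rtr (E₀ ρ) + rtr (E₁ ρ) = rtr ρ) {ρ : Matrix I I ℂ} (hρ : 0 ≤ ρ) :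
    Summable fun n => rtr (E₀ ((fun τ => Φ (E₁ τ))^[n] ρ)) := by
  refine summable_of_sum_range_le (c := rtr ρ)
    (fun n => rtr_nonneg (hE₀.nonneg (((hΦ.comp hE₁).iterate n).nonneg hρ))) fun n => ?_
  have := sum_exit_le hΦ hE₁ hE hρ n
  have h2 := rtr_nonneg (((hΦ.comp hE₁).iterate n).nonneg hρ)
  linarith

theorem loop_hasSum (hΦ : IsOp Φ) (hE₀ : IsOp E₀) (hE₁ : IsOp E₁)
    (hE : ∀ ρ, rtr (E₀ ρ) + rtr (E₁ ρ) = rtr ρ) {ρ : Matrix I I ℂ} (hρ : 0 ≤ ρ) :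
    HasSum (fun n => E₀ ((fun τ => Φ (E₁ τ))^[n] ρ))
      (fun f g => ∑' n, E₀ ((fun τ => Φ (E₁ τ))^[n] ρ) f g : Matrix I I ℂ) :=
  hasSum_matrix (fun n => hE₀.nonneg (((hΦ.comp hE₁).iterate n).nonneg hρ))
    (exit_summable hΦ hE₀ hE₁ hE hρ)

/-- Additivity and homogeneity pass to the series by uniqueness of sums; the trace bound is the
bookkeeping of `sum_exit_le`. -/
theorem isOp_loop (hΦ : IsOp Φ) (hE₀ : IsOp E₀) (hE₁ : IsOp E₁)
    (hE : ∀ ρ, rtr (E₀ ρ) + rtr (E₁ ρ) = rtr ρ) :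
    IsOp (fun ρ f g => ∑' n, E₀ ((fun τ => Φ (E₁ τ))^[n] ρ) f g) where
  add hρ hτ := by
    refine (loop_hasSum hΦ hE₀ hE₁ hE (add_nonneg hρ hτ)).unique ?_
    have h := (loop_hasSum hΦ hE₀ hE₁ hE hρ).add (loop_hasSum hΦ hE₀ hE₁ hE hτ)
    convert h using 2 with n
    exact (hE₀.comp ((hΦ.comp hE₁).iterate n)).add hρ hτ
  smul {c _} hc hρ := by
    refine (loop_hasSum hΦ hE₀ hE₁ hE (smul_nonneg_matrix hc hρ)).unique ?_
    have h := (loop_hasSum hΦ hE₀ hE₁ hE hρ).const_smul c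
    convert h using 2 with n
    exact (hE₀.comp ((hΦ.comp hE₁).iterate n)).smul hc hρ
  nonneg hρ := nonneg_of_hasSum
    (fun n => hE₀.nonneg (((hΦ.comp hE₁).iterate n).nonneg hρ)) (loop_hasSum hΦ hE₀ hE₁ hE hρ)
  rtr_le {ρ} hρ := by
    have h := hasSum_rtr (loop_hasSum hΦ hE₀ hE₁ hE hρ)
    refine h.tsum_eq ▸ (exit_summable hΦ hE₀ hE₁ hE hρ).tsum_le_of_sum_range_le fun n => ?_
    have := sum_exit_le hΦ hE₁ hE hρ n
    have h2 := rtr_nonneg (((hΦ.comp hE₁).iterate n).nonneg hρ)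
    linarith

theorem isOp_exit_sum (hΦ : IsOp Φ) (hE₀ : IsOp E₀) (hE₁ : IsOp E₁)
    (hE : ∀ ρ, rtr (E₀ ρ) + rtr (E₁ ρ) = rtr ρ) (n : ℕ) :
    IsOp (fun ρ => ∑ i ∈ Finset.range n, E₀ ((fun τ => Φ (E₁ τ))^[i] ρ)) where
  add hρ hτ := by
    rw [← Finset.sum_add_distrib]
    exact Finset.sum_congr rfl fun i _ => (hE₀.comp ((hΦ.comp hE₁).iterate i)).add hρ hτ
  smul hc hρ := by
    rw [Finset.smul_sum]
    exact Finset.sum_congr rfl fun i _ => (hE₀.comp ((hΦ.comp hE₁).iterate i)).smul hc hρ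
  nonneg hρ := Finset.sum_nonneg fun i _ => (hE₀.comp ((hΦ.comp hE₁).iterate i)).nonneg hρ
  rtr_le {ρ} hρ := by
    have := sum_exit_le hΦ hE₁ hE hρ n
    have h2 := rtr_nonneg (((hΦ.comp hE₁).iterate n).nonneg hρ)
    rw [rtr_sum]
    linarith

/-- `Ψ` need not be an operation: its iterates are positive because they dominate those of `Φ`, and
only `Φ` has to be monotone. -/
theorem iterate_le_iterate (hΦ : IsOp Φ) (hE₁ : IsOp E₁)
    (hle : ∀ {ρ : Matrix I I ℂ}, 0 ≤ ρ → Φ ρ ≤ Ψ ρ) {ρ : Matrix I I ℂ} (hρ : 0 ≤ ρ) (n : ℕ) :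
    (fun τ => Φ (E₁ τ))^[n] ρ ≤ (fun τ => Ψ (E₁ τ))^[n] ρ := by
  induction n with
  | zero => simp
  | succ n ih =>
    rw [Function.iterate_succ_apply', Function.iterate_succ_apply']
    have h0 := ((hΦ.comp hE₁).iterate n).nonneg hρ
    exact ((hΦ.comp hE₁).mono h0 ih).trans (hle (hE₁.nonneg (h0.trans ih)))

end Loop

end Operation

/-! ### Semantics of programs as operations -/

section Kraus

variable {V : Type} {B : V → Type} {ι : Type}

theorem lift_complete [Fintype (Cfg B)] [DecidableEq (Cfg B)] {q : ι → V}
    (hq : Function.Injective q) [Fintype (Reg B q)] [DecidableEq (Reg B q)] {κ : Type*} [Fintype κ]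
    {A : κ → Matrix (Reg B q) (Reg B q) ℂ} (hA : ∑ a, (A a).conjTranspose * A a = 1) :
    ∑ a, (lift q (A a)).conjTranspose * lift q (A a) = 1 := by
  rw [← lift_one hq, ← hA, lift_sum]
  refine Finset.sum_congr rfl fun a _ => ?_
  rw [lift_conjTranspose, ← opMul_lift_lift hq, opMul_eq_mul]

theorem exists_kraus_resetTo {q : ι → V} (hq : Function.Injective q) [Fintype (Reg B q)]
    [DecidableEq (Reg B q)] {σ : Matrix (Reg B q) (Reg B q) ℂ} (hσ : σ.PosSemidef)
    (htr : σ.trace = 1) :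
    ∃ A : Reg B q × Reg B q → Matrix (Reg B q) (Reg B q) ℂ,
      ∑ a, (A a).conjTranspose * A a = 1 ∧
      ∀ X, resetTo q σ X = ∑ a, conjBy (lift q (A a)) X := by
  obtain ⟨S, rfl⟩ := exists_eq_mul_conjTranspose (Matrix.nonneg_iff_posSemidef.2 hσ)
  exact ⟨resetKraus S, resetKraus_complete S htr, resetTo_eq_sum hq S⟩

theorem expGate_unitary {R : Type} [Fintype R] [DecidableEq R] (t : ℝ) {σ : Matrix R R ℂ}
    (hσ : σ.IsHermitian) : (expGate t σ).conjTranspose * expGate t σ = 1 := by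
  -- `expGate` chooses its own `Fintype` and `DecidableEq` instances; the exponential does not
  -- depend on that choice because both classes are subsingletons.
  have hexp : ∀ (i₁ i₁' : Fintype R) (i₂ i₂' : DecidableEq R) (A : Matrix R R ℂ),
      (letI := i₁; letI := i₂; NormedSpace.exp A) =
        (letI := i₁'; letI := i₂'; NormedSpace.exp A) := by
    intro i₁ i₁' i₂ i₂' A
    obtain rfl := Subsingleton.elim i₁ i₁'
    obtain rfl := Subsingleton.elim i₂ i₂'
    rfl
  have key : expGate t σ = NormedSpace.exp ((-(Complex.I * (t : ℂ))) • σ) := hexp _ _ _ _ _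
  rw [key]
  rw [← Matrix.exp_conjTranspose]
  have h1 : ((-(Complex.I * (t : ℂ))) • σ).conjTranspose = -((-(Complex.I * (t : ℂ))) • σ) := by
    rw [Matrix.conjTranspose_smul, hσ.eq]
    simp
  rw [h1, ← Matrix.exp_add_of_commute _ _ (Commute.neg_left (Commute.refl ((-(Complex.I * (t : ℂ))) • σ))), neg_add_cancel,
    NormedSpace.exp_zero]

end Kraus

namespace Prog

variable {V : Type} {B : V → Type} {k : ℕ}

/-- The semantics in which every loop performs at most `n` iterations. -/
def boundedSem [∀ v, Zero (B v)] (θ : Fin k → ℝ) (n : ℕ) :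
    Prog B k → Matrix (Cfg B) (Cfg B) ℂ → Matrix (Cfg B) (Cfg B) ℂ
  | skip, ρ => ρ
  | init v, ρ => (init v : Prog B k).sem θ ρ
  | initTo q σ, ρ => resetTo q σ ρ
  | gate q U, ρ => conjBy (lift q U) ρ
  | pgate q j σ, ρ => conjBy (lift q (expGate (θ j) σ)) ρ
  | seq P₁ P₂, ρ => P₂.boundedSem θ n (P₁.boundedSem θ n ρ)
  | meas q M P, ρ => ∑ m, (P m).boundedSem θ n (conjBy (lift q (M m)) ρ)
  | loop q M P, ρ => ∑ i ∈ Finset.range (n + 1),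
      conjBy (lift q (M 0)) ((fun τ => P.boundedSem θ n (conjBy (lift q (M 1)) τ))^[i] ρ)

/-- The maximal number of statements with the parameter `j` that are executed when every loop
performs at most `n` iterations. -/
def boundedCount (j : Fin k) (n : ℕ) : Prog B k → ℕ
  | skip => 0
  | init _ => 0
  | initTo _ _ => 0
  | gate _ _ => 0
  | pgate _ j' _ => if j' = j then 1 else 0
  | seq P₁ P₂ => P₁.boundedCount j n + P₂.boundedCount j n
  | meas _ _ P => Finset.univ.sup fun m => (P m).boundedCount j n
  | loop _ _ P => n * P.boundedCount j n

/-- The maximal number of times that loops are entered when every loop performs fewer than `n + 1`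
iterations. -/
def loopEntries (n : ℕ) : Prog B k → ℕ
  | skip => 0
  | init _ => 0
  | initTo _ _ => 0
  | gate _ _ => 0
  | pgate _ _ _ => 0
  | seq P₁ P₂ => P₁.loopEntries n + P₂.loopEntries n
  | meas _ _ P => ∑ m, (P m).loopEntries n
  | loop _ _ P => 1 + n * P.loopEntries n

end Prog

section Semantics

variable {Q : Type} [Fintype Q] [DecidableEq Q] {B : Q → Type}
    [∀ q, Fintype (B q)] [∀ q, DecidableEq (B q)] {k : ℕ}

theorem sem_init_eq {V : Type} {B : V → Type} [∀ v, Zero (B v)] (v : V) [Fintype (B v)]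
    (θ : Fin k → ℝ) (ρ : Matrix (Cfg B) (Cfg B) ℂ) :
    (Prog.init v : Prog B k).sem θ ρ = ∑ n, conjBy (lift (fun _ : Unit => v) (ketZeroBra v n)) ρ := by
  ext f g
  simp only [Prog.sem, tsum_fintype, Matrix.sum_apply]

theorem isOp_resetTo {ι : Type} [Fintype ι] [DecidableEq ι] {q : ι → Q}
    (hq : Function.Injective q) {σ : Matrix (Reg B q) (Reg B q) ℂ} (hσ : σ.PosSemidef)
    (htr : σ.trace = 1) : IsOp (resetTo q σ) := by
  obtain ⟨A, hA, h⟩ := exists_kraus_resetTo hq hσ htr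
  convert isOp_kraus (lift_complete hq hA) using 1
  funext ρ
  exact h ρ

theorem isOp_gate {ι : Type} [Fintype ι] [DecidableEq ι] {q : ι → Q}
    (hq : Function.Injective q) {U : Matrix (Reg B q) (Reg B q) ℂ}
    (hU : U.conjTranspose * U = 1) : IsOp (conjBy (lift q U)) :=
  isOp_conjBy (κ := Unit) (A := fun _ => lift q U)
    (lift_complete (κ := Unit) (A := fun _ => U) hq (by simpa using hU)) ()

section Measurement

variable {ι : Type} [Fintype ι] [DecidableEq ι] {q : ι → Q} {n : ℕ}
  {M : Fin n → Matrix (Reg B q) (Reg B q) ℂ}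

theorem isOp_meas (hq : Function.Injective q) (hM : ∑ m, (M m).conjTranspose * M m = 1)
    (m : Fin n) : IsOp (conjBy (lift q (M m))) :=
  isOp_conjBy (lift_complete hq hM) m

theorem sum_rtr_meas (hq : Function.Injective q) (hM : ∑ m, (M m).conjTranspose * M m = 1)
    (ρ : Matrix (Cfg B) (Cfg B) ℂ) : ∑ m, rtr (conjBy (lift q (M m)) ρ) = rtr ρ :=
  sum_rtr_conjBy (lift_complete hq hM) ρ

theorem rtr_meas_two {M : Fin 2 → Matrix (Reg B q) (Reg B q) ℂ} (hq : Function.Injective q)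
    (hM : ∑ m, (M m).conjTranspose * M m = 1) (ρ : Matrix (Cfg B) (Cfg B) ℂ) :
    rtr (conjBy (lift q (M 0)) ρ) + rtr (conjBy (lift q (M 1)) ρ) = rtr ρ := by
  rw [← sum_rtr_meas hq hM ρ, Fin.sum_univ_two]

end Measurement

variable [∀ q, Zero (B q)]

theorem isOp_init (v : Q) (θ : Fin k → ℝ) : IsOp ((Prog.init v : Prog B k).sem θ) := by
  have h := isOp_kraus (lift_complete (B := B) (q := fun _ : Unit => v)
    (Function.injective_of_subsingleton _) ketZeroBra_complete)
  convert h using 1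
  funext ρ
  exact sem_init_eq v θ ρ

theorem isOp_sem (θ : Fin k → ℝ) {P : Prog B k} (hP : P.WellFormed) : IsOp (P.sem θ) := by
  induction P with
  | skip => exact IsOp.id
  | init v => exact isOp_init v θ
  | initTo q σ => exact isOp_resetTo hP.1 hP.2.1 hP.2.2
  | gate q U => exact isOp_gate hP.1 (Matrix.mem_unitaryGroup_iff'.1 hP.2)
  | pgate q j σ => exact isOp_gate hP.1 (expGate_unitary _ hP.2.1.isHermitian)
  | seq P₁ P₂ h₁ h₂ => exact (h₂ hP.2).comp (h₁ hP.1)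
  | meas q M P h =>
    exact isOp_branch (lift_complete hP.1 hP.2.1) fun m => h m (hP.2.2 m)
  | loop q M P h =>
    exact isOp_loop (h hP.2.2) (isOp_meas hP.1 hP.2.1 0) (isOp_meas hP.1 hP.2.1 1)
      (rtr_meas_two hP.1 hP.2.1)

theorem isOp_boundedSem (θ : Fin k → ℝ) (n : ℕ) {P : Prog B k} (hP : P.WellFormed) :
    IsOp (P.boundedSem θ n) := by
  induction P with
  | skip => exact IsOp.id
  | init v => exact isOp_init v θ
  | initTo q σ => exact isOp_resetTo hP.1 hP.2.1 hP.2.2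
  | gate q U => exact isOp_gate hP.1 (Matrix.mem_unitaryGroup_iff'.1 hP.2)
  | pgate q j σ => exact isOp_gate hP.1 (expGate_unitary _ hP.2.1.isHermitian)
  | seq P₁ P₂ h₁ h₂ => exact (h₂ hP.2).comp (h₁ hP.1)
  | meas q M P h =>
    exact isOp_branch (lift_complete hP.1 hP.2.1) fun m => h m (hP.2.2 m)
  | loop q M P h =>
    exact isOp_exit_sum (h hP.2.2) (isOp_meas hP.1 hP.2.1 0) (isOp_meas hP.1 hP.2.1 1)
      (rtr_meas_two hP.1 hP.2.1) (n + 1)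

/-- Truncation drops positive terms from every loop series, and every constructor is monotone on the
positive cone. -/
theorem boundedSem_le_sem (θ : Fin k → ℝ) (n : ℕ) {P : Prog B k} (hP : P.WellFormed)
    {ρ : Matrix (Cfg B) (Cfg B) ℂ} (hρ : 0 ≤ ρ) : P.boundedSem θ n ρ ≤ P.sem θ ρ := by
  induction P generalizing ρ with
  | skip => exact le_rfl
  | init v => exact le_rfl
  | initTo q σ => exact le_rfl
  | gate q U => exact le_rfl
  | pgate q j σ => exact le_rfl
  | seq P₁ P₂ h₁ h₂ =>
    have h0 := (isOp_boundedSem θ n hP.1).nonneg hρ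
    exact ((isOp_boundedSem θ n hP.2).mono h0 (h₁ hP.1 hρ)).trans
      (h₂ hP.2 ((isOp_sem θ hP.1).nonneg hρ))
  | meas q M P h =>
    exact Finset.sum_le_sum fun m _ => h m (hP.2.2 m) ((isOp_meas hP.1 hP.2.1 m).nonneg hρ)
  | loop q M P h =>
    have hE₀ := isOp_meas hP.1 hP.2.1 0
    have hE₁ := isOp_meas hP.1 hP.2.1 1
    have hS := isOp_sem θ hP.2.2
    have hB := isOp_boundedSem θ n hP.2.2
    refine le_trans (Finset.sum_le_sum fun i _ => ?_) (sum_le_of_hasSum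
      (fun n => hE₀.nonneg (((hS.comp hE₁).iterate n).nonneg hρ))
      (loop_hasSum hS hE₀ hE₁ (rtr_meas_two hP.1 hP.2.1) hρ) (n + 1))
    exact hE₀.mono (((hB.comp hE₁).iterate i).nonneg hρ)
      (iterate_le_iterate hB hE₁ (fun h' => h hP.2.2 h') hρ i)

theorem boundedSem_mono (θ : Fin k → ℝ) {n n' : ℕ} (hn : n ≤ n') {P : Prog B k}
    (hP : P.WellFormed) {ρ : Matrix (Cfg B) (Cfg B) ℂ} (hρ : 0 ≤ ρ) :
    P.boundedSem θ n ρ ≤ P.boundedSem θ n' ρ := by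
  induction P generalizing ρ with
  | skip => exact le_rfl
  | init v => exact le_rfl
  | initTo q σ => exact le_rfl
  | gate q U => exact le_rfl
  | pgate q j σ => exact le_rfl
  | seq P₁ P₂ h₁ h₂ =>
    have h0 := (isOp_boundedSem θ n hP.1).nonneg hρ
    exact ((isOp_boundedSem θ n hP.2).mono h0 (h₁ hP.1 hρ)).trans
      (h₂ hP.2 ((isOp_boundedSem θ n' hP.1).nonneg hρ))
  | meas q M P h =>
    exact Finset.sum_le_sum fun m _ => h m (hP.2.2 m) ((isOp_meas hP.1 hP.2.1 m).nonneg hρ)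
  | loop q M P h =>
    have hE₀ := isOp_meas hP.1 hP.2.1 0
    have hE₁ := isOp_meas hP.1 hP.2.1 1
    have hB := isOp_boundedSem θ n hP.2.2
    have hB' := isOp_boundedSem θ n' hP.2.2
    refine le_trans (Finset.sum_le_sum fun i _ => ?_)
      (Finset.sum_le_sum_of_subset_of_nonneg
        (Finset.range_mono (show n + 1 ≤ n' + 1 by omega))
        fun i _ _ => (hE₀.comp ((hB'.comp hE₁).iterate i)).nonneg hρ)
    exact hE₀.mono (((hB.comp hE₁).iterate i).nonneg hρ)
      (iterate_le_iterate hB hE₁ (fun h' => h hP.2.2 h') hρ i)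

end Semantics

/-! ### Almost sure termination, uniform decay of loops, and the loss caused by truncation -/

section Termination

variable {Q : Type} [Fintype Q] [DecidableEq Q] {B : Q → Type}
    [∀ q, Fintype (B q)] [∀ q, DecidableEq (B q)] {k : ℕ}

theorem rtr_resetTo {ι : Type} [Fintype ι] [DecidableEq ι] {q : ι → Q}
    (hq : Function.Injective q) {σ : Matrix (Reg B q) (Reg B q) ℂ} (hσ : σ.PosSemidef)
    (htr : σ.trace = 1) (ρ : Matrix (Cfg B) (Cfg B) ℂ) : rtr (resetTo q σ ρ) = rtr ρ := by
  obtain ⟨A, hA, h⟩ := exists_kraus_resetTo hq hσ htr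
  rw [h, rtr_sum, sum_rtr_conjBy (lift_complete hq hA)]

theorem rtr_gate {ι : Type} [Fintype ι] [DecidableEq ι] {q : ι → Q}
    (hq : Function.Injective q) {U : Matrix (Reg B q) (Reg B q) ℂ}
    (hU : U.conjTranspose * U = 1) (ρ : Matrix (Cfg B) (Cfg B) ℂ) :
    rtr (conjBy (lift q U) ρ) = rtr ρ := by
  have h := sum_rtr_conjBy (κ := Unit) (A := fun _ => lift q U)
    (lift_complete (κ := Unit) (A := fun _ => U) hq (by simpa using hU)) ρ
  simpa using h

variable [∀ q, Zero (B q)]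

theorem rtr_init (v : Q) (θ : Fin k → ℝ) (ρ : Matrix (Cfg B) (Cfg B) ℂ) :
    rtr ((Prog.init v : Prog B k).sem θ ρ) = rtr ρ := by
  rw [sem_init_eq, rtr_sum, sum_rtr_conjBy (lift_complete (B := B) (q := fun _ : Unit => v)
    (Function.injective_of_subsingleton _) ketZeroBra_complete)]

section Loop

variable {ι : Type} [Fintype ι] [DecidableEq ι] {q : ι → Q}
  {M : Fin 2 → Matrix (Reg B q) (Reg B q) ℂ} {P : Prog B k} {θ : Fin k → ℝ}

/-- Termination gives convergence for each single input; applied to the maximally mixed state it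
yields one threshold for all inputs, since every `ρ` is dominated by `d * rtr ρ` times that state.
-/
theorem exists_iterate_le (hW : (Prog.loop q M P).WellFormed)
    (hterm : TerminatesAS θ (Prog.loop q M P)) {δ : ℝ} (hδ : 0 < δ) :
    ∃ n₀ : ℕ, ∀ n, n₀ ≤ n → ∀ ρ : Matrix (Cfg B) (Cfg B) ℂ, 0 ≤ ρ →
      rtr ((fun τ => P.sem θ (conjBy (lift q (M 1)) τ))^[n] ρ) ≤ δ * rtr ρ := by
  have hE₀ := isOp_meas hW.1 hW.2.1 0
  have hE₁ := isOp_meas hW.1 hW.2.1 1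
  have hS := isOp_sem θ hW.2.2
  have hE := rtr_meas_two hW.1 hW.2.1
  have hT := hS.comp hE₁
  have : Nonempty (Cfg B) := ⟨fun _ => 0⟩
  set d : ℝ := ((Fintype.card (Cfg B) : ℕ) : ℝ) with hd
  have hd0 : 0 < d := by rw [hd]; exact_mod_cast Fintype.card_pos
  set ρ₀ : Matrix (Cfg B) (Cfg B) ℂ := d⁻¹ • 1 with hρ₀
  have h1 : (0 : Matrix (Cfg B) (Cfg B) ℂ) ≤ 1 :=
    Matrix.nonneg_iff_posSemidef.2 Matrix.PosSemidef.one
  have h0 : 0 ≤ ρ₀ := smul_nonneg_matrix (by positivity) h1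
  have htr : rtr ρ₀ = 1 := by
    rw [hρ₀, rtr_smul, rtr, Matrix.trace_one]
    simp only [Complex.natCast_re]
    exact inv_mul_cancel₀ hd0.ne'
  have hsum := hasSum_rtr (loop_hasSum hS hE₀ hE₁ hE h0)
  have hlim := hterm ρ₀ ⟨Matrix.nonneg_iff_posSemidef.1 h0, htr.le⟩
  have hlim' : rtr (fun f g => ∑' n, conjBy (lift q (M 0))
      ((fun τ => P.sem θ (conjBy (lift q (M 1)) τ))^[n] ρ₀) f g) = 1 := by
    rw [← htr]
    exact congrArg Complex.re hlim
  rw [hlim'] at hsum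
  have hev := (hsum.tendsto_sum_nat.eventually
    (lt_mem_nhds (show 1 - δ / d < 1 by linarith [div_pos hδ hd0])))
  obtain ⟨n₀, hn₀⟩ := Filter.eventually_atTop.1 hev
  refine ⟨n₀, fun n hn ρ hρ => ?_⟩
  have h2 := sum_exit_le hS hE₁ hE h0 n
  have h3 := hn₀ n hn
  have h4 : rtr ((fun τ => P.sem θ (conjBy (lift q (M 1)) τ))^[n] ρ₀) ≤ δ / d := by linarith
  -- The factor `d` lost in this domination is the reason for asking for `δ / d` above.
  have h5 : ρ ≤ (d * rtr ρ) • ρ₀ := by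
    have : (d * rtr ρ) • ρ₀ = rtr ρ • (1 : Matrix (Cfg B) (Cfg B) ℂ) := by
      rw [hρ₀, smul_smul]; congr 1; field_simp
    rw [this]
    exact le_rtr_smul_one hρ
  have h6 := rtr_mono ((hT.iterate n).mono hρ h5)
  have hc : 0 ≤ d * rtr ρ := mul_nonneg hd0.le (rtr_nonneg hρ)
  rw [(hT.iterate n).smul hc h0, rtr_smul] at h6
  refine h6.trans ((mul_le_mul_of_nonneg_left h4 hc).trans_eq ?_)
  field_simp

/-- A contraction by `ε` over any `N` rounds iterates. The claim covers all `N` beyond a threshold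
so that a common `N` can be chosen for several loops. -/
theorem exists_loopDecay_loop (hW : (Prog.loop q M P).WellFormed)
    (hterm : TerminatesAS θ (Prog.loop q M P)) {ε : ℝ} (hε : 0 < ε) :
    ∃ N₀ : ℕ, 0 < N₀ ∧ ∀ N, N₀ ≤ N → LoopDecay θ ε N (Prog.loop q M P) := by
  obtain ⟨n₀, hn₀⟩ := exists_iterate_le hW hterm hε
  refine ⟨max 1 n₀, by positivity, fun N hN n ρ hρ => ?_⟩
  have hE₀ := isOp_meas hW.1 hW.2.1 0
  have hE₁ := isOp_meas hW.1 hW.2.1 1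
  have hT := (isOp_sem θ hW.2.2).comp hE₁
  have h0 : 0 ≤ ρ := Matrix.nonneg_iff_posSemidef.2 hρ.1
  have key : ∀ m : ℕ, rtr ((fun τ => P.sem θ (conjBy (lift q (M 1)) τ))^[N * m] ρ)
      ≤ ε ^ m * rtr ρ := by
    intro m
    induction m with
    | zero => simp
    | succ m ih =>
      rw [Nat.mul_succ, Nat.add_comm, Function.iterate_add_apply]
      refine (hn₀ N (le_trans (le_max_right _ _) hN) _ ((hT.iterate _).nonneg h0)).trans ?_
      rw [pow_succ']
      calc _ ≤ ε * (ε ^ m * rtr ρ) := mul_le_mul_of_nonneg_left ih hε.le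
        _ = _ := by ring
  refine (hE₀.rtr_le ((hT.iterate n).nonneg h0)).trans ?_
  -- The full blocks of `N` rounds are run first; the remaining `n % N` rounds and the exit can only
  -- lose trace.
  conv_lhs => rw [← Nat.mod_add_div n N, Function.iterate_add_apply]
  exact ((hT.iterate _).rtr_le ((hT.iterate _).nonneg h0)).trans (key _)

/-- Both sides are homogeneous, so a positive input is normalized to trace one; a positive matrix of
trace zero is zero. -/
theorem LoopDecay.of_nonneg (hW : (Prog.loop q M P).WellFormed) {ε : ℝ} {N : ℕ}
    (h : LoopDecay θ ε N (Prog.loop q M P)) (n : ℕ) {ρ : Matrix (Cfg B) (Cfg B) ℂ} (hρ : 0 ≤ ρ) :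
    rtr (conjBy (lift q (M 0)) ((fun τ => P.sem θ (conjBy (lift q (M 1)) τ))^[n] ρ)) ≤
      ε ^ (n / N) * rtr ρ := by
  have hO := (isOp_meas hW.1 hW.2.1 0).comp
    (((isOp_sem θ hW.2.2).comp (isOp_meas hW.1 hW.2.1 1)).iterate n)
  rcases (rtr_nonneg hρ).eq_or_lt with h0 | h0
  · obtain rfl := eq_zero_of_rtr_eq_zero hρ h0.ge
    rw [hO.map_zero]
    simp
  · have h1 : 0 ≤ (rtr ρ)⁻¹ • ρ := smul_nonneg_matrix (inv_nonneg.2 h0.le) hρ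
    have h2 : rtr ((rtr ρ)⁻¹ • ρ) = 1 := by rw [rtr_smul, inv_mul_cancel₀ h0.ne']
    have h3 := h n ((rtr ρ)⁻¹ • ρ) ⟨Matrix.nonneg_iff_posSemidef.1 h1, h2.le⟩
    have h4 : ρ = rtr ρ • ((rtr ρ)⁻¹ • ρ) := by rw [smul_smul, mul_inv_cancel₀ h0.ne', one_smul]
    rw [h4, hO.smul h0.le h1, rtr_smul, ← h4]
    change rtr _ ≤ _ * rtr _ at h3
    rw [h2, mul_one] at h3
    rw [mul_comm (ε ^ _)]
    exact mul_le_mul_of_nonneg_left h3 h0.le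

end Loop

theorem exists_loopDecay {θ : Fin k → ℝ} {ε : ℝ} (hε : 0 < ε) {P : Prog B k} (hP : P.WellFormed)
    (hterm : ∀ W ∈ P.loops, TerminatesAS θ W) :
    ∃ N₀ : ℕ, 0 < N₀ ∧ ∀ N, N₀ ≤ N → ∀ W ∈ P.loops, LoopDecay θ ε N W := by
  induction P with
  | skip => exact ⟨1, one_pos, fun _ _ W hW => hW.elim⟩
  | init v => exact ⟨1, one_pos, fun _ _ W hW => hW.elim⟩
  | initTo q σ => exact ⟨1, one_pos, fun _ _ W hW => hW.elim⟩
  | gate q U => exact ⟨1, one_pos, fun _ _ W hW => hW.elim⟩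
  | pgate q j σ => exact ⟨1, one_pos, fun _ _ W hW => hW.elim⟩
  | seq P₁ P₂ h₁ h₂ =>
    obtain ⟨N₁, hN₁, h₁⟩ := h₁ hP.1 fun W hW => hterm W (Or.inl hW)
    obtain ⟨N₂, hN₂, h₂⟩ := h₂ hP.2 fun W hW => hterm W (Or.inr hW)
    refine ⟨max N₁ N₂, by positivity, fun N hN W hW => ?_⟩
    exact hW.elim (h₁ N (le_trans (le_max_left _ _) hN) W)
      (h₂ N (le_trans (le_max_right _ _) hN) W)
  | meas q M P h =>
    choose N hN h using fun m => h m (hP.2.2 m) fun W hW => hterm W (Set.mem_iUnion.2 ⟨m, hW⟩)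
    -- Any positive upper bound of all the thresholds serves; the added 1 covers a measurement
    -- without outcomes.
    refine ⟨1 + ∑ m, N m, by positivity, fun N' hN' W hW => ?_⟩
    obtain ⟨m, hm⟩ := Set.mem_iUnion.1 hW
    refine h m N' ?_ W hm
    have := Finset.single_le_sum (f := N) (fun i _ => Nat.zero_le _) (Finset.mem_univ m)
    omega
  | loop q M P h =>
    obtain ⟨N₁, hN₁, h₁⟩ := h hP.2.2 fun W hW => hterm W (Or.inr hW)
    obtain ⟨N₂, hN₂, h₂⟩ := exists_loopDecay_loop hP (hterm _ (Or.inl rfl)) hε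
    refine ⟨max N₁ N₂, by positivity, fun N hN W hW => ?_⟩
    rcases hW with rfl | hW
    · exact h₂ N (le_trans (le_max_right _ _) hN)
    · exact h₁ N (le_trans (le_max_left _ _) hN) W hW

/-- A hybrid argument: exits up to index `n` involve at most `n` executions of the body. Replacing
`Ψ` by `Φ` in one of them changes at most the mass `c * rtr ρ`, and the later rounds cannot enlarge
it. -/
theorem exit_sum_sub_le {I : Type} [Fintype I] {E₀ E₁ Φ Ψ : Matrix I I ℂ → Matrix I I ℂ}
    (hΦ : IsOp Φ) (hΨ : IsOp Ψ) (hE₀ : IsOp E₀) (hE₁ : IsOp E₁)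
    (hE : ∀ ρ, rtr (E₀ ρ) + rtr (E₁ ρ) = rtr ρ)
    (hle : ∀ {ρ : Matrix I I ℂ}, 0 ≤ ρ → Φ ρ ≤ Ψ ρ) {c : ℝ} (hc : 0 ≤ c)
    (hdiff : ∀ {ρ : Matrix I I ℂ}, 0 ≤ ρ → rtr (Ψ ρ) - rtr (Φ ρ) ≤ c * rtr ρ) (n : ℕ)
    {ρ : Matrix I I ℂ} (hρ : 0 ≤ ρ) :
    ∑ i ∈ Finset.range (n + 1), rtr (E₀ ((fun τ => Ψ (E₁ τ))^[i] ρ)) -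
      ∑ i ∈ Finset.range (n + 1), rtr (E₀ ((fun τ => Φ (E₁ τ))^[i] ρ)) ≤ n * c * rtr ρ := by
  induction n generalizing ρ with
  | zero => simp
  | succ n ih =>
    rw [Finset.sum_range_succ', Finset.sum_range_succ' (n := n + 1)]
    simp only [Function.iterate_succ_apply, Function.iterate_zero_apply]
    have h1 := ih ((hΨ.comp hE₁).nonneg hρ)
    have hO := isOp_exit_sum hΦ hE₀ hE₁ hE (n + 1)
    have hl := hle (hE₁.nonneg hρ)
    have h2 := hO.rtr_le (sub_nonneg.2 hl)
    rw [hO.sub_eq ((hΦ.comp hE₁).nonneg hρ) hl, rtr_sub, rtr_sub, rtr_sum, rtr_sum] at h2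
    have h3 := hdiff (hE₁.nonneg hρ)
    have h4 := mul_le_mul_of_nonneg_left ((hΨ.comp hE₁).rtr_le hρ)
      (show 0 ≤ (n : ℝ) * c by positivity)
    have h5 := mul_le_mul_of_nonneg_left (hE₁.rtr_le hρ) hc
    push_cast
    linarith

/-- The probability that the maximal number of iterations of a loop is `n + 1`. -/
theorem rtr_boundedSem_succ_sub_le {θ : Fin k → ℝ} {ε : ℝ} (hε : 0 ≤ ε) (N n : ℕ) {P : Prog B k}
    (hP : P.WellFormed) (hdec : ∀ W ∈ P.loops, LoopDecay θ ε N W)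
    {ρ : Matrix (Cfg B) (Cfg B) ℂ} (hρ : 0 ≤ ρ) :
    rtr (P.boundedSem θ (n + 1) ρ) - rtr (P.boundedSem θ n ρ) ≤
      P.loopEntries n * ε ^ ((n + 1) / N) * rtr ρ := by
  have he : 0 ≤ ε ^ ((n + 1) / N) := pow_nonneg hε _
  have hr := rtr_nonneg hρ
  induction P generalizing ρ with
  | skip => simp [Prog.boundedSem, Prog.loopEntries]
  | init v => simp [Prog.boundedSem, Prog.loopEntries]
  | initTo q σ => simp [Prog.boundedSem, Prog.loopEntries]
  | gate q U => simp [Prog.boundedSem, Prog.loopEntries]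
  | pgate q j σ => simp [Prog.boundedSem, Prog.loopEntries]
  | seq P₁ P₂ h₁ h₂ =>
    -- Two-step telescope: shorten the truncation of `P₂` behind the longer `P₁`, then compare the
    -- two outputs of `P₁` under the same truncated `P₂`.
    have h₁ := h₁ hP.1 (fun W hW => hdec W (Or.inl hW)) hρ hr
    have h0 := (isOp_boundedSem θ (n + 1) hP.1).nonneg hρ
    have h₂ := h₂ hP.2 (fun W hW => hdec W (Or.inr hW)) h0 (rtr_nonneg h0)
    have hO := isOp_boundedSem θ n hP.2
    have hl := boundedSem_mono θ n.le_succ hP.1 hρ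
    have h3 := hO.rtr_le (sub_nonneg.2 hl)
    rw [hO.sub_eq ((isOp_boundedSem θ n hP.1).nonneg hρ) hl, rtr_sub, rtr_sub] at h3
    have h4 := mul_le_mul_of_nonneg_left ((isOp_boundedSem θ (n + 1) hP.1).rtr_le hρ)
      (show 0 ≤ (P₂.loopEntries n : ℝ) * ε ^ ((n + 1) / N) by positivity)
    simp only [Prog.boundedSem, Prog.loopEntries]
    push_cast
    linarith
  | meas q M P h =>
    simp only [Prog.boundedSem, Prog.loopEntries]
    rw [rtr_sum, rtr_sum, ← Finset.sum_sub_distrib]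
    push_cast
    rw [Finset.sum_mul, Finset.sum_mul]
    refine Finset.sum_le_sum fun m _ => ?_
    have hE := isOp_meas hP.1 hP.2.1 m
    refine (h m (hP.2.2 m) (fun W hW => hdec W (Set.mem_iUnion.2 ⟨m, hW⟩)) (hE.nonneg hρ)
      (rtr_nonneg (hE.nonneg hρ))).trans ?_
    exact mul_le_mul_of_nonneg_left (hE.rtr_le hρ) (by positivity)
  | loop q M P h =>
    have hE₀ := isOp_meas hP.1 hP.2.1 0
    have hE₁ := isOp_meas hP.1 hP.2.1 1
    have hS := isOp_sem θ hP.2.2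
    have hB := isOp_boundedSem θ n hP.2.2
    have hB' := isOp_boundedSem θ (n + 1) hP.2.2
    have hE := rtr_meas_two hP.1 hP.2.1
    simp only [Prog.boundedSem, Prog.loopEntries]
    rw [rtr_sum, rtr_sum, Finset.sum_range_succ _ (n + 1)]
    -- Two sources of new mass: lengthened loops inside the at most `n` executions of the body, and
    -- the new exit after `n + 1` rounds, which accounts for the `1` in `loopEntries`.
    have h1 := exit_sum_sub_le hB hB' hE₀ hE₁ hE
      (fun h' => boundedSem_mono θ n.le_succ hP.2.2 h')
      (c := P.loopEntries n * ε ^ ((n + 1) / N)) (by positivity)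
      (fun h' => h hP.2.2 (fun W hW => hdec W (Or.inr hW)) h' (rtr_nonneg h')) n hρ
    -- `LoopDecay` speaks about the true semantics of the body, which dominates the truncated one.
    have h2 := rtr_mono (hE₀.mono (((hB'.comp hE₁).iterate (n + 1)).nonneg hρ)
      (iterate_le_iterate hB' hE₁ (fun h' => boundedSem_le_sem θ (n + 1) hP.2.2 h') hρ (n + 1)))
    have h3 := (hdec _ (Or.inl rfl)).of_nonneg hP (n + 1) hρ
    push_cast
    linarith

/-- Mass that has not left in the first `n` rounds is either still inside or was lost in one of `n`
executions of the body, each losing at most a fraction `c`. -/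
theorem sub_exit_sum_le {I : Type} [Fintype I] {E₀ E₁ Φ : Matrix I I ℂ → Matrix I I ℂ}
    (hΦ : IsOp Φ) (hE₁ : IsOp E₁)
    (hE : ∀ ρ, rtr (E₀ ρ) + rtr (E₁ ρ) = rtr ρ) {c : ℝ} (hc : 0 ≤ c)
    (hdiff : ∀ {ρ : Matrix I I ℂ}, 0 ≤ ρ → rtr ρ - rtr (Φ ρ) ≤ c * rtr ρ) (n : ℕ)
    {ρ : Matrix I I ℂ} (hρ : 0 ≤ ρ) (h₀ : ∀ {τ : Matrix I I ℂ}, 0 ≤ τ → 0 ≤ rtr (E₀ τ)) :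
    rtr ρ - ∑ i ∈ Finset.range n, rtr (E₀ ((fun τ => Φ (E₁ τ))^[i] ρ)) ≤
      n * c * rtr ρ + rtr ((fun τ => Φ (E₁ τ))^[n] ρ) := by
  induction n with
  | zero => simp
  | succ n ih =>
    rw [Finset.sum_range_succ, Function.iterate_succ_apply']
    have h0 := ((hΦ.comp hE₁).iterate n).nonneg hρ
    have h1 := hdiff (hE₁.nonneg h0)
    have h2 := hE ((fun τ => Φ (E₁ τ))^[n] ρ)
    have h3 := ((hΦ.comp hE₁).iterate n).rtr_le hρ
    have h4 : c * rtr (E₁ ((fun τ => Φ (E₁ τ))^[n] ρ)) ≤ c * rtr ρ :=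
      mul_le_mul_of_nonneg_left (by linarith [h₀ h0]) hc
    push_cast
    linarith

/-- Programs whose loops terminate almost surely lose arbitrarily little when the numbers of
iterations are bounded. -/
theorem exists_sub_rtr_boundedSem_le {θ : Fin k → ℝ} {P : Prog B k}
    (hP : P.WellFormed) (hterm : ∀ W ∈ P.loops, TerminatesAS θ W) {δ : ℝ} (hδ : 0 < δ) :
    ∃ n₀ : ℕ, ∀ n, n₀ ≤ n → ∀ {ρ : Matrix (Cfg B) (Cfg B) ℂ}, 0 ≤ ρ →
      rtr ρ - rtr (P.boundedSem θ n ρ) ≤ δ * rtr ρ := by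
  have triv : ∀ {Φ : Matrix (Cfg B) (Cfg B) ℂ → Matrix (Cfg B) (Cfg B) ℂ},
      (∀ ρ, rtr (Φ ρ) = rtr ρ) → ∀ {ρ : Matrix (Cfg B) (Cfg B) ℂ}, 0 ≤ ρ →
      rtr ρ - rtr (Φ ρ) ≤ δ * rtr ρ := fun h ρ hρ => by
    rw [h, sub_self]; exact mul_nonneg hδ.le (rtr_nonneg hρ)
  induction P generalizing δ with
  | skip => exact ⟨0, fun _ _ => triv fun _ => rfl⟩
  | init v => exact ⟨0, fun _ _ => triv fun ρ => rtr_init v θ ρ⟩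
  | initTo q σ => exact ⟨0, fun _ _ => triv fun ρ => rtr_resetTo hP.1 hP.2.1 hP.2.2 ρ⟩
  | gate q U =>
    exact ⟨0, fun _ _ => triv fun ρ => rtr_gate hP.1 (Matrix.mem_unitaryGroup_iff'.1 hP.2) ρ⟩
  | pgate q j σ =>
    exact ⟨0, fun _ _ => triv fun ρ => rtr_gate hP.1 (expGate_unitary _ hP.2.1.isHermitian) ρ⟩
  | seq P₁ P₂ h₁ h₂ =>
    obtain ⟨n₁, h₁⟩ := h₁ hP.1 (fun W hW => hterm W (Or.inl hW)) (half_pos hδ)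
      (fun h ρ hρ => by rw [h, sub_self]; exact mul_nonneg (half_pos hδ).le (rtr_nonneg hρ))
    obtain ⟨n₂, h₂⟩ := h₂ hP.2 (fun W hW => hterm W (Or.inr hW)) (half_pos hδ)
      (fun h ρ hρ => by rw [h, sub_self]; exact mul_nonneg (half_pos hδ).le (rtr_nonneg hρ))
    refine ⟨max n₁ n₂, fun n hn ρ hρ => ?_⟩
    have hO := isOp_boundedSem θ n hP.1
    have h3 := h₁ n (le_trans (le_max_left _ _) hn) hρ
    have h4 := h₂ n (le_trans (le_max_right _ _) hn) (hO.nonneg hρ)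
    have h5 := mul_le_mul_of_nonneg_left (hO.rtr_le hρ) (half_pos hδ).le
    simp only [Prog.boundedSem]
    linarith
  | meas q M P h =>
    choose n₀ h using fun m => h m (hP.2.2 m) (fun W hW => hterm W (Set.mem_iUnion.2 ⟨m, hW⟩))
      hδ triv
    refine ⟨∑ m, n₀ m, fun n hn ρ hρ => ?_⟩
    simp only [Prog.boundedSem]
    rw [rtr_sum, ← sum_rtr_meas hP.1 hP.2.1 ρ, ← Finset.sum_sub_distrib, Finset.mul_sum]
    refine Finset.sum_le_sum fun m _ => h m n ?_ ((isOp_meas hP.1 hP.2.1 m).nonneg hρ)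
    exact (Finset.single_le_sum (f := n₀) (fun i _ => Nat.zero_le _) (Finset.mem_univ m)).trans hn
  | loop q M P h =>
    have hE₀ := isOp_meas hP.1 hP.2.1 0
    have hE₁ := isOp_meas hP.1 hP.2.1 1
    have hE := rtr_meas_two hP.1 hP.2.1
    obtain ⟨m, hm⟩ := exists_iterate_le hP (hterm _ (Or.inl rfl)) (half_pos hδ)
    -- Half of `δ` pays for the mass still inside after `m` rounds, the other half for the losses in
    -- `m` executions of the body.
    have hδ' : 0 < δ / (2 * (m + 1)) := by positivity
    obtain ⟨n₀, h⟩ := h hP.2.2 (fun W hW => hterm W (Or.inr hW)) hδ'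
      (fun h ρ hρ => by rw [h, sub_self]; exact mul_nonneg hδ'.le (rtr_nonneg hρ))
    refine ⟨max m n₀, fun n hn ρ hρ => ?_⟩
    have hB := isOp_boundedSem θ n hP.2.2
    have h1 := sub_exit_sum_le hB hE₁ hE hδ'.le (h n (le_trans (le_max_right _ _) hn)) m hρ
      (fun h => rtr_nonneg (hE₀.nonneg h))
    have h2 := rtr_mono (iterate_le_iterate hB hE₁
      (fun h' => boundedSem_le_sem θ n hP.2.2 h') hρ m)
    have h3 := hm m le_rfl ρ hρ
    have h4 : ∑ i ∈ Finset.range m, rtr (conjBy (lift q (M 0))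
        ((fun τ => P.boundedSem θ n (conjBy (lift q (M 1)) τ))^[i] ρ)) ≤
        rtr ((Prog.loop q M P).boundedSem θ n ρ) := by
      simp only [Prog.boundedSem]
      rw [rtr_sum]
      refine Finset.sum_le_sum_of_subset_of_nonneg (Finset.range_mono ?_) fun i _ _ =>
        rtr_nonneg ((hE₀.comp ((hB.comp hE₁).iterate i)).nonneg hρ)
      have := le_trans (le_max_left _ _) hn
      omega
    have h5 : m * (δ / (2 * (m + 1))) * rtr ρ ≤ δ / 2 * rtr ρ := by
      refine mul_le_mul_of_nonneg_right ?_ (rtr_nonneg hρ)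
      rw [mul_div_assoc', div_le_div_iff₀ (by positivity) (by positivity)]
      nlinarith
    linarith

end Termination

/-! ### States of the differential program -/

section Block

variable {Q : Type} {B : Q → Type}

/-- The configurations in which the counter has the value `z`. -/
abbrev Block (B : Q → Type) (z : ℤ) : Type := {f : Cfg (DBasis B) // f DVar.qc = z}

/-- The counter is the only variable with an infinite basis, so fixing its value leaves finitely
many configurations. -/
instance [Finite Q] [∀ q, Finite (B q)] (z : ℤ) : Finite (Block B z) := by
  refine Finite.of_injective (β := Fin 2 × Fin 2 × Cfg B × Cfg B)
    (fun f => (f.1 DVar.q1, f.1 DVar.q2, fun q => f.1 (DVar.copy q), fun q => f.1 (DVar.orig q)))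
    fun f g h => ?_
  simp only [Prod.mk.injEq] at h
  obtain ⟨h1, h2, h3, h4⟩ := h
  refine Subtype.ext (funext fun v => ?_)
  cases v with
  | orig q => exact congrFun h4 q
  | copy q => exact congrFun h3 q
  | q1 => exact h1
  | q2 => exact h2
  | qc => exact f.2.trans g.2.symm

instance [Finite Q] [∀ q, Finite (B q)] (z : ℤ) : Fintype (Block B z) := Fintype.ofFinite _

/-- The block of an operator in which the counter has the value `z`. -/
def block (z : ℤ) (X : Matrix (Cfg (DBasis B)) (Cfg (DBasis B)) ℂ) :
    Matrix (Block B z) (Block B z) ℂ :=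
  X.submatrix Subtype.val Subtype.val

theorem block_add (z : ℤ) (X Y : Matrix (Cfg (DBasis B)) (Cfg (DBasis B)) ℂ) :
    block z (X + Y) = block z X + block z Y := rfl

theorem block_sum {κ : Type*} (z : ℤ) (s : Finset κ)
    (X : κ → Matrix (Cfg (DBasis B)) (Cfg (DBasis B)) ℂ) :
    block z (∑ a ∈ s, X a) = ∑ a ∈ s, block z (X a) := by
  ext f g
  simp [block, Matrix.sum_apply]

variable [Finite Q] [∀ q, Finite (B q)]

/-- An operator that preserves the counter never leaves a block, so the infinite sum is the finite
matrix product on each block. -/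
theorem block_opMul {z : ℤ} {A : Matrix (Cfg (DBasis B)) (Cfg (DBasis B)) ℂ}
    (hA : ∀ f h, A f h ≠ 0 → f .qc = h .qc) (X : Matrix (Cfg (DBasis B)) (Cfg (DBasis B)) ℂ) :
    block z (opMul A X) = block z A * block z X := by
  ext f g
  rw [Matrix.mul_apply, ← tsum_fintype (L := .unconditional _)]
  exact (Subtype.val_injective.tsum_eq (f := fun h => A f.1 h * X h g.1) fun h hh =>
    ⟨⟨h, (hA _ _ (left_ne_zero_of_mul hh)).symm.trans f.2⟩, rfl⟩).symm

theorem block_opMul' {z : ℤ} {A : Matrix (Cfg (DBasis B)) (Cfg (DBasis B)) ℂ}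
    (hA : ∀ f h, A f h ≠ 0 → f .qc = h .qc) (X : Matrix (Cfg (DBasis B)) (Cfg (DBasis B)) ℂ) :
    block z (opMul X A) = block z X * block z A := by
  ext f g
  rw [Matrix.mul_apply, ← tsum_fintype (L := .unconditional _)]
  exact (Subtype.val_injective.tsum_eq (f := fun h => X f.1 h * A h g.1) fun h hh =>
    ⟨⟨h, (hA _ _ (right_ne_zero_of_mul hh)).trans g.2⟩, rfl⟩).symm

variable {ι : Type} {q : ι → DVar Q}

theorem lift_qc_eq (hqc : ∀ i, q i ≠ .qc) (A : Matrix (Reg (DBasis B) q) (Reg (DBasis B) q) ℂ)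
    (f h : Cfg (DBasis B)) (hne : lift q A f h ≠ 0) : f .qc = h .qc := by
  by_contra hcon
  exact hne (by unfold lift; rw [if_neg fun h' => hcon (h' .qc hqc)])

theorem block_conjBy_lift (hqc : ∀ i, q i ≠ .qc)
    (A : Matrix (Reg (DBasis B) q) (Reg (DBasis B) q) ℂ)
    (X : Matrix (Cfg (DBasis B)) (Cfg (DBasis B)) ℂ) (z : ℤ) :
    block z (conjBy (lift q A) X) =
      block z (lift q A) * block z X * (block z (lift q A)).conjTranspose := by
  unfold conjBy
  rw [block_opMul', block_opMul (lift_qc_eq hqc A)]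
  · rfl
  · rw [lift_conjTranspose]
    exact lift_qc_eq hqc _

theorem block_lift_complete [DecidableEq (Cfg (DBasis B))] [∀ z, DecidableEq (Block B z)]
    (hq : Function.Injective q) (hqc : ∀ i, q i ≠ .qc)
    [Fintype (Reg (DBasis B) q)] [DecidableEq (Reg (DBasis B) q)] {κ : Type*} [Fintype κ]
    {A : κ → Matrix (Reg (DBasis B) q) (Reg (DBasis B) q) ℂ}
    (hA : ∑ a, (A a).conjTranspose * A a = 1) (z : ℤ) :
    ∑ a, (block z (lift q (A a))).conjTranspose * block z (lift q (A a)) = 1 := by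
  have h1 : ∀ a, (block z (lift q (A a))).conjTranspose * block z (lift q (A a)) =
      block z (lift q ((A a).conjTranspose * A a)) := fun a => by
    rw [← opMul_lift_lift hq, block_opMul (lift_qc_eq hqc _), ← lift_conjTranspose]
    rfl
  simp only [h1]
  rw [← block_sum, ← lift_sum, hA, lift_one hq]
  exact Matrix.submatrix_one _ Subtype.val_injective

/-- The weight of the block `z`. -/
def weight (z : ℤ) (X : Matrix (Cfg (DBasis B)) (Cfg (DBasis B)) ℂ) : ℝ := rtr (block z X)

/-- States that are diagonal in the counter, with positive blocks. -/
structure IsCounterState (X : Matrix (Cfg (DBasis B)) (Cfg (DBasis B)) ℂ) : Prop where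
  diag : ∀ f g, X f g ≠ 0 → f .qc = g .qc
  nonneg : ∀ z, 0 ≤ block z X

theorem IsCounterState.conjBy_lift {X : Matrix (Cfg (DBasis B)) (Cfg (DBasis B)) ℂ}
    (hX : IsCounterState X) (hq : Function.Injective q) (hqc : ∀ i, q i ≠ .qc)
    [Finite (Reg (DBasis B) q)] (A : Matrix (Reg (DBasis B) q) (Reg (DBasis B) q) ℂ) :
    IsCounterState (conjBy (lift q A) X) where
  diag := conjBy_lift_support hq A hqc (fun a b => a = b) hX.diag
  nonneg z := by
    rw [block_conjBy_lift hqc]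
    exact conj_nonneg _ (hX.nonneg z)

theorem IsCounterState.add {X Y : Matrix (Cfg (DBasis B)) (Cfg (DBasis B)) ℂ}
    (hX : IsCounterState X) (hY : IsCounterState Y) : IsCounterState (X + Y) where
  diag f g h := by
    by_contra hcon
    refine h ?_
    rw [Matrix.add_apply, not_not.1 fun h' => hcon (hX.diag f g h'),
      not_not.1 fun h' => hcon (hY.diag f g h'), add_zero]
  nonneg z := by
    rw [block_add]
    exact add_nonneg (hX.nonneg z) (hY.nonneg z)

theorem IsCounterState.sum {κ : Type*} {s : Finset κ}
    {X : κ → Matrix (Cfg (DBasis B)) (Cfg (DBasis B)) ℂ}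
    (hX : ∀ a, IsCounterState (X a)) : IsCounterState (∑ a ∈ s, X a) where
  diag f g h := by
    rw [Matrix.sum_apply] at h
    obtain ⟨a, -, ha⟩ := Finset.exists_ne_zero_of_sum_ne_zero h
    exact (hX a).diag f g ha
  nonneg z := by
    rw [block_sum]
    exact Finset.sum_nonneg fun a _ => (hX a).nonneg z

theorem weight_add (z : ℤ) (X Y : Matrix (Cfg (DBasis B)) (Cfg (DBasis B)) ℂ) :
    weight z (X + Y) = weight z X + weight z Y := by
  rw [weight, block_add, rtr_add]; rfl

theorem weight_sum {κ : Type*} (z : ℤ) (s : Finset κ)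
    (X : κ → Matrix (Cfg (DBasis B)) (Cfg (DBasis B)) ℂ) :
    weight z (∑ a ∈ s, X a) = ∑ a ∈ s, weight z (X a) := by
  rw [weight, block_sum, rtr_sum]; rfl

/-- A complete family of Kraus operators off the counter restricts to a complete family on each
block, so trace is conserved for each counter value separately. -/
theorem sum_weight_kraus (hq : Function.Injective q) (hqc : ∀ i, q i ≠ .qc)
    [Fintype (Reg (DBasis B) q)] [DecidableEq (Reg (DBasis B) q)] {κ : Type*} [Fintype κ]
    {A : κ → Matrix (Reg (DBasis B) q) (Reg (DBasis B) q) ℂ}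
    (hA : ∑ a, (A a).conjTranspose * A a = 1)
    (X : Matrix (Cfg (DBasis B)) (Cfg (DBasis B)) ℂ) (z : ℤ) :
    ∑ a, weight z (conjBy (lift q (A a)) X) = weight z X := by
  classical
  unfold weight
  simp only [block_conjBy_lift hqc]
  exact sum_rtr_conj (block_lift_complete hq hqc hA z) _

end Block

/-! ### States before the jump -/

section Form

variable {Q : Type} {B : Q → Type}

theorem splice_orig {ι : Type} {q : ι → Q} (hq : Function.Injective q) (f : Cfg (DBasis B))
    (s : Reg B q) :
    (fun p => splice (B := DBasis B) (fun i => DVar.orig (q i)) f s (.orig p)) =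
      splice q (fun p => f (.orig p)) s := by
  have hq' : Function.Injective (fun i => DVar.orig (q i)) := fun i i' h => hq (DVar.orig.inj h)
  funext p
  by_cases hp : ∃ i, q i = p
  · obtain ⟨i, rfl⟩ := hp
    rw [splice_apply hq]
    exact splice_apply (B := DBasis B) hq' f s i
  · push Not at hp
    rw [splice_of_forall_ne _ _ hp]
    exact splice_of_forall_ne (B := DBasis B) f s fun i h => hp i (DVar.orig.inj h)

variable [∀ q, Zero (B q)]

/-- Configurations with the same counter value `m ≥ 0`, the qubit `q₁` in state `|0⟩` and all copies
in state `|0⟩`. -/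
def IdlePair (f g : Cfg (DBasis B)) : Prop :=
  f .qc = g .qc ∧ (0 : ℤ) ≤ f .qc ∧ f .q1 = 0 ∧ g .q1 = 0 ∧ (∀ p, f (.copy p) = 0) ∧
    ∀ p, g (.copy p) = 0

open Classical in
/-- The state that is the mixture of the unnormalized states
`|m⟩⟨m| ⊗ |0⟩⟨0| ⊗ a m ⊗ |0⟩⟨0| ⊗ r m` of the counter, the qubits `q₁` and `q₂`, the copies and the
original variables. -/
def form (a : ℕ → Fin 2 → Fin 2 → ℂ) (r : ℕ → Matrix (Cfg B) (Cfg B) ℂ) :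
    Matrix (Cfg (DBasis B)) (Cfg (DBasis B)) ℂ :=
  fun f g =>
    if IdlePair f g then
      a (f .qc).toNat (f .q2) (g .q2) *
        r (f .qc).toNat (fun p => f (.orig p)) (fun p => g (.orig p))
    else 0

theorem form_of_idlePair (a : ℕ → Fin 2 → Fin 2 → ℂ) (r : ℕ → Matrix (Cfg B) (Cfg B) ℂ)
    {f g : Cfg (DBasis B)} (h : IdlePair f g) {m : ℕ} (hm : f .qc = (m : ℤ)) :
    form a r f g = a m (f .q2) (g .q2) * r m (fun p => f (.orig p)) (fun p => g (.orig p)) := by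
  unfold form
  rw [if_pos h, hm, Int.toNat_natCast]

theorem form_of_not_idlePair (a : ℕ → Fin 2 → Fin 2 → ℂ) (r : ℕ → Matrix (Cfg B) (Cfg B) ℂ)
    {f g : Cfg (DBasis B)} (h : ¬ IdlePair f g) : form a r f g = 0 := if_neg h

theorem form_sum {κ : Type*} (s : Finset κ) (a : ℕ → Fin 2 → Fin 2 → ℂ)
    (r : κ → ℕ → Matrix (Cfg B) (Cfg B) ℂ) :
    form a (fun m => ∑ x ∈ s, r x m) = ∑ x ∈ s, form a (r x) := by
  ext f g
  simp only [form, Matrix.sum_apply]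
  split_ifs with h
  · rw [Finset.mul_sum]
  · simp

/-- The register is disjoint from the counter, the flags and the copies, so the operator passes
through the product form and acts on `r` alone. -/
theorem conjBy_lift_form {ι : Type} {q : ι → Q} (hq : Function.Injective q) [Fintype (Reg B q)]
    (A : Matrix (Reg B q) (Reg B q) ℂ) (a : ℕ → Fin 2 → Fin 2 → ℂ)
    (r : ℕ → Matrix (Cfg B) (Cfg B) ℂ) :
    conjBy (lift (B := DBasis B) (fun i => DVar.orig (q i)) A) (form a r) =
      form a (fun m => conjBy (lift q A) (r m)) := by
  have hq' : Function.Injective (fun i => DVar.orig (q i)) := fun i i' h => hq (DVar.orig.inj h)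
  let _ : Fintype (Reg (DBasis B) (fun i => DVar.orig (q i))) := ‹Fintype (Reg B q)›
  ext f g
  rw [conjBy_lift hq']
  have hs : ∀ (f : Cfg (DBasis B)) (s : Reg B q) {v : DVar Q}, (∀ p, DVar.orig p ≠ v) →
      splice (B := DBasis B) (fun i => DVar.orig (q i)) f s v = f v :=
    fun f s v hv => splice_of_forall_ne (B := DBasis B) f s fun i => hv (q i)
  have hform : ∀ s s' : Reg B q,
      form a r (splice (B := DBasis B) (fun i => DVar.orig (q i)) f s)
        (splice (B := DBasis B) (fun i => DVar.orig (q i)) g s') =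
      form a (fun m => fun x y => r m (splice q x s) (splice q y s')) f g := by
    intro s s'
    have hc : IdlePair (splice (B := DBasis B) (fun i => DVar.orig (q i)) f s)
        (splice (B := DBasis B) (fun i => DVar.orig (q i)) g s') ↔ IdlePair f g := by
      unfold IdlePair
      rw [hs f s (v := .qc) (by simp), hs f s (v := .q1) (by simp), hs g s' (v := .qc) (by simp),
        hs g s' (v := .q1) (by simp)]
      simp only [hs f s (v := .copy _) (by simp), hs g s' (v := .copy _) (by simp)]
    unfold form
    rw [hs f s (v := .qc) (by simp), hs f s (v := .q2) (by simp), hs g s' (v := .q2) (by simp),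
      splice_orig hq, splice_orig hq]
    by_cases h : IdlePair f g
    · rw [if_pos h, if_pos (hc.2 h)]
    · rw [if_neg h, if_neg fun h' => h (hc.1 h')]
  refine (Finset.sum_congr rfl fun s' _ => Finset.sum_congr rfl fun s _ => by
    rw [hform s s']).trans ?_
  unfold form
  split_ifs with h
  · refine Eq.trans ?_ (congrArg _ (conjBy_lift hq A (r _) _ _).symm)
    rw [Finset.mul_sum]
    refine Finset.sum_congr rfl fun s' _ => ?_
    rw [Finset.mul_sum]
    refine Finset.sum_congr rfl fun s _ => ?_
    ring
  · simp

end Form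

/-! ### The rate distribution -/

/-- The probability `1 - ∑_{1 ≤ i < m} μ(i)` that no index below `m` is chosen. -/
def survival (μ : ℕ → ℝ) (m : ℕ) : ℝ := 1 - ∑ i ∈ Finset.Ico 1 m, μ i

/-- The amplitudes of the qubit `q₂` when the counter has the value `m`. -/
def amplitude (μ : ℕ → ℝ) (m : ℕ) (s : Fin 2) : ℂ :=
  rotY (2 * Real.arcsin (Real.sqrt (hazard μ m))) s 0

section Rate

variable {μ : ℕ → ℝ}

theorem survival_succ {m : ℕ} (hm : 1 ≤ m) : survival μ (m + 1) = survival μ m - μ m := by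
  rw [survival, survival, Finset.sum_Ico_succ_top hm]
  ring

theorem IsRateDistribution.survival_nonneg (hμ : IsRateDistribution μ) (m : ℕ) :
    0 ≤ survival μ m := by
  have h := sum_le_hasSum (Finset.range (m - 1)) (fun i _ => (hμ.pos (i + 1) (by omega)).le)
    hμ.hasSum
  rw [survival, Finset.sum_Ico_eq_sum_range]
  simp only [add_comm 1]
  linarith

theorem IsRateDistribution.le_survival (hμ : IsRateDistribution μ) {m : ℕ} (hm : 1 ≤ m) :
    μ m ≤ survival μ m := by
  have h := hμ.survival_nonneg (m + 1)
  rw [survival_succ hm] at h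
  linarith

theorem IsRateDistribution.survival_pos (hμ : IsRateDistribution μ) {m : ℕ} (hm : 1 ≤ m) :
    0 < survival μ m := (hμ.pos m hm).trans_le (hμ.le_survival hm)

theorem hazard_eq (μ : ℕ → ℝ) (m : ℕ) : hazard μ m = μ m / survival μ m := rfl

theorem IsRateDistribution.hazard_mem (hμ : IsRateDistribution μ) {m : ℕ} (hm : 1 ≤ m) :
    0 ≤ hazard μ m ∧ hazard μ m ≤ 1 := by
  rw [hazard_eq]
  exact ⟨div_nonneg (hμ.pos m hm).le (hμ.survival_nonneg m),
    (div_le_one (hμ.survival_pos hm)).2 (hμ.le_survival hm)⟩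

theorem star_amplitude (μ : ℕ → ℝ) (m : ℕ) (s : Fin 2) :
    star (amplitude μ m s) = amplitude μ m s := by
  fin_cases s <;> simp [amplitude, rotY, -Complex.ofReal_cos, -Complex.ofReal_sin]

/-- The squared amplitude is `cos² = 1 - hazard`, and `survival * (1 - hazard) = survival - μ`: the
weight with which no jump happens at `m`. -/
theorem IsRateDistribution.survival_mul_amplitude_zero (hμ : IsRateDistribution μ) {m : ℕ}
    (hm : 1 ≤ m) :
    (survival μ m : ℂ) * amplitude μ m 0 * amplitude μ m 0 = (survival μ (m + 1) : ℂ) := by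
  obtain ⟨h0, h1⟩ := hμ.hazard_mem hm
  have h2 : amplitude μ m 0 = (Real.cos (Real.arcsin (Real.sqrt (hazard μ m))) : ℂ) := by
    simp [amplitude, rotY]
  rw [h2, mul_assoc, ← Complex.ofReal_mul, ← Complex.ofReal_mul, Real.cos_arcsin,
    Real.sq_sqrt h0, Real.mul_self_sqrt (by linarith), survival_succ hm, hazard_eq]
  congr 1
  field_simp [(hμ.survival_pos hm).ne']

/-- The squared amplitude is `sin² = hazard`, so `survival` cancels: the jump at `m` has absolute
weight `μ m`. -/
theorem IsRateDistribution.survival_mul_amplitude_one (hμ : IsRateDistribution μ) {m : ℕ}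
    (hm : 1 ≤ m) :
    (survival μ m : ℂ) * amplitude μ m 1 * amplitude μ m 1 = (μ m : ℂ) := by
  obtain ⟨h0, h1⟩ := hμ.hazard_mem hm
  have h2 : amplitude μ m 1 = (Real.sin (Real.arcsin (Real.sqrt (hazard μ m))) : ℂ) := by
    simp [amplitude, rotY]
  rw [h2, mul_assoc, ← Complex.ofReal_mul, ← Complex.ofReal_mul,
    Real.sin_arcsin (by linarith [Real.sqrt_nonneg (hazard μ m)]) (Real.sqrt_le_one.2 h1),
    Real.mul_self_sqrt h0, hazard_eq]
  congr 1
  field_simp [(hμ.survival_pos hm).ne']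

end Rate

/-! ### The inserted code -/

section Counter

variable {Q : Type} {B : Q → Type} {k : ℕ}

/-- The assignment of the value `s` to `q₂`, on the register `(q_c, q₂)`. -/
def counterReg (z : ℤ) (s : Fin 2) : Reg (DBasis B) (regCounter (Q := Q))
  | false => z
  | true => s

theorem regCounter_injective : Function.Injective (regCounter (Q := Q)) := by
  intro a b h
  cases a <;> cases b <;> simp_all [regCounter]

/-- The block of `GP` for the value `z` of the counter. -/
def gpBlock (μ : ℕ → ℝ) (z : ℤ) : Matrix (Fin 2) (Fin 2) ℂ :=
  if 1 ≤ z then rotY (2 * Real.arcsin (Real.sqrt (hazard μ z.toNat))) else 1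

/-- `GP` is block diagonal in the counter, so only the two values of `q₂` survive. The function `c`
allows use with the entries and with their conjugates. -/
theorem tsum_opGP (μ : ℕ → ℝ) (f : Cfg (DBasis B)) (F : Reg (DBasis B) (regCounter (Q := Q)) → ℂ)
    (c : ℂ → ℂ) (hc : c 0 = 0) :
    ∑' r, c (opGP B μ (fun i => f (regCounter i)) r) * F r =
      ∑ s : Fin 2, c (gpBlock μ (f .qc) (f .q2) s) * F (counterReg (f .qc) s) := by
  have hinj : Function.Injective (counterReg (B := B) (f .qc)) :=
    fun s s' h => congrFun h true
  rw [← tsum_fintype (L := .unconditional _), ← hinj.tsum_eq]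
  · refine tsum_congr fun s => ?_
    congr 2
    unfold opGP gpBlock
    simp only [counterReg, if_true]
    split_ifs <;> rfl
  · intro r hr
    refine ⟨r true, funext fun b => ?_⟩
    cases b with
    | true => rfl
    | false =>
      by_contra hcon
      refine left_ne_zero_of_mul hr ?_
      have : opGP B μ (fun i => f (regCounter i)) r = 0 := if_neg hcon
      rw [this, hc]

variable [∀ q, Zero (B q)]

/-- Shift of a family along the counter. -/
def shift {α : Type*} [Zero α] (r : ℕ → α) : ℕ → α
  | 0 => 0
  | m + 1 => r m

/-- The amplitude identities hold for `m ≥ 1` only; since `r 0` will be zero, coefficients need to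
agree only where `r m` does not vanish. -/
theorem form_congr {a a' : ℕ → Fin 2 → Fin 2 → ℂ} {r : ℕ → Matrix (Cfg B) (Cfg B) ℂ}
    (h : ∀ m, r m ≠ 0 → a m = a' m) : form a r = form a' r := by
  ext f g
  simp only [form]
  by_cases h0 : r (Int.toNat (f .qc)) = 0
  · simp [h0]
  · rw [h _ h0]

theorem conjBy_opC (X : Matrix (Cfg (DBasis B)) (Cfg (DBasis B)) ℂ) (f g : Cfg (DBasis B)) :
    conjBy (lift (B := DBasis B) (fun _ : Unit => DVar.qc) opC) X f g =
      X (splice (B := DBasis B) (fun _ : Unit => DVar.qc) f (fun _ => (f .qc - 1 : ℤ)))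
        (splice (B := DBasis B) (fun _ : Unit => DVar.qc) g (fun _ => (g .qc - 1 : ℤ))) := by
  have hq : Function.Injective (fun _ : Unit => (DVar.qc : DVar Q)) :=
    Function.injective_of_subsingleton _
  have hne : ∀ (f : Cfg (DBasis B)) (b : Unit → ℤ), b ≠ (fun _ => (f .qc - 1 : ℤ)) →
      opC (fun _ => f .qc) b = 0 := by
    intro f b hb
    refine if_neg fun h => hb (funext fun _ => ?_)
    change (f .qc : ℤ) = b () + 1 at h
    exact eq_sub_of_add_eq h.symm
  have hone : ∀ f : Cfg (DBasis B), opC (fun _ => f .qc) (fun _ => (f .qc - 1 : ℤ)) = 1 := by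
    intro f
    exact if_pos (by ring)
  unfold conjBy
  rw [opMul_lift_conjTranspose hq, tsum_eq_single (fun _ => (g .qc - 1 : ℤ))]
  · rw [hone g, opMul_lift hq, tsum_eq_single (fun _ => (f .qc - 1 : ℤ)), hone f]
    · simp
    · intro b hb
      rw [hne f b hb, zero_mul]
  · intro b hb
    rw [hne g b hb, star_zero, mul_zero]

theorem conjBy_opC_form (a : ℕ → Fin 2 → Fin 2 → ℂ) (r : ℕ → Matrix (Cfg B) (Cfg B) ℂ) :
    conjBy (lift (B := DBasis B) (fun _ : Unit => DVar.qc) opC) (form a r) =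
      form (fun m => a (m - 1)) (shift r) := by
  have hq : Function.Injective (fun _ : Unit => (DVar.qc : DVar Q)) :=
    Function.injective_of_subsingleton _
  have hs : ∀ (f : Cfg (DBasis B)) (s : Unit → ℤ) {v : DVar Q}, DVar.qc ≠ v →
      splice (B := DBasis B) (fun _ : Unit => DVar.qc) f s v = f v :=
    fun f s v hv => splice_of_forall_ne (B := DBasis B) f s fun _ => hv
  have hc : ∀ (f : Cfg (DBasis B)) (s : Unit → ℤ),
      splice (B := DBasis B) (fun _ : Unit => DVar.qc) f s .qc = s () :=
    fun f s => splice_apply (B := DBasis B) hq f s ()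
  ext f g
  rw [conjBy_opC]
  have ho : ∀ (f : Cfg (DBasis B)) (s : Unit → ℤ),
      (fun p => splice (B := DBasis B) (fun _ : Unit => DVar.qc) f s (.orig p)) =
        fun p => f (.orig p) := fun f s => funext fun p => hs f s (by simp)
  have hcond : IdlePair (splice (B := DBasis B) (fun _ : Unit => DVar.qc) f
        (fun _ => (f .qc - 1 : ℤ)))
      (splice (B := DBasis B) (fun _ : Unit => DVar.qc) g (fun _ => (g .qc - 1 : ℤ))) ↔
      IdlePair f g ∧ (1 : ℤ) ≤ f .qc := by
    unfold IdlePair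
    rw [hc, hc, hs f _ (v := .q1) (by simp), hs g _ (v := .q1) (by simp)]
    simp only [hs f _ (v := .copy _) (by simp), hs g _ (v := .copy _) (by simp)]
    constructor
    · rintro ⟨h1, h2, h3⟩
      refine ⟨⟨?_, ?_, h3⟩, ?_⟩
      · exact sub_left_injective h1
      · exact le_trans h2 (Int.sub_le_self _ (by norm_num))
      · exact Int.le_of_sub_nonneg h2
    · rintro ⟨⟨h1, -, h3⟩, h4⟩
      exact ⟨by rw [h1], Int.sub_nonneg_of_le h4, h3⟩
  by_cases h : IdlePair f g
  · obtain ⟨m, hm⟩ := Int.eq_ofNat_of_zero_le h.2.1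
    rw [form_of_idlePair _ _ h hm]
    cases m with
    | zero =>
      -- Counter 0 is reached from -1, where there is no idle state; this matches the zero that
      -- `shift` puts at index 0.
      rw [form_of_not_idlePair _ _ fun h' => by simpa [hm] using (hcond.1 h').2]
      simp [shift]
    | succ m =>
      rw [form_of_idlePair _ _ (hcond.2 ⟨h, by rw [hm]; push_cast; omega⟩) (m := m)
        (by rw [hc, hm]; push_cast; ring), hs f _ (v := .q2) (by simp),
        hs g _ (v := .q2) (by simp), ho, ho]
      simp [shift]
  · rw [form_of_not_idlePair _ _ h, form_of_not_idlePair _ _ fun h' => h (hcond.1 h').1]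

theorem conjBy_opGP (μ : ℕ → ℝ) (X : Matrix (Cfg (DBasis B)) (Cfg (DBasis B)) ℂ)
    (f g : Cfg (DBasis B)) :
    conjBy (lift regCounter (opGP B μ)) X f g = ∑ s' : Fin 2, ∑ s : Fin 2,
      gpBlock μ (f .qc) (f .q2) s *
        X (splice regCounter f (counterReg (f .qc) s)) (splice regCounter g (counterReg (g .qc) s'))
        * star (gpBlock μ (g .qc) (g .q2) s') := by
  unfold conjBy
  rw [opMul_lift_conjTranspose regCounter_injective]
  have h1 := tsum_opGP μ g (fun r => opMul (lift regCounter (opGP B μ)) X f (splice regCounter g r))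
    star (star_zero ℂ)
  simp only [mul_comm (star _)] at h1
  rw [h1]
  refine Finset.sum_congr rfl fun s' _ => ?_
  rw [opMul_lift regCounter_injective, ← Finset.sum_mul]
  congr 1
  exact tsum_opGP μ f (fun r => X (splice regCounter f r) _) id rfl

/-- Rotating `|0⟩` produces the first column of the rotation, which is `amplitude`. At counter 0
`GP` is the identity instead, hence `r 0 = 0`. -/
theorem conjBy_opGP_form (μ : ℕ → ℝ) (α : ℕ → ℂ) {r : ℕ → Matrix (Cfg B) (Cfg B) ℂ}
    (hr : r 0 = 0) :
    conjBy (lift regCounter (opGP B μ))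
        (form (fun m s s' => if s = 0 ∧ s' = 0 then α m else 0) r) =
      form (fun m s s' => α m * amplitude μ m s * amplitude μ m s') r := by
  have hs : ∀ (f : Cfg (DBasis B)) s {v : DVar Q}, DVar.qc ≠ v → DVar.q2 ≠ v →
      splice regCounter f s v = f v :=
    fun f s v hv hv' => splice_of_forall_ne (B := DBasis B) f s fun i => by cases i <;> assumption
  have hc : ∀ (f : Cfg (DBasis B)) z s,
      splice regCounter f (counterReg z s) .qc = z :=
    fun f z s => splice_apply (B := DBasis B) regCounter_injective f _ false
  have h2 : ∀ (f : Cfg (DBasis B)) z s,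
      splice regCounter f (counterReg z s) .q2 = s :=
    fun f z s => splice_apply (B := DBasis B) regCounter_injective f _ true
  have ho : ∀ (f : Cfg (DBasis B)) s,
      (fun p => splice regCounter f s (.orig p)) =
        fun p => f (.orig p) := fun f s => funext fun p => hs f s (by simp) (by simp)
  ext f g
  rw [conjBy_opGP]
  have hcond : ∀ s s', IdlePair (splice regCounter f (counterReg (f .qc) s))
      (splice regCounter g (counterReg (g .qc) s')) ↔ IdlePair f g := by
    intro s s'
    unfold IdlePair
    rw [hc, hc, hs f _ (v := .q1) (by simp) (by simp), hs g _ (v := .q1) (by simp) (by simp)]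
    simp only [hs f _ (v := .copy _) (by simp) (by simp),
      hs g _ (v := .copy _) (by simp) (by simp)]
  by_cases h : IdlePair f g
  · obtain ⟨m, hm⟩ := Int.eq_ofNat_of_zero_le h.2.1
    have hg : (g .qc : ℤ) = m := h.1.symm.trans hm
    rw [form_of_idlePair _ _ h hm]
    have hsum : ∀ s s', form (fun m s s' => if s = 0 ∧ s' = 0 then α m else 0) r
        (splice regCounter f (counterReg (f .qc) s)) (splice regCounter g (counterReg (g .qc) s')) =
        (if s = 0 ∧ s' = 0 then α m else 0) *
          r m (fun p => f (.orig p)) (fun p => g (.orig p)) := by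
      intro s s'
      rw [form_of_idlePair _ _ ((hcond s s').2 h) (m := m) (by rw [hc, hm]), h2, h2, ho, ho]
    simp only [hsum, Fin.sum_univ_two]
    rw [hm, hg]
    cases m with
    | zero => simp [hr]
    | succ m =>
      have hgp : ∀ s, gpBlock μ ((m + 1 : ℕ) : ℤ) s 0 = amplitude μ (m + 1) s := by
        intro s
        unfold gpBlock amplitude
        rw [if_pos (by push_cast; omega)]
        rfl
      rw [hgp, hgp, star_amplitude]
      simp
      ring
  · rw [form_of_not_idlePair _ _ h]
    refine Finset.sum_eq_zero fun s' _ => Finset.sum_eq_zero fun s _ => ?_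
    rw [form_of_not_idlePair _ _ fun h' => h ((hcond s s').1 h')]
    simp

/-- The state of a program that has not yet been differentiated. -/
def runState (μ : ℕ → ℝ) (r : ℕ → Matrix (Cfg B) (Cfg B) ℂ) :
    Matrix (Cfg (DBasis B)) (Cfg (DBasis B)) ℂ :=
  form (fun m s s' => survival μ m * amplitude μ m s * amplitude μ m s') r

/-- The weight `survival μ (m + 1)` left after not jumping at `m` is the survival weight belonging
to the new counter value, so the form `runState` is restored. -/
theorem sem_stepCounter (μ : ℕ → ℝ) (θ : Fin k → ℝ) (r : ℕ → Matrix (Cfg B) (Cfg B) ℂ) :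
    (stepCounter B μ).sem θ
        (form (fun m s s' => if s = 0 ∧ s' = 0 then (survival μ (m + 1) : ℂ) else 0) r) =
      runState μ (shift r) := by
  simp only [stepCounter, Prog.sem]
  rw [conjBy_opC_form, conjBy_opGP_form μ (fun m => (survival μ (m - 1 + 1) : ℂ)) rfl]
  refine form_congr fun m hm => ?_
  cases m with
  | zero => exact absurd rfl hm
  | succ m => simp

end Counter

/-! ### The measurement of the flags and the code run at a jump -/

section Flags

variable {Q : Type} {B : Q → Type} {k : ℕ}

theorem regFlags_injective : Function.Injective (regFlags (Q := Q)) := by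
  intro a b h
  cases a <;> cases b <;> simp_all [regFlags]

/-- The outcome of the measurement of the flags. -/
def flagOutcome (f : Cfg (DBasis B)) : Fin 3 :=
  if (f .q1 : Fin 2) = 0 then (if (f .q2 : Fin 2) = 0 then 0 else 1) else 2

theorem lift_measFlags [DecidableEq (Cfg (DBasis B))] (m : Fin 3) (f g : Cfg (DBasis B)) :
    lift regFlags (measFlags B m) f g = if f = g ∧ flagOutcome f = m then 1 else 0 := by
  by_cases h : f = g ∧ flagOutcome f = m
  · rw [if_pos h]
    obtain ⟨rfl, h⟩ := h
    unfold lift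
    rw [if_pos fun _ _ => rfl]
    exact if_pos ⟨rfl, rfl, h⟩
  · rw [if_neg h]
    unfold lift
    split_ifs with h1
    · refine if_neg fun h2 => h ⟨?_, h2.2.2⟩
      rw [← splice_eq_of_agree regFlags_injective h1]
      have : (fun i => g (regFlags i)) = fun i => f (regFlags i) := by
        funext i
        cases i
        · exact h2.1.symm
        · exact h2.2.1.symm
      rw [this]
      exact (splice_eq_of_agree regFlags_injective fun _ _ => rfl).symm
    · rfl

theorem conjBy_measFlags (m : Fin 3) (X : Matrix (Cfg (DBasis B)) (Cfg (DBasis B)) ℂ)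
    (f g : Cfg (DBasis B)) :
    conjBy (lift regFlags (measFlags B m)) X f g =
      if flagOutcome f = m ∧ flagOutcome g = m then X f g else 0 := by
  classical
  unfold conjBy opMul
  rw [tsum_eq_single g, tsum_eq_single f]
  · simp only [Matrix.conjTranspose_apply, lift_measFlags]
    by_cases h1 : flagOutcome f = m <;> by_cases h2 : flagOutcome g = m <;> simp [h1, h2]
  · intro h hh
    rw [lift_measFlags, if_neg fun h' => hh h'.1.symm, zero_mul]
  · intro h hh
    rw [Matrix.conjTranspose_apply, lift_measFlags, if_neg fun h' => hh h'.1.symm, star_zero,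
      mul_zero]

/-- States supported on the value `|1⟩` of the qubit `q₁`. -/
def IsFlagged (X : Matrix (Cfg (DBasis B)) (Cfg (DBasis B)) ℂ) : Prop :=
  ∀ f g, X f g ≠ 0 → (f .q1 : Fin 2) = 1 ∧ (g .q1 : Fin 2) = 1

theorem IsFlagged.add {X Y : Matrix (Cfg (DBasis B)) (Cfg (DBasis B)) ℂ}
    (hX : IsFlagged X) (hY : IsFlagged Y) : IsFlagged (X + Y) := by
  intro f g h
  by_contra hcon
  refine h ?_
  rw [Matrix.add_apply, not_not.1 fun h' => hcon (hX f g h'),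
    not_not.1 fun h' => hcon (hY f g h'), add_zero]

theorem IsFlagged.sum {κ : Type*} {s : Finset κ}
    {X : κ → Matrix (Cfg (DBasis B)) (Cfg (DBasis B)) ℂ}
    (hX : ∀ a, IsFlagged (X a)) : IsFlagged (∑ a ∈ s, X a) := by
  intro f g h
  rw [Matrix.sum_apply] at h
  obtain ⟨a, -, ha⟩ := Finset.exists_ne_zero_of_sum_ne_zero h
  exact hX a f g ha

theorem IsFlagged.conjBy_lift {X : Matrix (Cfg (DBasis B)) (Cfg (DBasis B)) ℂ}
    (hX : IsFlagged X) {ι : Type} {q : ι → DVar Q} (hq : Function.Injective q)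
    (hq1 : ∀ i, q i ≠ .q1) [Finite (Reg (DBasis B) q)]
    (A : Matrix (Reg (DBasis B) q) (Reg (DBasis B) q) ℂ) : IsFlagged (conjBy (lift q A) X) :=
  conjBy_lift_support hq A hq1 (fun a b => (a : Fin 2) = 1 ∧ (b : Fin 2) = 1) hX

/-- A state that is diagonal in the counter with positive blocks, is flagged, and has given
block weights. -/
structure IsJumped (w : ℤ → ℝ) (X : Matrix (Cfg (DBasis B)) (Cfg (DBasis B)) ℂ)
    [Finite Q] [∀ q, Finite (B q)] : Prop where
  state : IsCounterState X
  flagged : IsFlagged X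
  weight_eq : ∀ z, weight z X = w z

theorem conjBy_opX_flagged {X : Matrix (Cfg (DBasis B)) (Cfg (DBasis B)) ℂ}
    (hX : ∀ f g, X f g ≠ 0 → (f .q1 : Fin 2) = 0 ∧ (g .q1 : Fin 2) = 0) :
    IsFlagged (conjBy (lift (B := DBasis B) (fun _ : Unit => DVar.q1) opX) X) := by
  have hq : Function.Injective (fun _ : Unit => (DVar.q1 : DVar Q)) :=
    Function.injective_of_subsingleton _
  let _ : Fintype (Reg (DBasis B) (fun _ : Unit => (DVar.q1 : DVar Q))) :=
    inferInstanceAs (Fintype (Unit → Fin 2))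
  intro f g hne
  rw [conjBy_lift hq] at hne
  obtain ⟨r', -, h1⟩ := Finset.exists_ne_zero_of_sum_ne_zero hne
  obtain ⟨r, -, h2⟩ := Finset.exists_ne_zero_of_sum_ne_zero h1
  have h3 := hX _ _ (right_ne_zero_of_mul (left_ne_zero_of_mul h2))
  rw [splice_apply (B := DBasis B) hq f r (), splice_apply (B := DBasis B) hq g r' ()] at h3
  have key : ∀ (a b : Unit → Fin 2), opX a b ≠ 0 → b () = 0 → a () = 1 := by
    intro a b hab hb
    have : a () ≠ b () := by
      by_contra hcon
      exact hab (if_neg (not_not.2 hcon))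
    omega
  exact ⟨key _ _ (left_ne_zero_of_mul (left_ne_zero_of_mul h2)) h3.1,
    key _ _ (star_ne_zero.1 (right_ne_zero_of_mul h2)) h3.2⟩

theorem opX_unitary : opX.conjTranspose * opX = 1 := by
  ext a b
  rw [Matrix.mul_apply, ← (Equiv.funUnique Unit (Fin 2)).symm.sum_comp]
  have h : a = b ↔ a () = b () := ⟨fun h => by rw [h], fun h => funext fun _ => h⟩
  simp only [Matrix.conjTranspose_apply, opX, Fin.sum_univ_two, Matrix.one_apply, h]
  generalize a () = x
  generalize b () = y
  fin_cases x <;> fin_cases y <;> simp [Equiv.funUnique]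

theorem halfId_eq : halfId = (1 / 2 : ℂ) • (1 : Matrix (Unit → Fin 2) (Unit → Fin 2) ℂ) := by
  ext a b
  have h : a = b ↔ a () = b () := ⟨fun h => by rw [h], fun h => funext fun _ => h⟩
  simp [halfId, Matrix.one_apply, h]

theorem halfId_posSemidef : halfId.PosSemidef := by
  rw [halfId_eq]
  refine Matrix.PosSemidef.one.smul ?_
  simp

theorem halfId_trace : halfId.trace = 1 := by
  rw [halfId_eq, Matrix.trace_smul, Matrix.trace_one]
  simp

theorem swapOp_isHermitian (R : Type) : (swapOp R).IsHermitian := by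
  ext a b
  simp only [Matrix.conjTranspose_apply, swapOp]
  by_cases h : a.1 = b.2 ∧ a.2 = b.1
  · rw [if_pos h, if_pos ⟨h.2.symm, h.1.symm⟩, star_one]
  · rw [if_neg h, if_neg fun h' => h ⟨h'.2.symm, h'.1.symm⟩, star_zero]

/-- Splitting the register `(q₂, q̄, q̄')`. -/
def swapEquiv {ι : Type} (q : ι → Q) :
    Reg (DBasis B) (regSwap q) ≃ (Reg B q × Reg B q) × Fin 2 where
  toFun a := ((fun i => a (some (.inl i)), fun i => a (some (.inr i))), a none)
  invFun x
    | none => x.2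
    | some (.inl i) => x.1.1 i
    | some (.inr i) => x.1.2 i
  left_inv a := by
    funext i
    rcases i with - | i | i <;> rfl
  right_inv x := rfl

/-- Ordering the register by `q₂` makes the gate block diagonal with blocks `exp (∓iπ/4 S)`, unitary
because `S` is Hermitian. -/
theorem opAS_unitary {ι : Type} (q : ι → Q) [Finite (Reg B q)]
    [Fintype (Reg (DBasis B) (regSwap q))] [DecidableEq (Reg (DBasis B) (regSwap q))] :
    (opAS B q).conjTranspose * opAS B q = 1 := by
  classical
  have := Fintype.ofFinite (Reg B q)
  set E : Fin 2 → Matrix (Reg B q × Reg B q) (Reg B q × Reg B q) ℂ := fun s =>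
    expGate (if s = 0 then Real.pi / 4 else -(Real.pi / 4)) (swapOp (Reg B q)) with hE
  have h : opAS B q = (Matrix.blockDiagonal E).submatrix (swapEquiv q) (swapEquiv q) := by
    ext a b
    simp only [Matrix.submatrix_apply, Matrix.blockDiagonal_apply]
    rfl
  rw [h, Matrix.conjTranspose_submatrix, Matrix.submatrix_mul_equiv,
    Matrix.blockDiagonal_conjTranspose, ← Matrix.blockDiagonal_mul]
  have h1 : (fun s => (E s).conjTranspose * E s) = 1 :=
    funext fun s => expGate_unitary _ (swapOp_isHermitian _)
  rw [h1, Matrix.blockDiagonal_one, Matrix.submatrix_one_equiv]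

section Channels

variable [Finite Q] [∀ q, Finite (B q)] {w : ℤ → ℝ}
  {X : Matrix (Cfg (DBasis B)) (Cfg (DBasis B)) ℂ} {ι : Type} {q : ι → DVar Q}

theorem weight_gate (hq : Function.Injective q) (hqc : ∀ i, q i ≠ .qc)
    [Fintype (Reg (DBasis B) q)] [DecidableEq (Reg (DBasis B) q)]
    {U : Matrix (Reg (DBasis B) q) (Reg (DBasis B) q) ℂ} (hU : U.conjTranspose * U = 1)
    (X : Matrix (Cfg (DBasis B)) (Cfg (DBasis B)) ℂ) (z : ℤ) :
    weight z (conjBy (lift q U) X) = weight z X := by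
  have h := sum_weight_kraus (κ := Unit) (A := fun _ => U) hq hqc (by simpa using hU) X z
  simpa using h

theorem IsJumped.gate (hX : IsJumped w X) (hq : Function.Injective q) (hqc : ∀ i, q i ≠ .qc)
    (hq1 : ∀ i, q i ≠ .q1) [Fintype (Reg (DBasis B) q)] [DecidableEq (Reg (DBasis B) q)]
    {U : Matrix (Reg (DBasis B) q) (Reg (DBasis B) q) ℂ} (hU : U.conjTranspose * U = 1) :
    IsJumped w (conjBy (lift q U) X) where
  state := hX.state.conjBy_lift hq hqc U
  flagged := hX.flagged.conjBy_lift hq hq1 U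
  weight_eq z := by rw [weight_gate hq hqc hU, hX.weight_eq]

theorem IsJumped.resetTo (hX : IsJumped w X) (hq : Function.Injective q) (hqc : ∀ i, q i ≠ .qc)
    (hq1 : ∀ i, q i ≠ .q1) [Fintype (Reg (DBasis B) q)] [DecidableEq (Reg (DBasis B) q)]
    {σ : Matrix (Reg (DBasis B) q) (Reg (DBasis B) q) ℂ} (hσ : σ.PosSemidef)
    (htr : σ.trace = 1) : IsJumped w (resetTo q σ X) := by
  obtain ⟨A, hA, h⟩ := exists_kraus_resetTo hq hσ htr
  rw [h]
  exact ⟨IsCounterState.sum fun a => hX.state.conjBy_lift hq hqc (A a),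
    IsFlagged.sum fun a => hX.flagged.conjBy_lift hq hq1 (A a), fun z => by
      rw [weight_sum, sum_weight_kraus hq hqc hA, hX.weight_eq]⟩

end Channels

section Pinned

variable [∀ q, Zero (B q)]

/-- The configuration with `q_c = z`, `q₁ = 0`, `q₂ = s`, all copies `0`, and given values of the
original variables. -/
def idleCfg (z : ℤ) (s : Fin 2) (x : Cfg B) : Cfg (DBasis B)
  | .orig p => x p
  | .copy _ => 0
  | .q1 => (0 : Fin 2)
  | .q2 => s
  | .qc => z

open Classical in
/-- The isometry `x ↦ |z⟩|0⟩|s⟩|0⟩|x⟩`. -/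
def idleEmbed {Q : Type} (B : Q → Type) [∀ q, Zero (B q)] (z : ℤ) (s : Fin 2) : Matrix (Block B z) (Cfg B) ℂ :=
  fun f x => if f.1 = idleCfg z s x then 1 else 0

theorem idleCfg_injective (z : ℤ) (s : Fin 2) : Function.Injective (idleCfg (B := B) z s) :=
  fun _ _ h => funext fun p => congrFun h (.orig p)

/-- Configurations of the form `idleCfg z s x`. -/
def IsIdle (z : ℤ) (s : Fin 2) (f : Cfg (DBasis B)) : Prop :=
  f = idleCfg z s (fun p => f (.orig p))

theorem isIdle_iff (z : ℤ) (s : Fin 2) (f : Cfg (DBasis B)) :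
    IsIdle z s f ↔ (f .qc = z ∧ (f .q1 : Fin 2) = 0 ∧ f .q2 = s) ∧ ∀ p, f (.copy p) = 0 := by
  constructor
  · intro h
    exact ⟨⟨congrFun h .qc, congrFun h .q1, congrFun h .q2⟩, fun p => congrFun h (.copy p)⟩
  · rintro ⟨⟨h1, h2, h3⟩, h4⟩
    funext v
    cases v with
    | orig p => rfl
    | copy p => exact h4 p
    | q1 => exact h2
    | q2 => exact h3
    | qc => exact h1

open Classical in
theorem idleEmbed_apply (z : ℤ) (s : Fin 2) (f : Block B z) (x : Cfg B) :
    idleEmbed B z s f x = if (fun p => f.1 (.orig p)) = x ∧ IsIdle z s f.1 then 1 else 0 := by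
  unfold idleEmbed
  refine if_congr ⟨fun h => ?_, fun h => ?_⟩ rfl rfl
  · have : (fun p => f.1 (.orig p)) = x := by rw [h]; rfl
    exact ⟨this, by unfold IsIdle; rw [this]; exact h⟩
  · rw [← h.1]; exact h.2

open Classical in
theorem idleEmbed_conj_apply [Fintype (Cfg B)] (z : ℤ) (s : Fin 2) (r : Matrix (Cfg B) (Cfg B) ℂ)
    (f g : Block B z) :
    (idleEmbed B z s * r * (idleEmbed B z s).conjTranspose) f g =
      if IsIdle z s f.1 ∧ IsIdle z s g.1 then
        r (fun p => f.1 (.orig p)) (fun p => g.1 (.orig p)) else 0 := by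
  simp only [Matrix.mul_apply, Matrix.conjTranspose_apply, idleEmbed_apply]
  by_cases h1 : IsIdle z s f.1 <;> by_cases h2 : IsIdle z s g.1 <;> simp [h1, h2]

/-- The state `∑ m, α m |m⟩⟨m| ⊗ |0⟩⟨0| ⊗ |s⟩⟨s| ⊗ |0⟩⟨0| ⊗ r m`. -/
def pinned (s : Fin 2) (α : ℕ → ℝ) (r : ℕ → Matrix (Cfg B) (Cfg B) ℂ) :
    Matrix (Cfg (DBasis B)) (Cfg (DBasis B)) ℂ :=
  form (fun m t t' => if t = s ∧ t' = s then (α m : ℂ) else 0) r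

theorem block_pinned_of_neg (s : Fin 2) (α : ℕ → ℝ) (r : ℕ → Matrix (Cfg B) (Cfg B) ℂ) {z : ℤ}
    (hz : z < 0) : block z (pinned s α r) = 0 := by
  ext f g
  rw [block, Matrix.submatrix_apply]
  refine form_of_not_idlePair _ r fun h => ?_
  have := h.2.1
  rw [f.2] at this
  omega

theorem pinned_idlePair {s : Fin 2} {α : ℕ → ℝ} {r : ℕ → Matrix (Cfg B) (Cfg B) ℂ}
    {f g : Cfg (DBasis B)} (h : pinned s α r f g ≠ 0) : IdlePair f g := by
  by_contra hcon
  exact h (form_of_not_idlePair _ _ hcon)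

/-- The code that is executed when the flags are in the state `|01⟩`. -/
def jumpCode {ι : Type} [Fintype ι] [DecidableEq ι] (q : ι → Q) [Finite (Reg B q)]
    (σ : Matrix (Reg B q) (Reg B q) ℂ) : Prog (DBasis B) k :=
  .seq (.gate (fun _ : Unit => DVar.q1) opX)
    (.seq (.initTo (fun _ : Unit => DVar.q2) halfId)
      (.seq (.initTo (fun i => DVar.copy (q i)) σ)
        (.gate (regSwap q) (opAS B q))))

theorem regSwap_injective {ι : Type} {q : ι → Q} (hq : Function.Injective q) :
    Function.Injective (regSwap q) := by
  intro a b h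
  rcases a with - | a | a <;> rcases b with - | b | b <;> simp_all [regSwap, hq.eq_iff]

/-- The measurement separates three parts: `q₂ = 0`, which keeps weight `survival μ (m + 1)` and
steps the counter; `q₂ = 1`, which has weight `μ m` and jumps; and the flagged part, on which
nothing happens. Coherences between the values of `q₂` are projected away. -/
theorem sem_eulCode (θ : Fin k → ℝ) {μ : ℕ → ℝ} (hμ : IsRateDistribution μ)
    {ι : Type} [Fintype ι] [DecidableEq ι] {q : ι → Q} [Finite (Reg B q)]
    {σ : Matrix (Reg B q) (Reg B q) ℂ} {r : ℕ → Matrix (Cfg B) (Cfg B) ℂ} (hr : r 0 = 0)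
    {Y : Matrix (Cfg (DBasis B)) (Cfg (DBasis B)) ℂ} (hY : IsFlagged Y) :
    (eulCode (k := k) B μ q σ).sem θ (runState μ r + Y) =
      runState μ (shift r) + ((jumpCode (k := k) q σ).sem θ (pinned 1 μ r) + Y) := by
  have hm : ∀ m, r m ≠ 0 → 1 ≤ m := fun m h => by
    rcases Nat.eq_zero_or_pos m with rfl | h'
    · exact absurd hr h
    · exact h'
  have hYz : ∀ {f g : Cfg (DBasis B)}, ((f .q1 : Fin 2) = 0 ∨ (g .q1 : Fin 2) = 0) → Y f g = 0 := by
    intro f g h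
    by_contra hcon
    have := hY f g hcon
    rcases h with h | h
    · rw [this.1] at h; exact one_ne_zero h
    · rw [this.2] at h; exact one_ne_zero h
  have hfin : ∀ s : Fin 2, s = 0 ∨ s = 1 := fun s => by omega
  have h0 : conjBy (lift regFlags (measFlags B 0)) (runState μ r + Y) =
      form (fun m s s' => if s = 0 ∧ s' = 0 then (survival μ (m + 1) : ℂ) else 0) r := by
    rw [← form_congr (a := fun m s s' => if s = 0 ∧ s' = 0 then
      (survival μ m * amplitude μ m 0 * amplitude μ m 0 : ℂ) else 0) fun m h => by
        rw [hμ.survival_mul_amplitude_zero (hm m h)]]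
    ext f g
    rw [conjBy_measFlags, Matrix.add_apply]
    by_cases h : IdlePair f g
    · obtain ⟨m, hm⟩ := Int.eq_ofNat_of_zero_le h.2.1
      rw [runState, form_of_idlePair _ _ h hm, form_of_idlePair _ _ h hm, hYz (Or.inl h.2.2.1),
        add_zero, flagOutcome, if_pos h.2.2.1, flagOutcome, if_pos h.2.2.2.1]
      rcases hfin (f .q2) with h1 | h1 <;> rcases hfin (g .q2) with h2 | h2 <;> simp [h1, h2]
    · rw [runState, form_of_not_idlePair _ _ h, form_of_not_idlePair _ _ h, zero_add]
      split_ifs with h1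
      · refine hYz (Or.inl ?_)
        by_contra hcon
        rw [flagOutcome, if_neg hcon] at h1
        exact absurd h1.1 (by decide)
      · rfl
  have h1 : conjBy (lift regFlags (measFlags B 1)) (runState μ r + Y) = pinned 1 μ r := by
    rw [pinned, ← form_congr (a := fun m s s' => if s = 1 ∧ s' = 1 then
      (survival μ m * amplitude μ m 1 * amplitude μ m 1 : ℂ) else 0) fun m h => by
        rw [hμ.survival_mul_amplitude_one (hm m h)]]
    ext f g
    rw [conjBy_measFlags, Matrix.add_apply]
    by_cases h : IdlePair f g
    · obtain ⟨m, hm⟩ := Int.eq_ofNat_of_zero_le h.2.1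
      rw [runState, form_of_idlePair _ _ h hm, form_of_idlePair _ _ h hm, hYz (Or.inl h.2.2.1),
        add_zero, flagOutcome, if_pos h.2.2.1, flagOutcome, if_pos h.2.2.2.1]
      rcases hfin (f .q2) with h1 | h1 <;> rcases hfin (g .q2) with h2 | h2 <;> simp [h1, h2]
    · rw [runState, form_of_not_idlePair _ _ h, form_of_not_idlePair _ _ h, zero_add]
      split_ifs with h1
      · refine hYz (Or.inl ?_)
        by_contra hcon
        rw [flagOutcome, if_neg hcon] at h1
        exact absurd h1.1 (by decide)
      · rfl
  have h2 : conjBy (lift regFlags (measFlags B 2)) (runState μ r + Y) = Y := by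
    ext f g
    rw [conjBy_measFlags, Matrix.add_apply]
    have hout : ∀ f : Cfg (DBasis B), flagOutcome f = 2 ↔ (f .q1 : Fin 2) = 1 := by
      intro f
      unfold flagOutcome
      rcases hfin (f .q1) with h1 | h1 <;> rcases hfin (f .q2) with h2 | h2 <;> simp [h1, h2]
    simp only [hout]
    split_ifs with h
    · rw [runState, form_of_not_idlePair, zero_add]
      intro h'
      have := h'.2.2.1.symm.trans h.1
      exact zero_ne_one this
    · by_contra hcon
      exact h (hY f g (Ne.symm hcon))
  simp only [eulCode, Prog.sem, Fin.sum_univ_three, h0, h1, h2]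
  rw [add_assoc]
  congr 1
  exact sem_stepCounter μ θ r

variable [Fintype Q] [DecidableEq Q] [∀ q, Fintype (B q)] [∀ q, DecidableEq (B q)]

theorem idleEmbed_isometry (z : ℤ) (s : Fin 2) :
    (idleEmbed B z s).conjTranspose * idleEmbed B z s = 1 := by
  ext x y
  rw [Matrix.mul_apply, Finset.sum_eq_single (⟨idleCfg z s x, rfl⟩ : Block B z)]
  · simp [idleEmbed, Matrix.one_apply, (idleCfg_injective (B := B) z s).eq_iff]
  · intro f _ hf
    have : f.1 ≠ idleCfg z s x := fun h => hf (Subtype.ext h)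
    simp [idleEmbed, this]
  · simp

/-- Exhibits the block as an isometric image of `α m • r m`, from which positivity and trace are
read off. -/
theorem block_pinned (s : Fin 2) (α : ℕ → ℝ) (r : ℕ → Matrix (Cfg B) (Cfg B) ℂ) (m : ℕ) :
    block (m : ℤ) (pinned s α r) =
      idleEmbed B (m : ℤ) s * (α m • r m) * (idleEmbed B (m : ℤ) s).conjTranspose := by
  classical
  ext f g
  rw [idleEmbed_conj_apply, block, Matrix.submatrix_apply, pinned]
  by_cases h : IdlePair f.1 g.1
  · rw [form_of_idlePair _ _ h f.2]
    have hf : IsIdle (m : ℤ) s f.1 ↔ f.1 .q2 = s := by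
      rw [isIdle_iff]
      exact ⟨fun h' => h'.1.2.2, fun h' => ⟨⟨f.2, h.2.2.1, h'⟩, h.2.2.2.2.1⟩⟩
    have hg : IsIdle (m : ℤ) s g.1 ↔ g.1 .q2 = s := by
      rw [isIdle_iff]
      exact ⟨fun h' => h'.1.2.2, fun h' => ⟨⟨g.2, h.2.2.2.1, h'⟩, h.2.2.2.2.2⟩⟩
    rw [hf, hg]
    split_ifs with h1
    · simp
    · simp
  · rw [form_of_not_idlePair _ _ h, if_neg]
    rintro ⟨hf, hg⟩
    rw [isIdle_iff] at hf hg
    exact h ⟨f.2.trans g.2.symm, by rw [f.2]; exact Int.natCast_nonneg m, hf.1.2.1, hg.1.2.1,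
      hf.2, hg.2⟩

theorem isCounterState_pinned (s : Fin 2) {α : ℕ → ℝ} {r : ℕ → Matrix (Cfg B) (Cfg B) ℂ}
    (h : ∀ m, 0 ≤ α m • r m) : IsCounterState (pinned s α r) where
  diag _ _ h := (pinned_idlePair h).1
  nonneg z := by
    rcases lt_or_ge z 0 with hz | hz
    · rw [block_pinned_of_neg s α r hz]
    · obtain ⟨m, rfl⟩ := Int.eq_ofNat_of_zero_le hz
      rw [block_pinned]
      exact conj_nonneg _ (h m)

theorem weight_pinned (s : Fin 2) (α : ℕ → ℝ) (r : ℕ → Matrix (Cfg B) (Cfg B) ℂ) (m : ℕ) :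
    weight (m : ℤ) (pinned s α r) = α m * rtr (r m) := by
  have h : rtr (idleEmbed B (m : ℤ) s * (α m • r m) * (idleEmbed B (m : ℤ) s).conjTranspose) =
      rtr ((idleEmbed B (m : ℤ) s).conjTranspose * idleEmbed B (m : ℤ) s * (α m • r m)) := by
    rw [rtr, rtr, Matrix.trace_mul_comm, Matrix.mul_assoc]
  rw [weight, block_pinned, h, idleEmbed_isometry, one_mul, rtr_smul]

/-- `X` sets the flag; all later operations avoid `q₁` and `q_c` and are trace preserving, hence
preserve the weight of every block. -/
theorem isJumped_jumpCode (θ : Fin k → ℝ) {ι : Type} [Fintype ι] [DecidableEq ι] {q : ι → Q}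
    (hq : Function.Injective q) {σ : Matrix (Reg B q) (Reg B q) ℂ} (hσ : σ.PosSemidef)
    (htr : σ.trace = 1) (s : Fin 2) {α : ℕ → ℝ} {r : ℕ → Matrix (Cfg B) (Cfg B) ℂ}
    (h : ∀ m, 0 ≤ α m • r m) :
    IsJumped (fun z => weight z (pinned s α r))
      ((jumpCode (k := k) q σ).sem θ (pinned s α r)) := by
  classical
  simp only [jumpCode, Prog.sem]
  have hunit : ∀ v : DVar Q, Function.Injective (fun _ : Unit => v) :=
    fun v => Function.injective_of_subsingleton _
  have hX : IsJumped (fun z => weight z (pinned s α r))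
      (conjBy (lift (B := DBasis B) (fun _ : Unit => DVar.q1) opX) (pinned s α r)) := by
    let _ : Fintype (Reg (DBasis B) (fun _ : Unit => (DVar.q1 : DVar Q))) :=
      inferInstanceAs (Fintype (Unit → Fin 2))
    let _ : DecidableEq (Reg (DBasis B) (fun _ : Unit => (DVar.q1 : DVar Q))) :=
      inferInstanceAs (DecidableEq (Unit → Fin 2))
    exact ⟨(isCounterState_pinned s h).conjBy_lift (hunit _) (by simp) _,
      conjBy_opX_flagged fun f g hne => ⟨(pinned_idlePair hne).2.2.1, (pinned_idlePair hne).2.2.2.1⟩,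
      fun z => weight_gate (hunit _) (by simp) opX_unitary _ z⟩
  have hR : ∀ X, IsJumped (fun z => weight z (pinned s α r)) X →
      IsJumped (fun z => weight z (pinned s α r))
        (resetTo (B := DBasis B) (fun _ : Unit => DVar.q2) halfId X) := by
    intro X hX
    let _ : Fintype (Reg (DBasis B) (fun _ : Unit => (DVar.q2 : DVar Q))) :=
      inferInstanceAs (Fintype (Unit → Fin 2))
    let _ : DecidableEq (Reg (DBasis B) (fun _ : Unit => (DVar.q2 : DVar Q))) :=
      inferInstanceAs (DecidableEq (Unit → Fin 2))
    exact hX.resetTo (hunit _) (by simp) (by simp) halfId_posSemidef halfId_trace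
  have hC : ∀ X, IsJumped (fun z => weight z (pinned s α r)) X →
      IsJumped (fun z => weight z (pinned s α r))
        (resetTo (B := DBasis B) (fun i => DVar.copy (q i)) σ X) := by
    intro X hX
    let _ : Fintype (Reg (DBasis B) (fun i => DVar.copy (q i))) :=
      inferInstanceAs (Fintype (Reg B q))
    let _ : DecidableEq (Reg (DBasis B) (fun i => DVar.copy (q i))) :=
      inferInstanceAs (DecidableEq (Reg B q))
    exact hX.resetTo (fun i i' h => hq (DVar.copy.inj h)) (by simp) (by simp) hσ htr
  have : Finite (Reg (DBasis B) (regSwap q)) := Finite.of_equiv _ (swapEquiv q).symm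
  have := Fintype.ofFinite (Reg (DBasis B) (regSwap q))
  exact (hC _ (hR _ hX)).gate (regSwap_injective hq) (by rintro (- | i | i) <;> simp)
    (by rintro (- | i | i) <;> simp) (opAS_unitary q)

end Pinned

end Flags

/-! ### The potential and the simulation of the original program -/

section Simulation

variable {Q : Type} {B : Q → Type} [∀ q, Zero (B q)] [Fintype Q] [DecidableEq Q]
  [∀ q, Fintype (B q)] [∀ q, DecidableEq (B q)] {k : ℕ}

/-- A mixture of states `run m` of the original program, indexed by the value `m ≥ 1` of the
counter, and a state of the program after the differentiation. -/
structure DiffState (B : Q → Type) [∀ q, Zero (B q)] [∀ q, Fintype (B q)] where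
  /-- The states before the differentiation. -/
  run : ℕ → Matrix (Cfg B) (Cfg B) ℂ
  /-- The state after the differentiation. -/
  jumped : Matrix (Cfg (DBasis B)) (Cfg (DBasis B)) ℂ
  run_zero : run 0 = 0
  run_nonneg : ∀ m, 0 ≤ run m
  state : IsCounterState jumped
  flagged : IsFlagged jumped

namespace DiffState

/-- The state of the differential program. -/
def toState (μ : ℕ → ℝ) (s : DiffState B) : Matrix (Cfg (DBasis B)) (Cfg (DBasis B)) ℂ :=
  runState μ s.run + s.jumped

/-- The probability that the differentiation has happened with the counter at `z`, or can still
happen with the counter at `z`. -/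
def potential (μ : ℕ → ℝ) (z : ℤ) (s : DiffState B) : ℝ :=
  weight z s.jumped +
    (if 1 ≤ z then μ z.toNat else 0) * ∑ i ∈ Finset.range (z.toNat + 1), rtr (s.run i)

theorem weight_nonneg (s : DiffState B) (m : ℤ) : 0 ≤ weight m s.jumped :=
  rtr_nonneg (s.state.nonneg m)

theorem weight_le_potential {μ : ℕ → ℝ} (hμ : IsRateDistribution μ) (z : ℤ)
    (s : DiffState B) : weight z s.jumped ≤ s.potential μ z := by
  refine le_add_of_nonneg_right (mul_nonneg ?_
    (Finset.sum_nonneg fun i _ => rtr_nonneg (s.run_nonneg i)))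
  split_ifs with h
  · exact (hμ.pos _ (by omega)).le
  · exact le_rfl

theorem potential_nonneg {μ : ℕ → ℝ} (hμ : IsRateDistribution μ) (z : ℤ)
    (s : DiffState B) : 0 ≤ s.potential μ z :=
  (s.weight_nonneg z).trans (s.weight_le_potential hμ z)

/-- Makes the potential control every part of the state, so that a series of states converges as
soon as its potentials do. -/
theorem rtr_run_le_potential {μ : ℕ → ℝ} (hμ : IsRateDistribution μ) {m : ℕ} (hm : 1 ≤ m)
    (s : DiffState B) : rtr (s.run m) ≤ (μ m)⁻¹ * s.potential μ m := by
  rw [← div_eq_inv_mul, le_div_iff₀' (hμ.pos m hm)]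
  refine le_trans ?_ (le_add_of_nonneg_left (s.weight_nonneg m))
  rw [if_pos (by omega), Int.toNat_natCast]
  exact mul_le_mul_of_nonneg_left (Finset.single_le_sum (f := fun i => rtr (s.run i))
    (fun i _ => rtr_nonneg (s.run_nonneg i)) (by simp)) (hμ.pos m hm).le

/-- A sum of states. -/
def sum {κ : Type*} [Fintype κ] (s : κ → DiffState B) : DiffState B where
  run m := ∑ a, (s a).run m
  jumped := ∑ a, (s a).jumped
  run_zero := Finset.sum_eq_zero fun a _ => (s a).run_zero
  run_nonneg m := Finset.sum_nonneg fun a _ => (s a).run_nonneg m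
  state := IsCounterState.sum fun a => (s a).state
  flagged := IsFlagged.sum fun a => (s a).flagged

theorem toState_sum (μ : ℕ → ℝ) {κ : Type*} [Fintype κ] (s : κ → DiffState B) :
    (sum s).toState μ = ∑ a, (s a).toState μ := by
  simp only [toState, sum, runState]
  rw [form_sum, ← Finset.sum_add_distrib]

theorem potential_sum (μ : ℕ → ℝ) (m : ℤ) {κ : Type*} [Fintype κ] (s : κ → DiffState B) :
    (sum s).potential μ m = ∑ a, (s a).potential μ m := by
  simp only [potential, sum, weight_sum, rtr_sum]
  rw [Finset.sum_add_distrib, ← Finset.mul_sum, Finset.sum_comm]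

section Apply

variable {ι : Type} {q : ι → Q}

theorem orig_injective (hq : Function.Injective q) :
    Function.Injective (fun i => DVar.orig (q i)) := fun _ _ h => hq (DVar.orig.inj h)

instance [Finite (Reg B q)] : Finite (Reg (DBasis B) (fun i => DVar.orig (q i))) :=
  inferInstanceAs (Finite (Reg B q))

/-- The application of an operator on a register of the original program. -/
def apply (s : DiffState B) (hq : Function.Injective q) [Finite (Reg B q)]
    (A : Matrix (Reg B q) (Reg B q) ℂ) : DiffState B where
  run m := conjBy (lift q A) (s.run m)
  jumped := conjBy (lift (B := DBasis B) (fun i => DVar.orig (q i)) A) s.jumped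
  run_zero := by rw [s.run_zero, conjBy_eq, Matrix.mul_zero, Matrix.zero_mul]
  run_nonneg m := by rw [conjBy_eq]; exact conj_nonneg _ (s.run_nonneg m)
  state := s.state.conjBy_lift (orig_injective hq) (by simp) A
  flagged := s.flagged.conjBy_lift (orig_injective hq) (by simp) A

theorem toState_apply (μ : ℕ → ℝ) (s : DiffState B) (hq : Function.Injective q)
    [Finite (Reg B q)] (A : Matrix (Reg B q) (Reg B q) ℂ) :
    (s.apply hq A).toState μ =
      conjBy (lift (B := DBasis B) (fun i => DVar.orig (q i)) A) (s.toState μ) := by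
  have := Fintype.ofFinite (Reg B q)
  refine Eq.trans ?_ (conjBy_lift_add (B := DBasis B) (orig_injective hq) A
    (runState μ s.run) s.jumped).symm
  exact congrArg (· + _) (conjBy_lift_form hq A _ s.run).symm

/-- A complete measurement of original variables conserves the flagged weight at each counter value
and the trace of each `run i`, so the potential splits exactly over the outcomes. -/
theorem sum_potential_apply (μ : ℕ → ℝ) (m : ℤ) (s : DiffState B) (hq : Function.Injective q)
    [Fintype (Reg B q)] [DecidableEq (Reg B q)] {κ : Type*} [Fintype κ]
    {A : κ → Matrix (Reg B q) (Reg B q) ℂ} (hA : ∑ a, (A a).conjTranspose * A a = 1) :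
    ∑ a, (s.apply hq (A a)).potential μ m = s.potential μ m := by
  let _ : Fintype (Reg (DBasis B) (fun i => DVar.orig (q i))) := ‹Fintype (Reg B q)›
  let _ : DecidableEq (Reg (DBasis B) (fun i => DVar.orig (q i))) := ‹DecidableEq (Reg B q)›
  simp only [potential, apply]
  rw [Finset.sum_add_distrib, ← Finset.mul_sum, Finset.sum_comm]
  congr 1
  · exact sum_weight_kraus (orig_injective hq) (by simp) hA s.jumped m
  · congr 1
    exact Finset.sum_congr rfl fun i _ => sum_rtr_conjBy (lift_complete hq hA) _

end Apply

end DiffState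

/-- The differential operation `F` acts on states of the differential program such that the
potential does not increase, and the operations `G n` are lower bounds for its action before the
differentiation, where the counter is increased by at most `b n`. -/
def Simulates (μ : ℕ → ℝ)
    (F : Matrix (Cfg (DBasis B)) (Cfg (DBasis B)) ℂ → Matrix (Cfg (DBasis B)) (Cfg (DBasis B)) ℂ)
    (G : ℕ → Matrix (Cfg B) (Cfg B) ℂ → Matrix (Cfg B) (Cfg B) ℂ) (b : ℕ → ℕ) : Prop :=
  ∀ s : DiffState B, ∃ s' : DiffState B, F (s.toState μ) = s'.toState μ ∧
    (∀ z, s'.potential μ z ≤ s.potential μ z) ∧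
    ∀ n m, G n (∑ i ∈ Finset.range m, s.run i) ≤ ∑ i ∈ Finset.range (m + b n), s'.run i

theorem DiffState.sum_run_mono (s : DiffState B) {m m' : ℕ} (h : m ≤ m') :
    ∑ i ∈ Finset.range m, s.run i ≤ ∑ i ∈ Finset.range m', s.run i :=
  Finset.sum_le_sum_of_subset_of_nonneg (Finset.range_mono h) fun i _ _ => s.run_nonneg i

theorem DiffState.sum_run_nonneg (s : DiffState B) (m : ℕ) :
    0 ≤ ∑ i ∈ Finset.range m, s.run i := Finset.sum_nonneg fun i _ => s.run_nonneg i

variable {μ : ℕ → ℝ}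

theorem simulates_id : Simulates (B := B) μ (fun X => X) (fun _ ρ => ρ) (fun _ => 0) :=
  fun s => ⟨s, rfl, fun _ => le_rfl, fun _ _ => le_rfl⟩

theorem Simulates.comp
    {F F' : Matrix (Cfg (DBasis B)) (Cfg (DBasis B)) ℂ → Matrix (Cfg (DBasis B)) (Cfg (DBasis B)) ℂ}
    {G G' : ℕ → Matrix (Cfg B) (Cfg B) ℂ → Matrix (Cfg B) (Cfg B) ℂ} {b b' : ℕ → ℕ}
    (h : Simulates μ F G b) (h' : Simulates μ F' G' b') (hG : ∀ n, IsOp (G n))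
    (hG' : ∀ n, IsOp (G' n)) :
    Simulates μ (fun X => F' (F X)) (fun n ρ => G' n (G n ρ)) (fun n => b n + b' n) := by
  intro s
  obtain ⟨s₁, e₁, p₁, l₁⟩ := h s
  obtain ⟨s₂, e₂, p₂, l₂⟩ := h' s₁
  refine ⟨s₂, (congrArg F' e₁).trans e₂, fun z => (p₂ z).trans (p₁ z), fun n m => ?_⟩
  refine ((hG' n).mono ((hG n).nonneg (s.sum_run_nonneg m)) (l₁ n m)).trans ?_
  rw [← add_assoc]
  exact l₂ n _

theorem Simulates.mono
    {F : Matrix (Cfg (DBasis B)) (Cfg (DBasis B)) ℂ → Matrix (Cfg (DBasis B)) (Cfg (DBasis B)) ℂ}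
    {G : ℕ → Matrix (Cfg B) (Cfg B) ℂ → Matrix (Cfg B) (Cfg B) ℂ} {b b' : ℕ → ℕ}
    (h : Simulates μ F G b) (hb : ∀ n, b n ≤ b' n) : Simulates μ F G b' := by
  intro s
  obtain ⟨s', e, p, l⟩ := h s
  exact ⟨s', e, p, fun n m => (l n m).trans (s'.sum_run_mono (by have := hb n; omega))⟩

theorem simulates_branch {ι : Type} {q : ι → Q} (hq : Function.Injective q)
    [Fintype (Reg B q)] [DecidableEq (Reg B q)] {κ : Type*} [Fintype κ]
    {A : κ → Matrix (Reg B q) (Reg B q) ℂ} (hA : ∑ a, (A a).conjTranspose * A a = 1)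
    {F : κ → Matrix (Cfg (DBasis B)) (Cfg (DBasis B)) ℂ →
      Matrix (Cfg (DBasis B)) (Cfg (DBasis B)) ℂ}
    {G : κ → ℕ → Matrix (Cfg B) (Cfg B) ℂ → Matrix (Cfg B) (Cfg B) ℂ} {b : ℕ → ℕ}
    (h : ∀ a, Simulates μ (F a) (G a) b) :
    Simulates μ
      (fun X => ∑ a, F a (conjBy (lift (B := DBasis B) (fun i => DVar.orig (q i)) (A a)) X))
      (fun n ρ => ∑ a, G a n (conjBy (lift q (A a)) ρ)) b := by
  intro s
  choose s' e p l using fun a => h a (s.apply hq (A a))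
  refine ⟨DiffState.sum s', ?_, fun m => ?_, fun n m => ?_⟩
  · rw [DiffState.toState_sum]
    exact Finset.sum_congr rfl fun a _ => by rw [← e a, DiffState.toState_apply]
  · rw [DiffState.potential_sum, ← s.sum_potential_apply μ m hq hA]
    exact Finset.sum_le_sum fun a _ => p a m
  · simp only [DiffState.sum]
    rw [Finset.sum_comm]
    refine Finset.sum_le_sum fun a _ => ?_
    rw [(isOp_conjBy (lift_complete hq hA) a).sum _ s.run_nonneg]
    exact l a n m

theorem simulates_gate {ι : Type} {q : ι → Q} (hq : Function.Injective q)
    [Fintype (Reg B q)] [DecidableEq (Reg B q)]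
    {U : Matrix (Reg B q) (Reg B q) ℂ} (hU : U.conjTranspose * U = 1) :
    Simulates μ (conjBy (lift (B := DBasis B) (fun i => DVar.orig (q i)) U))
      (fun _ => conjBy (lift q U)) (fun _ => 0) := by
  have := simulates_branch (κ := Unit) (A := fun _ => U) hq (by simpa using hU)
    fun _ => simulates_id (B := B) (μ := μ)
  simpa using this

theorem simulates_init (θ : Fin k → ℝ) (v : Q) :
    Simulates μ ((Prog.init (DVar.orig v) : Prog (DBasis B) k).sem θ)
      (fun _ => (Prog.init v : Prog B k).sem θ) (fun _ => 0) := by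
  have h := simulates_branch (q := fun _ : Unit => v) (Function.injective_of_subsingleton _)
    (ketZeroBra_complete (B := B) (v := v)) fun _ => simulates_id (B := B) (μ := μ)
  convert h using 1
  · funext X
    let _ : Fintype (DBasis B (DVar.orig v)) := inferInstanceAs (Fintype (B v))
    exact sem_init_eq (B := DBasis B) (DVar.orig v) θ X
  · funext _ ρ
    exact sem_init_eq v θ ρ

theorem simulates_resetTo {ι : Type} [Fintype ι] [DecidableEq ι] {q : ι → Q}
    (hq : Function.Injective q) {σ : Matrix (Reg B q) (Reg B q) ℂ} (hσ : σ.PosSemidef)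
    (htr : σ.trace = 1) :
    Simulates μ (resetTo (B := DBasis B) (fun i => DVar.orig (q i)) σ)
      (fun _ => resetTo q σ) (fun _ => 0) := by
  obtain ⟨S, rfl⟩ := exists_eq_mul_conjTranspose (Matrix.nonneg_iff_posSemidef.2 hσ)
  have h := simulates_branch hq (resetKraus_complete S htr) fun _ => simulates_id (B := B) (μ := μ)
  convert h using 1
  · funext X
    let _ : Fintype (Reg (DBasis B) (fun i => DVar.orig (q i))) :=
      inferInstanceAs (Fintype (Reg B q))
    exact resetTo_eq_sum (B := DBasis B) (DiffState.orig_injective hq) S X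
  · funext _ ρ
    exact resetTo_eq_sum hq S ρ

/-- The jump adds `μ m * tr (run m)` to the flagged weight at `m`, while the counter step pushes
`run m` out of the sum over `i ≤ m`: the two changes cancel. -/
theorem simulates_eulCode (hμ : IsRateDistribution μ) (θ : Fin k → ℝ)
    {ι : Type} [Fintype ι] [DecidableEq ι] {q : ι → Q} [Finite (Reg B q)]
    (hq : Function.Injective q) {σ : Matrix (Reg B q) (Reg B q) ℂ} (hσ : σ.PosSemidef)
    (htr : σ.trace = 1) :
    Simulates μ ((eulCode (k := k) B μ q σ).sem θ) (fun _ ρ => ρ) (fun _ => 1) := by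
  intro s
  have hα : ∀ m, 0 ≤ μ m • s.run m := fun m => by
    rcases Nat.eq_zero_or_pos m with rfl | h
    · rw [s.run_zero, smul_zero]
    · exact smul_nonneg_matrix (hμ.pos m h).le (s.run_nonneg m)
  have hJ := isJumped_jumpCode θ hq hσ htr 1 hα
  refine ⟨⟨shift s.run, (jumpCode (k := k) q σ).sem θ (pinned 1 μ s.run) + s.jumped, rfl, ?_,
    hJ.state.add s.state, hJ.flagged.add s.flagged⟩, ?_, fun z => ?_, fun n m => ?_⟩
  · rintro (- | m)
    · exact le_rfl
    · exact s.run_nonneg m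
  · exact sem_eulCode θ hμ s.run_zero s.flagged
  · simp only [DiffState.potential]
    rw [weight_add, hJ.weight_eq]
    rcases lt_or_ge z 0 with hz | hz
    · rw [weight, block_pinned_of_neg 1 μ s.run hz, rtr_zero, if_neg (by omega)]
      linarith
    · obtain ⟨m, rfl⟩ := Int.eq_ofNat_of_zero_le hz
      -- After the shift the sum over `i ≤ m` is the old sum over `i < m`; the missing last term is
      -- the weight just added. At `m = 0` both vanish since `run 0 = 0`.
      rw [weight_pinned, Int.toNat_natCast, Finset.sum_range_succ' _ m, Finset.sum_range_succ _ m]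
      simp only [shift, rtr_zero]
      split_ifs with hm
      · linarith
      · obtain rfl : m = 0 := by omega
        rw [s.run_zero, rtr_zero]
        linarith
  · change _ ≤ ∑ i ∈ Finset.range (m + 1), shift s.run i
    rw [Finset.sum_range_succ']
    simp [shift]

section Loop

/-- A state given by a convergent series of states. -/
def DiffState.tsum (hμ : IsRateDistribution μ) (s : ℕ → DiffState B)
    (hs : ∀ z, Summable fun n => (s n).potential μ z) : DiffState B where
  run m f g := ∑' n, (s n).run m f g
  jumped f g := ∑' n, (s n).jumped f g
  run_zero := by
    ext f g
    simp [(s _).run_zero]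
  run_nonneg m := by
    -- The potential controls `run m` only for `m ≥ 1`; index 0 is empty in every state.
    rcases Nat.eq_zero_or_pos m with rfl | hm
    · refine le_of_eq ?_
      ext f g
      simp [(s _).run_zero]
    · have hsum := Summable.of_nonneg_of_le (fun n => rtr_nonneg ((s n).run_nonneg m))
        (fun n => (s n).rtr_run_le_potential hμ hm) ((hs m).mul_left _)
      exact nonneg_of_hasSum (fun n => (s n).run_nonneg m)
        (hasSum_matrix (fun n => (s n).run_nonneg m) hsum)
  state :=
    { diag := fun f g h => by
        by_contra hcon
        refine h ?_
        have : ∀ n, (s n).jumped f g = 0 := fun n => by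
          by_contra hn
          exact hcon ((s n).state.diag f g hn)
        simp [this]
      nonneg := fun z => by
        have hsum := Summable.of_nonneg_of_le (fun n => (s n).weight_nonneg z)
          (fun n => (s n).weight_le_potential hμ z) (hs z)
        exact nonneg_of_hasSum (fun n => (s n).state.nonneg z)
          (hasSum_matrix (fun n => (s n).state.nonneg z) hsum) }
  flagged f g h := by
    by_contra hcon
    refine h ?_
    have : ∀ n, (s n).jumped f g = 0 := fun n => by
      by_contra hn
      exact hcon ((s n).flagged f g hn)
    simp [this]

theorem DiffState.hasSum_run (hμ : IsRateDistribution μ) (s : ℕ → DiffState B)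
    (hs : ∀ z, Summable fun n => (s n).potential μ z) (m : ℕ) :
    HasSum (fun n => (s n).run m) ((DiffState.tsum hμ s hs).run m) := by
  rcases Nat.eq_zero_or_pos m with rfl | hm
  · simp only [DiffState.run_zero]
    exact hasSum_zero
  · exact hasSum_matrix (fun n => (s n).run_nonneg m)
      (Summable.of_nonneg_of_le (fun n => rtr_nonneg ((s n).run_nonneg m))
        (fun n => (s n).rtr_run_le_potential hμ hm) ((hs m).mul_left _))

theorem DiffState.hasSum_block (hμ : IsRateDistribution μ) (s : ℕ → DiffState B)
    (hs : ∀ z, Summable fun n => (s n).potential μ z) (z : ℤ) :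
    HasSum (fun n => block z (s n).jumped) (block z (DiffState.tsum hμ s hs).jumped) :=
  hasSum_matrix (fun n => (s n).state.nonneg z)
    (Summable.of_nonneg_of_le (fun n => (s n).weight_nonneg z)
      (fun n => (s n).weight_le_potential hμ z) (hs z))

theorem DiffState.hasSum_potential (hμ : IsRateDistribution μ) (s : ℕ → DiffState B)
    (hs : ∀ z, Summable fun n => (s n).potential μ z) (z : ℤ) :
    HasSum (fun n => (s n).potential μ z) ((DiffState.tsum hμ s hs).potential μ z) :=
  (hasSum_rtr (DiffState.hasSum_block hμ s hs z)).add
    ((hasSum_sum fun m _ => hasSum_rtr (DiffState.hasSum_run hμ s hs m)).mul_left _)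

theorem DiffState.toState_tsum (hμ : IsRateDistribution μ) (s : ℕ → DiffState B)
    (hs : ∀ z, Summable fun n => (s n).potential μ z) :
    (DiffState.tsum hμ s hs).toState μ = fun f g => ∑' n, (s n).toState μ f g := by
  ext f g
  have hj : Summable fun n => (s n).jumped f g := by
    by_cases h : f .qc = g .qc
    · exact (Pi.hasSum.1 (Pi.hasSum.1 (DiffState.hasSum_block hμ s hs (g .qc)) ⟨f, h⟩)
        ⟨g, rfl⟩).summable
    · have : ∀ n, (s n).jumped f g = 0 := fun n => by
        by_contra hn
        exact h ((s n).state.diag f g hn)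
      simp only [this]
      exact summable_zero
  simp only [DiffState.toState, Matrix.add_apply, runState]
  by_cases h : IdlePair f g
  · obtain ⟨m, hm⟩ := Int.eq_ofNat_of_zero_le h.2.1
    simp only [form_of_idlePair _ _ h hm]
    have hr := (Pi.hasSum.1 (Pi.hasSum.1 (DiffState.hasSum_run hμ s hs m)
      (fun p => f (.orig p))) (fun p => g (.orig p))).summable
    rw [Summable.tsum_add (hr.mul_left _) hj, tsum_mul_left]
    rfl
  · simp only [form_of_not_idlePair _ _ h, zero_add]
    rfl

/-- Each round splits the potential into an exiting and a continuing part, so the exiting potentials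
sum to at most the initial one and the series of exit states converges. An exit after `i ≤ n` rounds
has raised the counter by at most `i * b n ≤ n * b n` in the part dominating the truncation. -/
theorem simulates_loop (hμ : IsRateDistribution μ) {ι : Type} [Fintype ι] [DecidableEq ι]
    {q : ι → Q} (hq : Function.Injective q)
    {M : Fin 2 → Matrix (Reg B q) (Reg B q) ℂ} (hM : ∑ a, (M a).conjTranspose * M a = 1)
    {F : Matrix (Cfg (DBasis B)) (Cfg (DBasis B)) ℂ → Matrix (Cfg (DBasis B)) (Cfg (DBasis B)) ℂ}
    {G : ℕ → Matrix (Cfg B) (Cfg B) ℂ → Matrix (Cfg B) (Cfg B) ℂ} {b : ℕ → ℕ}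
    (h : Simulates μ F G b) (hG : ∀ n, IsOp (G n)) :
    Simulates μ
      (fun X f g => ∑' n : ℕ, conjBy (lift (B := DBasis B) (fun i => DVar.orig (q i)) (M 0))
        ((fun Y => F (conjBy (lift (B := DBasis B) (fun i => DVar.orig (q i)) (M 1)) Y))^[n] X) f g)
      (fun n ρ => ∑ i ∈ Finset.range (n + 1), conjBy (lift q (M 0))
        ((fun τ => G n (conjBy (lift q (M 1)) τ))^[i] ρ))
      (fun n => n * b n) := by
  intro s
  choose step e p l using h
  set T : ℕ → DiffState B := fun n => (fun s => step (s.apply hq (M 1)))^[n] s with hT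
  have hTs : ∀ n, T (n + 1) = step ((T n).apply hq (M 1)) := fun n =>
    Function.iterate_succ_apply' _ _ _
  have hstate : ∀ n, (fun Y => F (conjBy (lift (B := DBasis B) (fun i => DVar.orig (q i)) (M 1))
      Y))^[n] (s.toState μ) = (T n).toState μ := by
    intro n
    induction n with
    | zero => rfl
    | succ n ih => rw [Function.iterate_succ_apply', ih, hTs, ← e, DiffState.toState_apply]
  -- Telescoped balance: potential already exited plus potential still in the loop.
  have hpot : ∀ z n, ∑ i ∈ Finset.range n, ((T i).apply hq (M 0)).potential μ z +
      (T n).potential μ z ≤ s.potential μ z := by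
    intro z n
    induction n with
    | zero => simp [hT]
    | succ n ih =>
      have h1 := p ((T n).apply hq (M 1)) z
      have h2 := (T n).sum_potential_apply μ z hq hM
      rw [Fin.sum_univ_two] at h2
      rw [Finset.sum_range_succ, hTs]
      linarith
  have hbound : ∀ z n, ∑ i ∈ Finset.range n, ((T i).apply hq (M 0)).potential μ z ≤
      s.potential μ z := fun z n => by linarith [hpot z n, (T n).potential_nonneg hμ z]
  have hs : ∀ z, Summable fun n => ((T n).apply hq (M 0)).potential μ z := fun z =>
    summable_of_sum_range_le (fun n => ((T n).apply hq (M 0)).potential_nonneg hμ z) (hbound z)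
  refine ⟨DiffState.tsum hμ _ hs, ?_, fun z => ?_, fun n m => ?_⟩
  · rw [DiffState.toState_tsum]
    funext f g
    refine tsum_congr fun n => ?_
    rw [hstate, DiffState.toState_apply]
  · rw [← (DiffState.hasSum_potential hμ _ hs z).tsum_eq]
    exact (hs z).tsum_le_of_sum_range_le (hbound z)
  · have hE₀ := isOp_conjBy (lift_complete hq hM) 0
    have hE₁ := isOp_conjBy (lift_complete hq hM) 1
    have hiter : ∀ i, (fun τ => G n (conjBy (lift q (M 1)) τ))^[i]
        (∑ x ∈ Finset.range m, s.run x) ≤ ∑ x ∈ Finset.range (m + i * b n), (T i).run x := by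
      intro i
      induction i with
      | zero => simp [hT]
      | succ i ih =>
        rw [Function.iterate_succ_apply', hTs]
        have h0 := ((((hG n).comp hE₁).iterate i).nonneg (s.sum_run_nonneg m))
        refine (((hG n).comp hE₁).mono h0 ih).trans ?_
        rw [hE₁.sum _ (T i).run_nonneg]
        refine (l ((T i).apply hq (M 1)) n _).trans_eq ?_
        congr 2
        ring
    calc _ ≤ ∑ i ∈ Finset.range (n + 1), ∑ x ∈ Finset.range (m + n * b n),
          ((T i).apply hq (M 0)).run x := by
          refine Finset.sum_le_sum fun i hi => ?_
          have h0 := ((((hG n).comp hE₁).iterate i).nonneg (s.sum_run_nonneg m))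
          refine (hE₀.mono h0 (hiter i)).trans ?_
          rw [hE₀.sum _ (T i).run_nonneg]
          refine ((T i).apply hq (M 0)).sum_run_mono ?_
          have : i ≤ n := by simpa [Nat.lt_succ_iff] using hi
          gcongr
      _ = ∑ x ∈ Finset.range (m + n * b n), ∑ i ∈ Finset.range (n + 1),
          ((T i).apply hq (M 0)).run x := Finset.sum_comm
      _ ≤ _ := Finset.sum_le_sum fun x _ => sum_le_of_hasSum
          (fun i => ((T i).apply hq (M 0)).run_nonneg x) (DiffState.hasSum_run hμ _ hs x) (n + 1)

end Loop

theorem simulates_transform (hμ : IsRateDistribution μ) (θ : Fin k → ℝ) (j : Fin k)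
    {P : Prog B k} (hP : P.WellFormed) :
    Simulates μ ((transform μ j P).sem θ) (fun n => P.boundedSem θ n)
      (fun n => P.boundedCount j n) := by
  induction P with
  | skip => exact simulates_id
  | init v => exact simulates_init θ v
  | initTo q σ => exact simulates_resetTo hP.1 hP.2.1 hP.2.2
  | gate q U => exact simulates_gate hP.1 (Matrix.mem_unitaryGroup_iff'.1 hP.2)
  | pgate q j' σ =>
    have hU := simulates_gate (μ := μ) hP.1 (expGate_unitary (θ j') hP.2.1.isHermitian)
    by_cases h : j' = j
    · have h2 := (simulates_eulCode (k := k) hμ θ hP.1 hP.2.1 hP.2.2).comp hU (fun _ => IsOp.id)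
        (fun _ => isOp_gate hP.1 (expGate_unitary (θ j') hP.2.1.isHermitian))
      simp only [transform, Prog.boundedCount, if_pos h]
      exact h2
    · simp only [transform, Prog.boundedCount, if_neg h]
      exact hU
  | seq P₁ P₂ h₁ h₂ =>
    exact (h₁ hP.1).comp (h₂ hP.2) (fun n => isOp_boundedSem θ n hP.1)
      (fun n => isOp_boundedSem θ n hP.2)
  | meas q M P h =>
    exact simulates_branch hP.1 hP.2.1 fun m => (h m (hP.2.2 m)).mono fun n =>
      Finset.le_sup (f := fun m => (P m).boundedCount j n) (Finset.mem_univ m)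
  | loop q M P h =>
    exact simulates_loop hμ hP.1 hP.2.1 (h hP.2.2) (fun n => isOp_boundedSem θ n hP.2.2)

end Simulation

/-! ### Counting -/

namespace Prog

variable {V : Type} {B : V → Type} {k : ℕ}

/-- Each enclosing loop multiplies the count by `n`, and no statement is enclosed by more than
`loopCount` loops. -/
theorem boundedCount_le (j : Fin k) {n : ℕ} (hn : 1 ≤ n) (P : Prog B k) :
    P.boundedCount j n ≤ n ^ P.loopCount * P.runCount j := by
  induction P with
  | skip => simp [boundedCount]
  | init v => simp [boundedCount]
  | initTo q σ => simp [boundedCount]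
  | gate q U => simp [boundedCount]
  | pgate q j' σ => simp [boundedCount, loopCount, runCount]
  | seq P₁ P₂ h₁ h₂ =>
    simp only [boundedCount, loopCount, runCount, mul_add]
    refine add_le_add (h₁.trans (Nat.mul_le_mul_right _ ?_)) (h₂.trans (Nat.mul_le_mul_right _ ?_))
    · exact Nat.pow_le_pow_right hn (Nat.le_add_right _ _)
    · exact Nat.pow_le_pow_right hn (Nat.le_add_left _ _)
  | meas q M P h =>
    simp only [boundedCount, loopCount, runCount]
    refine Finset.sup_le fun m _ => (h m).trans (Nat.mul_le_mul (Nat.pow_le_pow_right hn ?_) ?_)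
    · exact Finset.single_le_sum (f := fun m => (P m).loopCount) (fun _ _ => Nat.zero_le _)
        (Finset.mem_univ m)
    · exact Finset.le_sup (f := fun m => (P m).runCount j) (Finset.mem_univ m)
  | loop q M P h =>
    simp only [boundedCount, loopCount, runCount, pow_succ', mul_assoc]
    exact Nat.mul_le_mul_left _ h

/-- Appending the second sum after the first only raises its exponents: nesting loops is at least as
bad as placing them side by side. -/
theorem geom_add_le {n : ℕ} (hn : 1 ≤ n) (a b : ℕ) :
    ∑ d ∈ Finset.range a, n ^ d + ∑ d ∈ Finset.range b, n ^ d ≤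
      ∑ d ∈ Finset.range (a + b), n ^ d := by
  rw [Finset.sum_range_add]
  gcongr with d hd
  omega

/-- The worst case is full nesting, where the loop at depth `d` is entered `n ^ d` times. -/
theorem loopEntries_le_geom {n : ℕ} (hn : 1 ≤ n) (P : Prog B k) :
    P.loopEntries n ≤ ∑ d ∈ Finset.range P.loopCount, n ^ d := by
  induction P with
  | skip => simp [loopEntries]
  | init v => simp [loopEntries]
  | initTo q σ => simp [loopEntries]
  | gate q U => simp [loopEntries]
  | pgate q j' σ => simp [loopEntries]
  | seq P₁ P₂ h₁ h₂ => exact (add_le_add h₁ h₂).trans (geom_add_le hn _ _)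
  | meas q M P h =>
    simp only [loopEntries, loopCount]
    refine (Finset.sum_le_sum fun m _ => h m).trans ?_
    have key : ∀ s : Finset (Fin _), ∑ m ∈ s, ∑ d ∈ Finset.range (P m).loopCount, n ^ d ≤
        ∑ d ∈ Finset.range (∑ m ∈ s, (P m).loopCount), n ^ d := by
      intro s
      induction s using Finset.induction_on with
      | empty => simp
      | insert a s ha ih =>
        rw [Finset.sum_insert ha, Finset.sum_insert ha]
        exact (Nat.add_le_add_left ih _).trans (geom_add_le hn _ _)
    exact key _
  | loop q M P h =>
    simp only [loopEntries, loopCount]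
    rw [Finset.sum_range_succ']
    simp only [pow_succ', pow_zero, ← Finset.mul_sum]
    have := Nat.mul_le_mul_left n h
    omega

/-- The subtraction-free form of `∑ n ^ d ≤ b + 1 + n * ((n + 1) ^ b - 1)`, suited to induction in
`ℕ`. -/
theorem geom_le {n : ℕ} (hn : 1 ≤ n) (b : ℕ) :
    ∑ d ∈ Finset.range (b + 1), n ^ d + n ≤ b + 1 + n * (n + 1) ^ b := by
  induction b with
  | zero => simp
  | succ b ih =>
    rw [Finset.sum_range_succ]
    have h1 : n ^ b ≤ (n + 1) ^ b := Nat.pow_le_pow_left (Nat.le_succ n) b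
    have h2 : n ^ (b + 1) ≤ n * n * (n + 1) ^ b := by
      rw [pow_succ', mul_assoc]
      exact Nat.mul_le_mul_left n (h1.trans (Nat.le_mul_of_pos_left _ hn))
    have h3 : n * (n + 1) ^ (b + 1) = n * n * (n + 1) ^ b + n * (n + 1) ^ b := by ring
    omega

theorem loopEntries_le {n : ℕ} (hn : 1 ≤ n) (P : Prog B k) :
    (P.loopEntries n : ℝ) ≤ (P.loopCount : ℝ) +
      (((n + 1 : ℕ) : ℝ) - 1) * max 0 (((n + 1 : ℕ) : ℝ) ^ ((P.loopCount : ℤ) - 1) - 1) := by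
  have h := loopEntries_le_geom hn P
  -- Without loops the exponent is the integer `-1`, the maximum is clamped at 0, and there are no
  -- entries.
  rcases hb : P.loopCount with - | b
  · rw [hb] at h
    have h0 : P.loopEntries n = 0 := by simpa using h
    rw [h0]
    push_cast
    have : (0 : ℝ) ≤ n := Nat.cast_nonneg n
    simp only [add_sub_cancel_right, zero_add]
    positivity
  · rw [hb] at h
    have h1 := geom_le hn b
    have h2 : (P.loopEntries n : ℝ) + n ≤ b + 1 + n * (n + 1) ^ b := by
      exact_mod_cast (Nat.add_le_add_right h n).trans h1
    have h3 : ((b + 1 : ℕ) : ℤ) - 1 = (b : ℤ) := by push_cast; ring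
    rw [h3, zpow_natCast]
    push_cast
    have h4 := mul_le_mul_of_nonneg_left (le_max_right 0 (((n : ℝ) + 1) ^ b - 1))
      (Nat.cast_nonneg (α := ℝ) n)
    rw [add_sub_cancel_right]
    linarith

end Prog

/-! ### The series -/

section Series

variable {μ : ℕ → ℝ}

theorem recipSum_eq (μ : ℕ → ℝ) (n : ℕ) :
    recipSum μ n = ∑ m ∈ Finset.range n, 1 / μ (m + 1) := by
  rw [recipSum, Finset.range_eq_Ico, Finset.sum_Ico_add' (fun m => 1 / μ m) 0 n 1]
  rfl

theorem IsRateDistribution.recipSum_mono (hμ : IsRateDistribution μ) {m n : ℕ} (h : m ≤ n) :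
    recipSum μ m ≤ recipSum μ n := by
  rw [recipSum_eq, recipSum_eq]
  exact Finset.sum_le_sum_of_subset_of_nonneg (Finset.range_mono h) fun i _ _ =>
    (one_div_pos.2 (hμ.pos _ (by omega))).le

theorem IsRateDistribution.recipSum_nonneg (hμ : IsRateDistribution μ) (n : ℕ) :
    0 ≤ recipSum μ n :=
  Finset.sum_nonneg fun _ hi => (one_div_pos.2 (hμ.pos _ (Finset.mem_Icc.1 hi).1)).le

theorem tsum_ite_lt (hμ : IsRateDistribution μ) (n : ℕ) :
    ∑' m : ℕ, (if m < n then ENNReal.ofReal (4 / μ (m + 1)) else 0) =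
      ENNReal.ofReal (4 * recipSum μ n) := by
  rw [tsum_eq_sum (s := Finset.range n) fun m hm => if_neg (by simpa using hm), recipSum_eq,
    Finset.mul_sum, ENNReal.ofReal_sum_of_nonneg]
  · refine Finset.sum_congr rfl fun m hm => ?_
    rw [if_pos (Finset.mem_range.1 hm)]
    congr 1
    ring
  · intro m _
    have := hμ.pos (m + 1) (by omega)
    positivity

/-- Telescoping up to a late index leaves an error below any given `δ`; working in `[0, ∞]` avoids
summability questions. -/
theorem ofReal_sub_le_tsum {p : ℕ → ℝ} {R : ℝ} (hmono : Monotone p)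
    (hlim : ∀ δ > 0, ∃ n, ∀ n' ≥ n, R - p n' ≤ δ) (n : ℕ) :
    ENNReal.ofReal (R - p n) ≤ ∑' i, ENNReal.ofReal (p (n + i + 1) - p (n + i)) := by
  refine ENNReal.le_of_forall_pos_le_add fun δ hδ _ => ?_
  obtain ⟨l, hl⟩ := hlim δ hδ
  have h1 := hl (n + l) (Nat.le_add_left l n)
  have h2 := Finset.sum_range_sub (fun i => p (n + i)) l
  calc ENNReal.ofReal (R - p n)
      ≤ ENNReal.ofReal (∑ i ∈ Finset.range l, (p (n + i + 1) - p (n + i)) + δ) := by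
        refine ENNReal.ofReal_le_ofReal ?_
        have h3 : ∑ i ∈ Finset.range l, (p (n + i + 1) - p (n + i)) = p (n + l) - p n := h2
        linarith
    _ ≤ ENNReal.ofReal (∑ i ∈ Finset.range l, (p (n + i + 1) - p (n + i))) +
          ENNReal.ofReal δ := ENNReal.ofReal_add_le
    _ ≤ _ := by
        refine add_le_add ?_ (by simp)
        rw [ENNReal.ofReal_sum_of_nonneg fun i _ => sub_nonneg.2 (hmono (Nat.le_succ _))]
        exact ENNReal.sum_le_tsum _

/-- If the tail weights `t m` are bounded in terms of a sequence `p n → R` at the rate at which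
`n ^ b * c` grows, then their weighted sum is bounded by a sum over the increments of `p`. -/
theorem tsum_tail_le (hμ : IsRateDistribution μ) {t p : ℕ → ℝ} {R : ℝ} (b c : ℕ)
    (ht₁ : ∀ m, t m ≤ 1) (hmono : Monotone p)
    (hlim : ∀ δ > 0, ∃ n, ∀ n' ≥ n, R - p n' ≤ δ)
    (htp : ∀ n m, 1 ≤ n → n ^ b * c ≤ m → t m ≤ R - p n) :
    ∑' m : ℕ, ENNReal.ofReal (4 / μ (m + 1)) * ENNReal.ofReal (t m) ≤
      ENNReal.ofReal (4 * recipSum μ c) +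
        ∑' i : ℕ, ENNReal.ofReal (p (i + 2) - p (i + 1)) *
          ENNReal.ofReal (4 * recipSum μ ((i + 2) ^ b * c)) := by
  have key : ∀ m, c ≤ m → ENNReal.ofReal (t m) ≤
      ∑' i : ℕ, if m < (i + 2) ^ b * c then ENNReal.ofReal (p (i + 2) - p (i + 1)) else 0 := by
    intro m hm
    by_cases h : ∃ i, m < (i + 2) ^ b * c
    · classical
      -- By minimality the preceding threshold `(i₀ + 1) ^ b * c` is at most `m`, so `htp` applies
      -- with `n = i₀ + 1`; for `i₀ = 0` that threshold is `c`.
      set i₀ := Nat.find h with hi₀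
      have h1 : (i₀ + 1) ^ b * c ≤ m := by
        rcases Nat.eq_zero_or_pos i₀ with h0 | h0
        · simpa [h0] using hm
        · have h2 := Nat.find_min h (m := i₀ - 1) (by omega)
          rw [show i₀ - 1 + 2 = i₀ + 1 by omega] at h2
          exact not_lt.1 h2
      have h2 : ∀ i, m < (i₀ + i + 2) ^ b * c := fun i =>
        (Nat.find_spec h).trans_le (Nat.mul_le_mul_right _
          (Nat.pow_le_pow_left (by omega) b))
      refine (ENNReal.ofReal_le_ofReal (htp _ m (by omega) h1)).trans
        ((ofReal_sub_le_tsum hmono hlim (i₀ + 1)).trans ?_)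
      refine le_trans (le_of_eq ?_) (ENNReal.tsum_comp_le_tsum_of_injective
        (add_right_injective i₀) _)
      refine tsum_congr fun i => ?_
      rw [if_pos (h2 i)]
      congr 3 <;> omega
    -- If the thresholds never pass `m`, as for `b = 0` or `c = 0`, then `htp` holds for all `n` and
    -- the limit forces `t m ≤ 0`.
    · push Not at h
      have h0 : t m ≤ 0 := by
        refine le_of_forall_pos_le_add fun δ hδ => ?_
        obtain ⟨n, hn⟩ := hlim δ hδ
        rw [zero_add]
        exact (htp (n + 2) m (by omega) (h n)).trans (hn _ (by omega))
      rw [ENNReal.ofReal_of_nonpos h0]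
      exact zero_le
  have hpt : ∀ m, ENNReal.ofReal (4 / μ (m + 1)) * ENNReal.ofReal (t m) ≤
      (if m < c then ENNReal.ofReal (4 / μ (m + 1)) else 0) +
        ∑' i : ℕ, ENNReal.ofReal (p (i + 2) - p (i + 1)) *
          (if m < (i + 2) ^ b * c then ENNReal.ofReal (4 / μ (m + 1)) else 0) := by
    intro m
    by_cases hm : m < c
    · rw [if_pos hm]
      refine le_trans (mul_le_of_le_one_right' ?_) le_self_add
      exact ENNReal.ofReal_le_one.2 (ht₁ m)
    · rw [if_neg hm, zero_add]
      refine (mul_le_mul_right (key m (not_lt.1 hm)) _).trans_eq ?_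
      rw [← ENNReal.tsum_mul_left]
      refine tsum_congr fun i => ?_
      split_ifs
      · exact mul_comm _ _
      · simp
  refine (ENNReal.tsum_le_tsum hpt).trans_eq ?_
  -- Exchange of summation: for fixed `i` the inner sum over `m` is a reciprocal sum up to the
  -- `i`-th threshold.
  rw [ENNReal.tsum_add, ENNReal.tsum_comm, tsum_ite_lt hμ]
  congr 1
  refine tsum_congr fun i => ?_
  rw [ENNReal.tsum_mul_left, tsum_ite_lt hμ]

/-- Both powers on the right have exponents at most `(n + 1) / N`; the second may have exponent
`-1`, hence the integer power. -/
theorem four_mul_pow_le {ε : ℝ} (hε0 : 0 < ε) (hε1 : ε < 1) (N n : ℕ) :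
    4 * ε ^ ((n + 1) / N) ≤ 2 * ε ^ (n / N) + 2 * ε ^ (((n / N : ℕ) : ℤ) - 1) := by
  have h1 : ε ^ ((n + 1) / N) ≤ ε ^ (n / N) :=
    pow_le_pow_of_le_one hε0.le hε1.le (Nat.div_le_div_right (Nat.le_succ n))
  have h2 : ε ^ (n / N) ≤ ε ^ (((n / N : ℕ) : ℤ) - 1) := by
    rw [← zpow_natCast]
    exact zpow_le_zpow_right_of_le_one₀ hε0 hε1.le (by omega)
  linarith

theorem mul_recipSum_le_boundTerm (hμ : IsRateDistribution μ) {ε : ℝ} (hε0 : 0 < ε) (hε1 : ε < 1)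
    {b c N n : ℕ} (hn : 1 ≤ n) {D Δ : ℝ} (hΔ : Δ ≤ D * ε ^ ((n + 1) / N)) (hD0 : b = 0 → D = 0)
    (hD : D ≤ (b : ℝ) + (((n + 1 : ℕ) : ℝ) - 1) * max 0 (((n + 1 : ℕ) : ℝ) ^ ((b : ℤ) - 1) - 1)) :
    Δ * (4 * recipSum μ ((n + 1) ^ b * c)) ≤ boundTerm μ c b ε N (n + 1) := by
  unfold boundTerm
  set C : ℝ := (b : ℝ) + (((n + 1 : ℕ) : ℝ) - 1) * max 0 (((n + 1 : ℕ) : ℝ) ^ ((b : ℤ) - 1) - 1)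
    with hC
  have hC0 : 0 ≤ C := by
    rw [hC]
    push_cast
    rw [add_sub_cancel_right]
    positivity
  have he : (0 : ℝ) < ε ^ ((n + 1) / N) := pow_pos hε0 _
  have hfour := four_mul_pow_le hε0 hε1 N n
  have hbase : 0 ≤ C * recipSum μ ((n + 1 + 1) ^ b * c - 1) *
      (2 * ε ^ (n / N) + 2 * ε ^ (((n / N : ℕ) : ℤ) - 1)) :=
    mul_nonneg (mul_nonneg hC0 (hμ.recipSum_nonneg _)) (le_trans (by positivity) hfour)
  rw [Nat.add_sub_cancel]
  have hS := hμ.recipSum_nonneg ((n + 1) ^ b * c)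
  -- The comparison `k ^ b * c ≤ (k + 1) ^ b * c - 1` with `k = n + 1` needs `b, c ≥ 1`. For `b = 0`
  -- the increment is not positive, for `c = 0` the reciprocal sum is empty.
  rcases Nat.eq_zero_or_pos b with hb | hb
  · rw [hD0 hb, zero_mul] at hΔ
    exact (mul_nonpos_of_nonpos_of_nonneg hΔ (by positivity)).trans hbase
  rcases Nat.eq_zero_or_pos c with hc | hc
  · subst hc
    refine le_trans (le_of_eq ?_) hbase
    simp [recipSum]
  have hle : (n + 1) ^ b * c ≤ (n + 1 + 1) ^ b * c - 1 := by
    have h1 : (n + 1) ^ b < (n + 1 + 1) ^ b := Nat.pow_lt_pow_left (Nat.lt_succ_self _) hb.ne'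
    have h2 : ((n + 1) ^ b + 1) * c ≤ (n + 1 + 1) ^ b * c := Nat.mul_le_mul_right c h1
    have h3 : ((n + 1) ^ b + 1) * c = (n + 1) ^ b * c + c := by ring
    omega
  calc Δ * (4 * recipSum μ ((n + 1) ^ b * c))
      ≤ C * ε ^ ((n + 1) / N) * (4 * recipSum μ ((n + 1) ^ b * c)) :=
        mul_le_mul_of_nonneg_right (hΔ.trans (mul_le_mul_of_nonneg_right hD he.le)) (by positivity)
    _ = C * recipSum μ ((n + 1) ^ b * c) * (4 * ε ^ ((n + 1) / N)) := by ring
    _ ≤ C * recipSum μ ((n + 1 + 1) ^ b * c - 1) * (4 * ε ^ ((n + 1) / N)) :=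
        mul_le_mul_of_nonneg_right (mul_le_mul_of_nonneg_left (hμ.recipSum_mono hle) hC0)
          (by positivity)
    _ ≤ _ := mul_le_mul_of_nonneg_left hfour (mul_nonneg hC0 (hμ.recipSum_nonneg _))

end Series

/-! ### The initial and the final state of the differential program -/

open Classical in
theorem conjBy_ketZeroBra {V : Type} {B : V → Type} (v : V) [Zero (B v)] (n : B v)
    (X : Matrix (Cfg B) (Cfg B) ℂ) (f g : Cfg B) :
    conjBy (lift (fun _ : Unit => v) (ketZeroBra v n)) X f g =
      (if f v = 0 then 1 else 0) * X (splice (fun _ : Unit => v) f fun _ => n)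
        (splice (fun _ : Unit => v) g fun _ => n) * (if g v = 0 then 1 else 0) := by
  have hq : Function.Injective (fun _ : Unit => v) := Function.injective_of_subsingleton _
  have hne : ∀ (a r : Reg B (fun _ : Unit => v)), r ≠ (fun _ => n) → ketZeroBra v n a r = 0 := by
    intro a r hr
    unfold ketZeroBra
    exact if_neg fun h => hr (funext fun _ => h.2)
  have heq : ∀ a : Reg B (fun _ : Unit => v),
      ketZeroBra v n a (fun _ => n) = if a () = 0 then 1 else 0 := fun a => by
    simp [ketZeroBra]
  unfold conjBy
  rw [opMul_lift_conjTranspose hq, tsum_eq_single (fun _ => n), opMul_lift hq,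
    tsum_eq_single (fun _ => n), heq, heq]
  · congr 1
    split_ifs <;> simp
  · intro r hr
    rw [hne _ _ hr, zero_mul]
  · intro r hr
    rw [hne _ _ hr, star_zero, mul_zero]

theorem splice_of_eq {V : Type} {B : V → Type} {v : V} {f : Cfg B} {n : B v} (h : f v = n) :
    splice (fun _ : Unit => v) f (fun _ => n) = f := by
  subst h
  exact splice_eq_of_agree (Function.injective_of_subsingleton _) fun _ _ => rfl

/-- Only `n = 0` contributes to the defining sum. This covers the counter, whose initialization is
an infinite sum. -/
theorem sem_init_eq_self {V : Type} {B : V → Type} [∀ v, Zero (B v)] {k : ℕ} (θ : Fin k → ℝ)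
    (v : V) {X : Matrix (Cfg B) (Cfg B) ℂ} (hX : ∀ f g, X f g ≠ 0 → f v = 0 ∧ g v = 0) :
    (Prog.init v : Prog B k).sem θ X = X := by
  have hq : Function.Injective (fun _ : Unit => v) := Function.injective_of_subsingleton _
  ext f g
  simp only [Prog.sem, conjBy_ketZeroBra]
  rw [tsum_eq_single 0]
  · by_cases hf : f v = 0
    · by_cases hg : g v = 0
      · rw [if_pos hf, if_pos hg, one_mul, mul_one]
        congr 1
        · exact splice_of_eq hf
        · exact splice_of_eq hg
      · rw [if_neg hg, mul_zero]
        exact (not_not.1 fun h => hg (hX f g h).2).symm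
    · rw [if_neg hf, zero_mul, zero_mul]
      exact (not_not.1 fun h => hf (hX f g h).1).symm
  · intro n hn
    have : X (splice (fun _ : Unit => v) f fun _ => n) (splice (fun _ : Unit => v) g fun _ => n)
        = 0 := by
      by_contra h
      refine hn ?_
      rw [← (hX _ _ h).1]
      exact (splice_apply hq f (fun _ => n) ()).symm
    rw [this, mul_zero, zero_mul]

section Final

variable {Q : Type} {B : Q → Type} [∀ q, Zero (B q)] {k : ℕ}

theorem extendState_ne_zero {ρ : Matrix (Cfg B) (Cfg B) ℂ} {f g : Cfg (DBasis B)}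
    (h : extendState ρ f g ≠ 0) {v : DVar Q} (hv : ∀ q, DVar.orig q ≠ v) : f v = 0 ∧ g v = 0 := by
  by_contra hcon
  exact h (if_neg fun h' => hcon (h' v hv))

/-- The family that consists of `ρ` at the index `0`. -/
def atZero (ρ : Matrix (Cfg B) (Cfg B) ℂ) (m : ℕ) : Matrix (Cfg B) (Cfg B) ℂ :=
  if m = 0 then ρ else 0

theorem extendState_eq_form (μ : ℕ → ℝ) (ρ : Matrix (Cfg B) (Cfg B) ℂ) :
    extendState ρ =
      form (fun m s s' => if s = 0 ∧ s' = 0 then (survival μ (m + 1) : ℂ) else 0) (atZero ρ) := by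
  ext f g
  unfold extendState
  by_cases h : ∀ v : DVar Q, (∀ q, DVar.orig q ≠ v) → f v = 0 ∧ g v = 0
  · rw [if_pos h]
    have hc := h .qc (by simp)
    have h2 := h .q2 (by simp)
    have hidle : IdlePair f g :=
      ⟨hc.1.trans hc.2.symm, hc.1.ge, (h .q1 (by simp)).1, (h .q1 (by simp)).2,
        fun p => (h (.copy p) (by simp)).1, fun p => (h (.copy p) (by simp)).2⟩
    rw [form_of_idlePair _ _ hidle (m := 0) hc.1, if_pos h2]
    -- The coefficient at `m = 0` is `survival μ 1`, an empty sum subtracted from 1.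
    simp [survival, atZero]
  · rw [if_neg h]
    by_cases hidle : IdlePair f g
    · obtain ⟨m, hm⟩ := Int.eq_ofNat_of_zero_le hidle.2.1
      rw [form_of_idlePair _ _ hidle hm]
      by_cases h2 : (f .q2 : Fin 2) = 0 ∧ (g .q2 : Fin 2) = 0
      · have hm0 : m ≠ 0 := by
          rintro rfl
          refine h fun v hv => ?_
          obtain ⟨e, -, hf1, hg1, hfc, hgc⟩ := hidle
          cases v with
          | orig q => exact absurd rfl (hv q)
          | copy q => exact ⟨hfc q, hgc q⟩
          | q1 => exact ⟨hf1, hg1⟩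
          | q2 => exact h2
          | qc => exact ⟨hm, e.symm.trans hm⟩
        simp [atZero, hm0]
      · rw [if_neg h2, zero_mul]
    · rw [form_of_not_idlePair _ _ hidle]

variable [Fintype Q] [DecidableEq Q] [∀ q, Fintype (B q)] [∀ q, DecidableEq (B q)]

/-- The state of the differential program after the initialization. -/
def DiffState.start {ρ : Matrix (Cfg B) (Cfg B) ℂ} (hρ : 0 ≤ ρ) : DiffState B where
  run := shift (atZero ρ)
  jumped := 0
  run_zero := rfl
  run_nonneg := by
    rintro (- | - | m)
    · exact le_rfl
    · exact hρ
    · exact le_rfl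
  state := ⟨fun _ _ h => (h rfl).elim, fun _ => le_rfl⟩
  flagged := fun _ _ h => (h rfl).elim

theorem sem_diffProg {μ : ℕ → ℝ} (θ : Fin k → ℝ) (j : Fin k) (P : Prog B k)
    {ρ : Matrix (Cfg B) (Cfg B) ℂ} (hρ : 0 ≤ ρ) :
    (diffProg μ j P).sem θ (extendState ρ) =
      (transform μ j P).sem θ ((DiffState.start hρ).toState μ) := by
  have hinit : ∀ v : DVar Q, (∀ q, DVar.orig q ≠ v) →
      (Prog.init v : Prog (DBasis B) k).sem θ (extendState ρ) = extendState ρ := fun v hv =>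
    sem_init_eq_self (B := DBasis B) θ v fun f g h => extendState_ne_zero h hv
  have h1 : (diffProg μ j P).sem θ (extendState ρ) = (transform μ j P).sem θ
      ((stepCounter B μ).sem θ ((Prog.init .qc).sem θ ((Prog.init .q2).sem θ
        ((Prog.init .q1).sem θ (extendState ρ))))) := rfl
  rw [h1, hinit .q1 (by simp), hinit .q2 (by simp), hinit .qc (by simp), extendState_eq_form μ,
    sem_stepCounter]
  congr 1
  exact (add_zero _).symm

/-- The initial potential at `m` is `μ m * tr ρ`, as all of `ρ` sits at counter 1. At the end the
unflagged part is subtracted, bounded below by the truncated semantics once `m` exceeds the number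
of gates passed. -/
theorem exists_sem_diffProg_eq {μ : ℕ → ℝ} (hμ : IsRateDistribution μ) (θ : Fin k → ℝ) (j : Fin k)
    {P : Prog B k} (hP : P.WellFormed) {ρ : Matrix (Cfg B) (Cfg B) ℂ} (hρ : 0 ≤ ρ) :
    ∃ s : DiffState B, (diffProg μ j P).sem θ (extendState ρ) = s.toState μ ∧
      (∀ m : ℕ, 1 ≤ m → weight m s.jumped ≤ μ m * rtr ρ) ∧
      ∀ n m : ℕ, P.boundedCount j n + 1 ≤ m →
        weight m s.jumped ≤ μ m * (rtr ρ - rtr (P.boundedSem θ n ρ)) := by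
  obtain ⟨s, e, hp, hl⟩ := simulates_transform hμ θ j hP (DiffState.start hρ)
  have hstart : ∀ m : ℕ, 1 ≤ m → (DiffState.start hρ).potential μ m = μ m * rtr ρ := by
    intro m hm
    obtain ⟨m, rfl⟩ := Nat.exists_eq_add_of_le hm
    have h0 : weight (1 + m : ℕ) (0 : Matrix (Cfg (DBasis B)) (Cfg (DBasis B)) ℂ) = 0 := rtr_zero
    simp only [DiffState.potential, DiffState.start]
    rw [h0, if_pos (by omega), Int.toNat_natCast, zero_add, show 1 + m + 1 = m + 2 by omega,
      Finset.sum_range_succ', Finset.sum_range_succ']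
    simp [shift, atZero]
  have hpot : ∀ m : ℕ, 1 ≤ m → weight m s.jumped +
      μ m * ∑ i ∈ Finset.range (m + 1), rtr (s.run i) ≤ μ m * rtr ρ := by
    intro m hm
    have h := hp m
    rw [hstart m hm, DiffState.potential, if_pos (by omega), Int.toNat_natCast] at h
    exact h
  refine ⟨s, (sem_diffProg θ j P hρ).trans e, fun m hm => ?_, fun n m hm => ?_⟩
  · exact (s.weight_le_potential hμ m).trans ((hp m).trans_eq (hstart m hm))
  · have h1 := hl n 2
    have h2 : ∑ i ∈ Finset.range 2, (DiffState.start hρ).run i = ρ := by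
      simp [Finset.sum_range_succ, DiffState.start, shift, atZero]
    rw [h2] at h1
    have h3 := rtr_mono (h1.trans (s.sum_run_mono (show 2 + P.boundedCount j n ≤ m + 1 by omega)))
    rw [rtr_sum] at h3
    have h4 := hpot m (by omega)
    have h5 := mul_le_mul_of_nonneg_left h3 (hμ.pos m (by omega)).le
    linarith

end Final

/-! ### The expectation of the observable -/

theorem mul_self_le_sq_maxAbsEigenvalue {I : Type} [Fintype I] [DecidableEq I] {O : Matrix I I ℂ}
    (hO : O.IsHermitian) : O * O ≤ (maxAbsEigenvalue hO ^ 2) • (1 : Matrix I I ℂ) := by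
  rw [Matrix.le_iff]
  set U : Matrix I I ℂ := hO.eigenvectorUnitary.1 with hU
  set D : Matrix I I ℂ := Matrix.diagonal fun i => (hO.eigenvalues i : ℂ) with hD
  have h1 : U * U.conjTranspose = 1 := Unitary.mul_star_self_of_mem hO.eigenvectorUnitary.2
  have h2 : U.conjTranspose * U = 1 := Unitary.star_mul_self_of_mem hO.eigenvectorUnitary.2
  have h3 : O = U * D * U.conjTranspose := hO.spectral_theorem
  have h4 : O * O = U * (D * D) * U.conjTranspose := by
    calc O * O = U * D * (U.conjTranspose * U) * D * U.conjTranspose := by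
          rw [h3]; simp only [Matrix.mul_assoc]
      _ = _ := by rw [h2, Matrix.mul_one, Matrix.mul_assoc U D D]
  have key : maxAbsEigenvalue hO ^ 2 • (1 : Matrix I I ℂ) - O * O = U *
      Matrix.diagonal (fun i => ((maxAbsEigenvalue hO ^ 2 - hO.eigenvalues i ^ 2 : ℝ) : ℂ)) *
      U.conjTranspose := by
    have h5 : Matrix.diagonal
        (fun i => ((maxAbsEigenvalue hO ^ 2 - hO.eigenvalues i ^ 2 : ℝ) : ℂ)) =
        maxAbsEigenvalue hO ^ 2 • (1 : Matrix I I ℂ) - D * D := by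
      rw [hD, Matrix.diagonal_mul_diagonal]
      ext i k
      by_cases hik : i = k <;> simp [hik, sq]
    rw [h5, mul_sub, sub_mul, h4]
    simp [h1]
  rw [key]
  refine Matrix.PosSemidef.mul_mul_conjTranspose_same (Matrix.PosSemidef.diagonal fun i => ?_) _
  have h6 : |hO.eigenvalues i| ≤ maxAbsEigenvalue hO :=
    le_ciSup (f := fun i => |hO.eigenvalues i|) (Set.finite_range _).bddAbove i
  have h7 : hO.eigenvalues i ^ 2 ≤ maxAbsEigenvalue hO ^ 2 := by
    rw [← sq_abs]
    exact pow_le_pow_left₀ (abs_nonneg _) h6 2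
  exact Complex.zero_le_real.2 (sub_nonneg.2 h7)

section Expectation

variable {Q : Type} {B : Q → Type} [Fintype Q] [DecidableEq Q] [∀ q, Fintype (B q)]
  [∀ q, DecidableEq (B q)] {μ : ℕ → ℝ}

theorem obsSq_qc_eq (O : Matrix (Cfg B) (Cfg B) ℂ) (f g : Cfg (DBasis B))
    (h : obsSq μ O f g ≠ 0) : f .qc = g .qc := by
  by_contra hcon
  exact h (if_neg fun h' => hcon h'.1)

theorem obsD_sq_le (z : ℤ) (s₁ s₂ : Fin 2) : obsD μ z s₁ s₂ ^ 2 ≤ 4 / μ z.toNat ^ 2 := by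
  unfold obsD
  split_ifs
  · exact le_of_eq (by ring)
  · exact le_of_eq (by ring)
  · rw [zero_pow two_ne_zero]
    positivity

/-- With `d` the diagonal of `O_d²` and `c` its bound, `M² c - d ⊗ O² = d ⊗ (M² - O²) + M² (c - d) ⊗
1`, and both summands are positive. -/
theorem block_obsSq_le (z : ℤ) [DecidableEq (Block B z)] {O : Matrix (Cfg B) (Cfg B) ℂ}
    (hO : O.IsHermitian) :
    block z (obsSq μ O) ≤
      (maxAbsEigenvalue hO ^ 2 * (4 / μ z.toNat ^ 2)) • (1 : Matrix (Block B z) (Block B z) ℂ) := by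
  set M := maxAbsEigenvalue hO
  set c := 4 / μ z.toNat ^ 2
  let d : Fin 2 × Fin 2 × Cfg B → ℝ := fun u => obsD μ z u.1 u.2.1 ^ 2
  have hd0 : ∀ u, 0 ≤ d u := fun u => sq_nonneg _
  have hdc : ∀ u, d u ≤ c := fun u => obsD_sq_le z _ _
  have h1 : (Matrix.kronecker (Matrix.diagonal fun u => ((d u : ℝ) : ℂ))
      (M ^ 2 • (1 : Matrix (Cfg B) (Cfg B) ℂ) - O * O)).PosSemidef :=
    (Matrix.PosSemidef.diagonal fun u => by simpa using hd0 u).kronecker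
      (Matrix.le_iff.1 (mul_self_le_sq_maxAbsEigenvalue hO))
  have h2 : (Matrix.kronecker (Matrix.diagonal fun u => ((M ^ 2 * (c - d u) : ℝ) : ℂ))
      (1 : Matrix (Cfg B) (Cfg B) ℂ)).PosSemidef :=
    (Matrix.PosSemidef.diagonal fun u => by
      have := mul_nonneg (sq_nonneg M) (sub_nonneg.2 (hdc u))
      exact Complex.zero_le_real.2 this).kronecker Matrix.PosSemidef.one
  let φ : Block B z → (Fin 2 × Fin 2 × Cfg B) × Cfg B := fun f =>
    ((f.1 DVar.q1, f.1 DVar.q2, fun q => f.1 (DVar.copy q)), fun q => f.1 (DVar.orig q))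
  have hφ : Function.Injective φ := by
    intro f g h
    simp only [φ, Prod.mk.injEq] at h
    obtain ⟨⟨h1, h2, h3⟩, h4⟩ := h
    refine Subtype.ext (funext fun v => ?_)
    cases v with
    | orig q => exact congrFun h4 q
    | copy q => exact congrFun h3 q
    | q1 => exact h1
    | q2 => exact h2
    | qc => exact f.2.trans g.2.symm
  rw [Matrix.le_iff]
  refine (congrArg Matrix.PosSemidef ?_).mpr ((h1.add h2).submatrix φ)
  ext f g
  have hone : (1 : Matrix (Block B z) (Block B z) ℂ) f g =
      (if (φ f).1 = (φ g).1 then 1 else 0) * (1 : Matrix (Cfg B) (Cfg B) ℂ) (φ f).2 (φ g).2 := by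
    by_cases h : f = g
    · subst h
      rw [Matrix.one_apply_eq, Matrix.one_apply_eq, if_pos rfl, mul_one]
    · rw [Matrix.one_apply_ne h]
      by_cases hu : (φ f).1 = (φ g).1
      · rw [Matrix.one_apply_ne fun hx => h (hφ (Prod.ext hu hx)), mul_zero]
      · rw [if_neg hu, zero_mul]
  have hkron : ∀ (v : Fin 2 × Fin 2 × Cfg B → ℂ) (K : Matrix (Cfg B) (Cfg B) ℂ) a b,
      Matrix.kronecker (Matrix.diagonal v) K a b = (if a.1 = b.1 then v a.1 else 0) * K a.2 b.2 :=
    fun _ _ _ _ => rfl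
  have hA : block z (obsSq μ O) f g =
      (if (φ f).1 = (φ g).1 then (d (φ f).1 : ℂ) else 0) * (O * O) (φ f).2 (φ g).2 := by
    have hiff : (f.1 .qc = g.1 .qc ∧ f.1 .q1 = g.1 .q1 ∧ f.1 .q2 = g.1 .q2 ∧
        ∀ q, f.1 (.copy q) = g.1 (.copy q)) ↔ (φ f).1 = (φ g).1 := by
      simp only [φ, Prod.mk.injEq, f.2, g.2, true_and, funext_iff]
    simp only [block, Matrix.submatrix_apply, obsSq]
    by_cases h : (φ f).1 = (φ g).1
    · rw [if_pos (hiff.2 h), if_pos h, f.2]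
    · rw [if_neg (fun h' => h (hiff.1 h')), if_neg h, zero_mul]
  simp only [Matrix.sub_apply, Matrix.smul_apply, Matrix.submatrix_apply, Matrix.add_apply,
    hkron, hone, hA]
  by_cases h : (φ f).1 = (φ g).1
  · simp only [if_pos h, Complex.real_smul]
    push_cast
    ring
  · simp [if_neg h]

variable [∀ q, Zero (B q)]

/-- The unflagged part has `q₁ = 0`, where `O_d` vanishes: only jumped states contribute. -/
theorem block_obsSq_mul_runState (z : ℤ) (O : Matrix (Cfg B) (Cfg B) ℂ)
    (r : ℕ → Matrix (Cfg B) (Cfg B) ℂ) :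
    block z (obsSq μ O) * block z (runState μ r) = 0 := by
  ext f g
  rw [Matrix.mul_apply]
  refine Finset.sum_eq_zero fun h _ => ?_
  by_cases hi : IdlePair h.1 g.1
  · have h1 : (h.1 .q1 : Fin 2) = 0 := hi.2.2.1
    refine mul_eq_zero_of_left ?_ _
    simp only [block, Matrix.submatrix_apply, obsSq]
    split_ifs with hc
    · have h2 : (f.1 .q1 : Fin 2) = 0 := hc.2.1.trans h1
      simp [obsD, h2]
    · rfl
  · have h0 : runState μ r h.1 g.1 = 0 := form_of_not_idlePair _ _ hi
    exact mul_eq_zero_of_right _ h0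

theorem expectation_toState_le {O : Matrix (Cfg B) (Cfg B) ℂ} (hO : O.IsHermitian)
    (s : DiffState B) :
    expectation (obsSq μ O) (s.toState μ) ≤ ∑' m : ℕ, ENNReal.ofReal
      (maxAbsEigenvalue hO ^ 2 * (4 / μ (m + 1) ^ 2) * weight (m + 1 : ℕ) s.jumped) := by
  classical
  have hz : ∀ z : ℤ, ∑' f : {f : Cfg (DBasis B) // f DVar.qc = z},
      opMul (obsSq μ O) (s.toState μ) f.1 f.1 =
        (block z (obsSq μ O) * block z s.jumped).trace := by
    intro z
    have h1 : block z (opMul (obsSq μ O) (s.toState μ)) =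
        block z (obsSq μ O) * block z s.jumped := by
      rw [block_opMul (obsSq_qc_eq O), DiffState.toState, block_add, mul_add,
        block_obsSq_mul_runState, zero_add]
    rw [← h1, Matrix.trace, ← tsum_fintype (L := .unconditional _)]
    rfl
  unfold expectation
  simp only [hz]
  have hinj : Function.Injective fun m : ℕ => ((m + 1 : ℕ) : ℤ) := fun a b h => by
    simpa using h
  -- `O_d` vanishes on counters `z ≤ 0`, so the sum over `ℤ` is one over `z = m + 1`.
  rw [← hinj.tsum_eq]
  · refine ENNReal.tsum_le_tsum fun m => ENNReal.ofReal_le_ofReal ?_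
    have h1 := rtr_mul_le_of_le_smul_one (block_obsSq_le (μ := μ) ((m + 1 : ℕ) : ℤ) hO)
      (s.state.nonneg _)
    rw [Int.toNat_natCast] at h1
    exact h1
  · intro z hne
    by_contra hcon
    refine hne ?_
    have hz0 : ¬ 1 ≤ z := fun h => hcon ⟨(z - 1).toNat, by simp only; omega⟩
    have h0 : block z (obsSq μ O) = 0 := by
      ext f g
      simp only [block, Matrix.submatrix_apply, obsSq, f.2]
      simp [obsD, hz0]
    simp [h0]

end Expectation

/-! ### Assembling the bound -/

section Variance

variable {Q : Type} {B : Q → Type} [Fintype Q] [DecidableEq Q] [∀ q, Fintype (B q)]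
  [∀ q, DecidableEq (B q)] [∀ q, Zero (B q)] {k : ℕ}

theorem expectation_diffProg_le {P : Prog B k} (hP : P.WellFormed) {θ : Fin k → ℝ} (j : Fin k)
    {O : Matrix (Cfg B) (Cfg B) ℂ} (hO : O.IsHermitian)
    {ρ : Matrix (Cfg B) (Cfg B) ℂ} (hρ : IsPartialDensity ρ)
    {μ : ℕ → ℝ} (hμ : IsRateDistribution μ) (hterm : ∀ W ∈ P.loops, TerminatesAS θ W)
    {ε : ℝ} (hε0 : 0 < ε) (hε1 : ε < 1) {N : ℕ} (hdec : ∀ W ∈ P.loops, LoopDecay θ ε N W) :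
    expectation (obsSq μ O) ((diffProg μ j P).sem θ (extendState ρ)) ≤
      varianceBound μ (maxAbsEigenvalue hO) (P.runCount j) P.loopCount ε N := by
  have hρ0 : 0 ≤ ρ := Matrix.nonneg_iff_posSemidef.2 hρ.1
  have hR0 := rtr_nonneg hρ0
  have hR1 : rtr ρ ≤ 1 := hρ.2
  obtain ⟨s, e, hw, hwn⟩ := exists_sem_diffProg_eq hμ θ j hP hρ0
  set M := maxAbsEigenvalue hO
  set b := P.loopCount
  set c := P.runCount j
  -- Dividing by `μ` removes one of the two factors `1 / μ` of `O_d²`; what remains is a tail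
  -- probability bounded by 1.
  set t : ℕ → ℝ := fun m => weight (m + 1 : ℕ) s.jumped / μ (m + 1) with ht
  set p : ℕ → ℝ := fun n => rtr (P.boundedSem θ n ρ) with hp
  have hpos : ∀ m : ℕ, 0 < μ (m + 1) := fun m => hμ.pos _ (Nat.succ_pos m)
  have htail := tsum_tail_le hμ (t := t) (p := p) (R := rtr ρ) b c
    (fun m => (div_le_one (hpos m)).2 ((hw _ (Nat.succ_pos m)).trans
      (mul_le_of_le_one_right (hpos m).le hR1)))
    (fun n n' h => rtr_mono (boundedSem_mono θ h hP hρ0))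
    (fun δ hδ => by
      obtain ⟨n₀, hn₀⟩ := exists_sub_rtr_boundedSem_le hP hterm hδ
      exact ⟨n₀, fun n hn => (hn₀ n hn hρ0).trans (mul_le_of_le_one_right hδ.le hR1)⟩)
    (fun n m hn hm => (div_le_iff₀' (hpos m)).2 (hwn n (m + 1)
      (Nat.succ_le_succ ((P.boundedCount_le j hn).trans hm))))
  have hterms : ∀ i : ℕ, ENNReal.ofReal (p (i + 2) - p (i + 1)) *
      ENNReal.ofReal (4 * recipSum μ ((i + 2) ^ b * c)) ≤
        ENNReal.ofReal (boundTerm μ c b ε N (i + 1 + 1)) := by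
    intro i
    rw [← ENNReal.ofReal_mul (sub_nonneg.2 (rtr_mono (boundedSem_mono θ (Nat.le_succ _) hP hρ0)))]
    refine ENNReal.ofReal_le_ofReal (mul_recipSum_le_boundTerm hμ hε0 hε1 (Nat.succ_pos i)
      (D := P.loopEntries (i + 1)) ?_ ?_ (Prog.loopEntries_le (Nat.succ_pos i) P))
    · refine (rtr_boundedSem_succ_sub_le hε0.le N (i + 1) hP hdec hρ0).trans ?_
      exact mul_le_of_le_one_right (by positivity) hR1
    · intro hb
      have h := Prog.loopEntries_le_geom (Nat.succ_pos i) P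
      rw [show P.loopCount = 0 from hb] at h
      simpa using h
  rw [e]
  refine (expectation_toState_le hO s).trans ?_
  calc ∑' m : ℕ, ENNReal.ofReal (M ^ 2 * (4 / μ (m + 1) ^ 2) * weight (m + 1 : ℕ) s.jumped)
      = ENNReal.ofReal (M ^ 2) *
          ∑' m : ℕ, ENNReal.ofReal (4 / μ (m + 1)) * ENNReal.ofReal (t m) := by
        rw [← ENNReal.tsum_mul_left]
        refine tsum_congr fun m => ?_
        have := hpos m
        rw [← ENNReal.ofReal_mul (by positivity), ← ENNReal.ofReal_mul (sq_nonneg M), ht]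
        congr 1
        field_simp
    _ ≤ _ := by
        refine mul_le_mul_right (htail.trans (add_le_add_right ?_ _)) _
        -- The increments start with `p 2 - p 1`, matched with the summand `k = 2`; the summand `k =
        -- 1` of the bound is not needed.
        exact (ENNReal.tsum_le_tsum hterms).trans (ENNReal.tsum_comp_le_tsum_of_injective
          (add_left_injective 1) fun i => ENNReal.ofReal (boundTerm μ c b ε N (i + 1)))

end Variance

end QWhile

end

end

theorem theoremB3 {Q : Type} [Fintype Q] [DecidableEq Q] (B : Q → Type)
    [∀ q, Fintype (B q)] [∀ q, DecidableEq (B q)] [∀ q, Zero (B q)] {k : ℕ}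
    (P : QWhile.Prog B k) (hP : P.WellFormed) (θ : Fin k → ℝ) (j : Fin k)
    (O : Matrix (QWhile.Cfg B) (QWhile.Cfg B) ℂ) (hO : O.IsHermitian)
    (ρ : Matrix (QWhile.Cfg B) (QWhile.Cfg B) ℂ) (hρ : QWhile.IsPartialDensity ρ)
    (μ : ℕ → ℝ) (hμ : QWhile.IsRateDistribution μ)
    (hterm : ∀ W ∈ P.loops, QWhile.TerminatesAS θ W)
    (ε : ℝ) (hε0 : 0 < ε) (hε1 : ε < 1) :
    (∃ N : ℕ, 0 < N ∧ ∀ W ∈ P.loops, QWhile.LoopDecay θ ε N W) ∧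
    ∀ N : ℕ, 0 < N → (∀ W ∈ P.loops, QWhile.LoopDecay θ ε N W) →
      QWhile.expectation (QWhile.obsSq μ O)
          ((QWhile.diffProg μ j P).sem θ (QWhile.extendState ρ))
        ≤ QWhile.varianceBound μ (QWhile.maxAbsEigenvalue hO)
            (P.runCount j) P.loopCount ε N :=
  ⟨(QWhile.exists_loopDecay hε0 hP hterm).imp fun N h => ⟨h.1, h.2 N le_rfl⟩,
    fun _ _ hdec => QWhile.expectation_diffProg_le hP j hO hρ hμ hterm hε0 hε1 hdec⟩
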